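/- Let $J=(J_t)_{t\ge 0}$ be a finite-mean subordinator with respect to a filtration $(\mathcal F_t)_{t\ge0}$ on a probability space $(\Omega,\mathcal F,P)$ (adapted, nondecreasing, right-continuous, $J_0=0$, with stationary increments independent of the past), with exponent $\eta$, i.e. $Ee^{-\alpha J_t}=e^{-\eta(\alpha)t}$ for $\alpha,t\ge0$, and mean $\rho=EJ_1$. Let $\tau$ be a stopping time with $E\tau<\infty$ such that $V:=J_\tau>0$ a.s., and let $R$ be an $\mathcal F_\tau$-measurable random variable (the output rate chosen at time $\tau$) with $R>\rho$ a.s. and $E\frac{V}{R-\rho}<\infty$. During $[0,\tau)$ (the off period) the workload is $J_t$; from $\tau$ on (the on period) it is $J_{\tau+s}-Rs$, $s\ge 0$, until the first time $s=T$ at which it hits $0$, when the cycle ends. Consider the regenerative storage system whose successive cycles are independent copies of this one, and let $Y$ be its workload process restricted to the on periods, i.e. the on-period workload paths of the successive cycles put one after the other. Then $Y$ has a unique steady-state distribution, that is, a unique probability law $\pi$ such that for every bounded continuous $f$ one has $\frac1t\int_0^t f(Y_s)\,ds\to\int f\,d\pi$ a.s. as $t\to\infty$; it is carried by $[0,\infty)$,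 and its Laplace–Stieltjes transform $\tilde Y(\alpha)=\int e^{-\alpha x}\,\pi(dx)$ is $$\tilde Y(\alpha)=\frac{E\left[\frac{1-e^{-\alpha V}}{\alpha R-\eta(\alpha)}\right]}{E\left[\frac{V}{R-\rho}\right]},\qquad \alpha\ge0,$$ where at $\alpha=0$ the ratio $\frac{1-e^{-\alpha V}}{\alpha R-\eta(\alpha)}$ is read as its limit $\frac{V}{R-\rho}$. Moreover, let $U,N,e_1,e_2,\dots$ be random variables, defined together with $(V,R)$ (or with a pair having the same joint law) on a probability space, such that $U$ is uniform on $[0,1]$; the $e_i$ are i.i.d. and nonnegative with $Ee^{-\alpha e_i}=\frac{\eta(\alpha)}{\rho\alpha}$ for $\alpha>0$; $N\ge0$ is integer valued and, conditionally on $(V,R)$, $N+1$ is geometric on $\{1,2,\dots\}$ with success probability $1-\rho/R$, i.e. $P(N=n\mid V,R)=(1-\frac{\rho}{R})(\frac{\rho}{R})^n$ for $n\ge 0$; and $U,e_1,e_2,\dots,(V,R,N)$ are mutually independent. Then $$\tilde Y(\alpha)=E_{V,R}\exp\left\{-\alpha\left(UV+\sum_{i=1}^Ne_i\right)\right\},\qquad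 \alpha\ge0,$$ where $E_{V,R}$ is the expectation under the size-biased measure $P_{V,R}(A)=E\left[\frac{V}{R-\rho}1_A\right]/E\left[\frac{V}{R-\rho}\right]$. -/

import Mathlib

open MeasureTheory ProbabilityTheory Filter Topology
open scoped NNReal ENNReal BoundedContinuousFunction

namespace LevyStorage

noncomputable section

/-- `J` is a subordinator with respect to the filtration `F`: an adapted nondecreasing
right-continuous process that starts at the origin, whose increments are stationary and
independent of the past. -/
structure IsSubordinator {Ω : Type*} [mΩ : MeasurableSpace Ω] (P : Measure Ω)
    (F : Filtration ℝ≥0 mΩ) (J : ℝ≥0 → Ω → ℝ) : Prop where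
  adapted : ∀ t, Measurable[F t] (J t)
  zero : ∀ ω, J 0 ω = 0
  mono : ∀ ω, Monotone fun t => J t ω
  rightCont : ∀ ω t, ContinuousWithinAt (fun s => J s ω) (Set.Ioi t) t
  stationary : ∀ s h, IdentDistrib (fun ω => J (s + h) ω - J s ω) (J h) P P
  indep : ∀ s h,
    Indep (MeasurableSpace.comap (fun ω => J (s + h) ω - J s ω) inferInstance) (F s) P

section Exponent

variable {Ω : Type*} [MeasurableSpace Ω]

/-- The exponent `η` of `J`, that is `E exp (-α J₁) = exp (-η α)`. -/
def exponent (P : Measure Ω) (J : ℝ≥0 → Ω → ℝ) (α : ℝ) : ℝ :=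
  -Real.log (∫ ω, Real.exp (-α * J 1 ω) ∂P)

/-- The mean input rate `ρ = E J₁`. -/
def meanRate (P : Measure Ω) (J : ℝ≥0 → Ω → ℝ) : ℝ := ∫ ω, J 1 ω ∂P

/-- The Laplace–Stieltjes transform at `α` of a law on `[0, ∞)`. -/
def lst (π : Measure ℝ) (α : ℝ) : ℝ := ∫ x, Real.exp (-α * x) ∂π

end Exponent

section Cycle

variable {Ω : Type*}

/-- The workload of the cycle `ω`, `s` time units after the beginning of its on period:
`J (τ + s) - R s`. -/
def onWorkload (J : ℝ≥0 → Ω → ℝ) (τ : Ω → WithTop ℝ≥0) (R : Ω → ℝ) (ω : Ω) (s : ℝ≥0) : ℝ :=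
  J ((τ ω).untopA + s) ω - R ω * s

/-- The length of the on period of the cycle `ω`: the first time at which the workload hits the
origin (`∞` if it never does). -/
def onLength (J : ℝ≥0 → Ω → ℝ) (τ : Ω → WithTop ℝ≥0) (R : Ω → ℝ) (ω : Ω) : ℝ≥0∞ :=
  ⨅ (s : ℝ≥0) (_ : onWorkload J τ R ω s = 0), (s : ℝ≥0∞)

/-- The total length of the first `n` on periods, when the `k`-th cycle is `ω k`. -/
def onEpoch (J : ℝ≥0 → Ω → ℝ) (τ : Ω → WithTop ℝ≥0) (R : Ω → ℝ) (ω : ℕ → Ω) (n : ℕ) : ℝ≥0∞ :=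
  ∑ k ∈ Finset.range n, onLength J τ R (ω k)

/-- The index of the on period in progress at time `t` of the clock that runs only during on
periods: the first `n` with `t < onEpoch (n + 1)`, so that `onEpoch n ≤ t < onEpoch (n + 1)`. -/
def onIndex (J : ℝ≥0 → Ω → ℝ) (τ : Ω → WithTop ℝ≥0) (R : Ω → ℝ) (ω : ℕ → Ω) (t : ℝ≥0) : ℕ :=
  sInf {n : ℕ | (t : ℝ≥0∞) < onEpoch J τ R ω (n + 1)}

/-- The workload process restricted to on periods (the off periods are cut out and the on periods
of the successive cycles `ω 0, ω 1, …` are put one after the other). -/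
def onProcess (J : ℝ≥0 → Ω → ℝ) (τ : Ω → WithTop ℝ≥0) (R : Ω → ℝ) (t : ℝ≥0) (ω : ℕ → Ω) : ℝ :=
  onWorkload J τ R (ω (onIndex J τ R ω t))
    (t - (onEpoch J τ R ω (onIndex J τ R ω t)).toNNReal)

end Cycle

/-- `π` is the steady-state law of the process `Y`: along almost every path the proportion of
time that `Y` spends in the different states converges weakly to `π`. -/
def IsSteadyStateLaw {S : Type*} [MeasurableSpace S] (Q : Measure S) (Y : ℝ≥0 → S → ℝ)
    (π : ProbabilityMeasure ℝ) : Prop :=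
  ∀ f : ℝ →ᵇ ℝ, ∀ᵐ ω ∂Q,
    Tendsto (fun t : ℝ => t⁻¹ * ∫ s in (0 : ℝ)..t, f (Y s.toNNReal ω)) atTop
      (𝓝 (∫ x, f x ∂(π : Measure ℝ)))

/-- The steady-state law of the on-period workload of the regenerative storage system whose
cycles are independent copies of the first one, which is described by `(J, τ, R)` under `P`. -/
def IsOnSteadyState {Ω : Type*} [MeasurableSpace Ω] (P : Measure Ω) (J : ℝ≥0 → Ω → ℝ)
    (τ : Ω → WithTop ℝ≥0) (R : Ω → ℝ) (π : ProbabilityMeasure ℝ) : Prop :=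
  IsSteadyStateLaw (Measure.infinitePi fun _ : ℕ => P) (onProcess J τ R) π

/-- `(1 - exp (-α v)) / (α r - η α)`, with its limit `v / (r - ρ)` as value at `α = 0`. -/
def onTransform (η : ℝ → ℝ) (ρ α v r : ℝ) : ℝ :=
  if α = 0 then v / (r - ρ) else (1 - Real.exp (-α * v)) / (α * r - η α)

/-- The size-biased measure `A ↦ E[V / (R - ρ) 1_A] / E[V / (R - ρ)]`. -/
def sizeBiased {Ω : Type*} [MeasurableSpace Ω] (P : Measure Ω) (ρ : ℝ) (V R : Ω → ℝ) :
    Measure Ω :=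
  (∫⁻ ω, ENNReal.ofReal (V ω / (R ω - ρ)) ∂P)⁻¹ •
    P.withDensity fun ω => ENNReal.ofReal (V ω / (R ω - ρ))

/-- The random variables of the decomposition: `U` is uniform on `[0, 1]`; given `(V, R)`,
`N + 1` is geometric on `{1, 2, …}` with success probability `1 - ρ / R`; the `e i` are
nonnegative with transform `η α / (ρ α)`; and `U, e 0, e 1, …, (V, R, N)` are independent. -/
structure IsDecomposition {Ω : Type*} [MeasurableSpace Ω] (P : Measure Ω) (η : ℝ → ℝ) (ρ : ℝ)
    (V R U : Ω → ℝ) (N : Ω → ℕ) (e : ℕ → Ω → ℝ) : Prop where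
  measurable_V : Measurable V
  measurable_R : Measurable R
  measurable_U : Measurable U
  measurable_N : Measurable N
  measurable_e : ∀ i, Measurable (e i)
  uniform : P.map U = volume.restrict (Set.Icc (0 : ℝ) 1)
  geometric : ∀ n : ℕ,
    P⟦N ⁻¹' {n} | MeasurableSpace.comap (fun ω => (V ω, R ω)) inferInstance⟧
      =ᵐ[P] fun ω => (1 - ρ / R ω) * (ρ / R ω) ^ n
  e_nonneg : ∀ i, ∀ᵐ ω ∂P, 0 ≤ e i ω
  e_lst : ∀ i, ∀ α : ℝ, 0 < α → ∫ ω, Real.exp (-α * e i ω) ∂P = η α / (ρ * α)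
  indep_e : iIndepFun e P
  indep_U_e : IndepFun U (fun ω i => e i ω) P
  indep_VRN : IndepFun (fun ω => (U ω, fun i => e i ω)) (fun ω => (V ω, R ω, N ω)) P

end

end LevyStorage

/-! By the strong Markov property, `shift J τ` (the input after `τ`) is again a subordinator with
exponent `η`, for a filtration that makes `V` and `R` known at time `0`. The on-period workload is
W_s = V + X_s - R s, which moves up by jumps and down at rate at most `R`.

The strong law of large numbers over i.i.d. cycles gives a renewal reward theorem: time averages of
f(Y) converge to E∫₀ᵀ f(W) ds / E T. Hence the steady-state law is the normalized occupation measure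
of one on period (`isSteadyStateLaw_stationaryLaw`), and its transform requires E∫₀ᵀ exp(-αW) ds and
E T.

Put φ = αR - η(α). Then exp(-αW_s) - φ∫₀ˢ exp(-αW) is a martingale, and W_T = 0, so stopping at T
gives exp(-αV) + φ E[∫₀ᵀ exp(-αW) | F_τ] = 1. Integrating against 1/φ yields E∫₀ᵀ exp(-αW) = E[(1 -
exp(-αV))/φ], and α → 0 gives E T = E[V/(R - ρ)]. The identity is proved on grids of mesh 1/(n+1),
where it is a telescoping sum (`lintegral_gridStop`), and then passed to the limit: first as an
inequality by Fatou, which bounds the mean of T, then as an equality by dominated convergence.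

Measurability is simpler for the first passage below zero (`negTime`) than for the first zero
(`hitTime`). The argument runs with the former; `ae_hitTime_eq_negTime` identifies the two almost
surely by comparing means.

The decomposition is a computation: UV has conditional transform (1 - exp(-αV))/(αV), the geometric
sum has (1 - ρ/R)/(1 - η(α)/(αR)), and their product with V/(R - ρ) is (1 - exp(-αV))/(αR - η(α)).
-/

namespace LevyStorage

noncomputable section

/-! ### Dyadic-style grids and joint measurability of right-continuous processes. -/

section Grid

/-- The first point strictly after `t` of the grid of mesh `1 / (n + 1)`. -/
def upperGrid (n : ℕ) (t : ℝ≥0) : ℝ≥0 := (⌊(n + 1 : ℝ≥0) * t⌋₊ + 1 : ℕ) / (n + 1 : ℝ≥0)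

lemma lt_upperGrid (n : ℕ) (t : ℝ≥0) : t < upperGrid n t := by
  unfold upperGrid
  rw [lt_div_iff₀ (by positivity), mul_comm]
  exact_mod_cast Nat.lt_floor_add_one ((n + 1 : ℝ≥0) * t)

lemma upperGrid_le (n : ℕ) (t : ℝ≥0) : upperGrid n t ≤ t + (n + 1 : ℝ≥0)⁻¹ := by
  unfold upperGrid
  rw [div_le_iff₀ (by positivity), add_mul t, inv_mul_cancel₀ (by positivity)]
  push_cast
  gcongr
  rw [mul_comm t]
  exact Nat.floor_le (by positivity)

lemma tendsto_inv_natCast_add_one :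
    Tendsto (fun n : ℕ => ((n : ℝ≥0) + 1)⁻¹) atTop (𝓝 0) := by
  rw [← NNReal.tendsto_coe]
  simpa using! tendsto_one_div_add_atTop_nhds_zero_nat (𝕜 := ℝ)

/-- The approach is strictly from the right because right continuity is assumed along `Set.Ioi t`.
-/
lemma tendsto_upperGrid (t : ℝ≥0) :
    Tendsto (fun n => upperGrid n t) atTop (𝓝[>] t) := by
  refine tendsto_nhdsWithin_iff.2 ⟨?_, Eventually.of_forall fun n => lt_upperGrid n t⟩
  refine tendsto_of_tendsto_of_tendsto_of_le_of_le tendsto_const_nhds ?_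
    (fun n => (lt_upperGrid n t).le) (fun n => upperGrid_le n t)
  simpa using tendsto_inv_natCast_add_one.const_add t

lemma measurable_upperGrid (n : ℕ) : Measurable (upperGrid n) := by
  unfold upperGrid
  fun_prop

/-- The last point before `t` of the grid of mesh `1 / (n + 1)`. -/
def lowerGrid (n : ℕ) (t : ℝ≥0) : ℝ≥0 := (⌊(n + 1 : ℝ≥0) * t⌋₊ : ℕ) / (n + 1 : ℝ≥0)

lemma lowerGrid_le (n : ℕ) (t : ℝ≥0) : lowerGrid n t ≤ t := by
  unfold lowerGrid
  rw [div_le_iff₀ (by positivity), mul_comm t]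
  exact Nat.floor_le (by positivity)

lemma lowerGrid_add_inv (n : ℕ) (t : ℝ≥0) :
    lowerGrid n t + (n + 1 : ℝ≥0)⁻¹ = upperGrid n t := by
  unfold lowerGrid upperGrid
  push_cast
  rw [add_div, one_div]

lemma tendsto_lowerGrid (t : ℝ≥0) :
    Tendsto (fun n => lowerGrid n t) atTop (𝓝 t) := by
  have h : ∀ n, lowerGrid n t = upperGrid n t - (n + 1 : ℝ≥0)⁻¹ := fun n => by
    rw [← lowerGrid_add_inv, add_tsub_cancel_right]
  simp_rw [h]
  simpa using ((tendsto_upperGrid t).mono_right nhdsWithin_le_nhds).sub tendsto_inv_natCast_add_one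

/-- A process with right-continuous paths is jointly measurable. -/
lemma measurable_uncurry_of_rightCont {Ω : Type*} [MeasurableSpace Ω] {X : ℝ≥0 → Ω → ℝ}
    (hX : ∀ t, Measurable (X t))
    (hc : ∀ ω t, ContinuousWithinAt (fun s => X s ω) (Set.Ioi t) t) :
    Measurable (Function.uncurry X) := by
  -- Sampling time at `upperGrid` leaves countably many values, so the approximants are jointly
  -- measurable, and right continuity makes them converge.
  refine measurable_of_tendsto_metrizable (f := fun n (p : ℝ≥0 × Ω) => X (upperGrid n p.1) p.2)
    (fun n => ?_) ?_
  · have h2 : Measurable fun p : ℕ × Ω => X ((p.1 + 1 : ℕ) / (n + 1 : ℝ≥0)) p.2 :=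
      measurable_from_prod_countable_right fun k => hX ((k + 1 : ℕ) / (n + 1 : ℝ≥0))
    have h3 : Measurable fun p : ℝ≥0 × Ω => (⌊(n + 1 : ℝ≥0) * p.1⌋₊, p.2) := by fun_prop
    exact h2.comp h3
  · rw [tendsto_pi_nhds]
    rintro ⟨t, ω⟩
    exact (hc ω t).tendsto.comp (tendsto_upperGrid t)

end Grid

/-! ### First passage times of a single workload path. -/

section Path

/-- A right-continuous path that starts in `[0, ∞)` and decreases at rate at most `r`. -/
structure IsWorkloadPath (w : ℝ≥0 → ℝ) (r : ℝ) : Prop where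
  rightCont : ∀ t, ContinuousWithinAt w (Set.Ioi t) t
  mono : Monotone fun s : ℝ≥0 => w s + r * s
  zero_nonneg : 0 ≤ w 0
  rate_pos : 0 < r

/-- The first time at which the path `w` becomes negative. -/
def negTime (w : ℝ≥0 → ℝ) : ℝ≥0∞ := ⨅ (s : ℝ≥0) (_ : w s < 0), (s : ℝ≥0∞)

/-- The first time at which the path `w` vanishes. -/
def hitTime (w : ℝ≥0 → ℝ) : ℝ≥0∞ := ⨅ (s : ℝ≥0) (_ : w s = 0), (s : ℝ≥0∞)

lemma nonneg_of_lt_negTime {w : ℝ≥0 → ℝ} {s : ℝ≥0} (h : (s : ℝ≥0∞) < negTime w) : 0 ≤ w s := by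
  by_contra! hs
  exact absurd (iInf₂_le s hs) (not_le.2 h)

variable {w : ℝ≥0 → ℝ} {r : ℝ}

lemma IsWorkloadPath.sub_le (hw : IsWorkloadPath w r) {s t : ℝ≥0} (hst : s ≤ t) :
    w s - r * (t - s) ≤ w t := by
  have := hw.mono hst
  simp only at this
  linarith

/-- There are no downward jumps: a path that is negative at `s` was already negative slightly
earlier, since it loses at most `r * (s - u)` on `[u, s]`. -/
lemma IsWorkloadPath.nonneg_of_le_negTime (hw : IsWorkloadPath w r) {s : ℝ≥0}
    (h : (s : ℝ≥0∞) ≤ negTime w) : 0 ≤ w s := by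
  rcases eq_or_ne s 0 with rfl | h0
  · exact hw.zero_nonneg
  have hs : 0 < s := pos_iff_ne_zero.2 h0
  by_contra! hneg
  have hr := hw.rate_pos
  obtain ⟨u, hu, hus⟩ : ∃ u : ℝ≥0, u < s ∧ r * (s - u) < - w s := by
    have hc : Tendsto (fun u : ℝ≥0 => r * ((s : ℝ) - u)) (𝓝[<] s) (𝓝 (r * ((s : ℝ) - s))) :=
      Continuous.continuousWithinAt (by fun_prop)
    have : (𝓝[<] s).NeBot := nhdsLT_neBot_of_exists_lt ⟨0, hs⟩
    have h1 := hc.eventually (gt_mem_nhds (show r * ((s : ℝ) - s) < - w s by simpa using hneg))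
    obtain ⟨u, h2, h3⟩ := (h1.and self_mem_nhdsWithin).exists
    exact ⟨u, h3, h2⟩
  have h1 := nonneg_of_lt_negTime ((ENNReal.coe_lt_coe.2 hu).trans_le h)
  have h2 := hw.sub_le hu.le
  linarith

/-- The path creeps through zero. A positive value would persist to the right by right continuity
and delay the passage; a negative one would need a downward jump. -/
lemma IsWorkloadPath.eq_zero_of_negTime_eq (hw : IsWorkloadPath w r) {t : ℝ≥0}
    (h : negTime w = t) : w t = 0 := by
  refine le_antisymm ?_ (hw.nonneg_of_le_negTime h.ge)
  by_contra! hpos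
  have h1 : ∀ᶠ s in 𝓝[>] t, 0 < w s := (hw.rightCont t).eventually (lt_mem_nhds hpos)
  obtain ⟨b, hb, hb'⟩ := (mem_nhdsGT_iff_exists_Ioo_subset).1 h1
  have : (b : ℝ≥0∞) ≤ negTime w := by
    refine le_iInf₂ fun s hs => ?_
    by_contra! hsb
    rw [ENNReal.coe_lt_coe] at hsb
    rcases lt_trichotomy s t with hst | rfl | hst
    · exact absurd (nonneg_of_lt_negTime (h ▸ ENNReal.coe_lt_coe.2 hst)) (not_le.2 hs)
    · exact absurd hs hpos.not_gt
    · exact absurd hs (not_lt.2 (le_of_lt (hb' ⟨hst, hsb⟩)))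
  rw [h, ENNReal.coe_le_coe] at this
  exact absurd hb (not_lt.2 this)

lemma IsWorkloadPath.hitTime_le_negTime (hw : IsWorkloadPath w r) : hitTime w ≤ negTime w := by
  cases h : negTime w with
  | top => exact le_top
  | coe t => exact iInf₂_le t (hw.eq_zero_of_negTime_eq h)

/-- When `w` vanishes, the copy lowered by `δ` is at `-δ`. This bounds hitting times from below by
passage times. -/
lemma negTime_le_hitTime_add {δ : ℝ} (hδ : 0 < δ) {w w' : ℝ≥0 → ℝ} (h : ∀ s, w s = w' s + δ) :
    negTime w' ≤ hitTime w :=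
  le_iInf₂ fun s hs => iInf₂_le s (by linarith [h s])

/-- By right continuity, a negative value at `s` forces negative values at dense times arbitrarily
close after `s`. The passage time is thus determined by countably many coordinates. -/
lemma le_negTime_iff (hc : ∀ t, ContinuousWithinAt w (Set.Ioi t) t) (t : ℝ≥0∞) :
    t ≤ negTime w ↔ ∀ i, w (TopologicalSpace.denseSeq ℝ≥0 i) < 0 →
      t ≤ TopologicalSpace.denseSeq ℝ≥0 i := by
  refine ⟨fun h i hi => h.trans (iInf₂_le (TopologicalSpace.denseSeq ℝ≥0 i) hi), fun h => le_iInf₂ fun s hs => ?_⟩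
  refine ENNReal.le_of_forall_pos_le_add fun ε hε _ => ?_
  have h1 : ∀ᶠ u in 𝓝[>] s, w u < 0 := (hc s).eventually (gt_mem_nhds hs)
  obtain ⟨b, hb, hb'⟩ := (mem_nhdsGT_iff_exists_Ioo_subset).1 h1
  obtain ⟨i, hu⟩ := (TopologicalSpace.denseRange_denseSeq ℝ≥0).exists_mem_open
    (isOpen_Ioo (a := s) (b := min b (s + ε)))
    (Set.nonempty_Ioo.2 (lt_min hb (lt_add_of_pos_right s hε)))
  refine (h i (hb' ⟨hu.1, hu.2.trans_le (min_le_left _ _)⟩)).trans ?_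
  exact_mod_cast (hu.2.trans_le (min_le_right _ _)).le

end Path

/-! ### Riemann sums and the stopped exponential along a single path. -/

section PathGrid

/-- `exp (-α w)` at the grid point `j / (n + 1)` if that point is not after `negTime w`. -/
def gridWeight (α : ℝ) (n : ℕ) (w : ℝ≥0 → ℝ) (j : ℕ) : ℝ≥0∞ :=
  if ((j / (n + 1) : ℝ≥0) : ℝ≥0∞) ≤ negTime w then
    ENNReal.ofReal (Real.exp (-α * w (j / (n + 1)))) else 0

/-- `exp (-α w)` at the grid point `(j + 1) / (n + 1)` if the preceding grid point is not after
`negTime w`. -/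
def gridNext (α : ℝ) (n : ℕ) (w : ℝ≥0 → ℝ) (j : ℕ) : ℝ≥0∞ :=
  if ((j / (n + 1) : ℝ≥0) : ℝ≥0∞) ≤ negTime w then
    ENNReal.ofReal (Real.exp (-α * w ((j + 1 : ℕ) / (n + 1)))) else 0

/-- `exp (-α w)` along the grid of mesh `1 / (n + 1)`, stopped at the first grid point after
`negTime w`. -/
def gridStop (α : ℝ) (n : ℕ) (w : ℝ≥0 → ℝ) : ℕ → ℝ≥0∞
  | 0 => ENNReal.ofReal (Real.exp (-α * w 0))
  | m + 1 => if ((m / (n + 1) : ℝ≥0) : ℝ≥0∞) ≤ negTime w then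
      ENNReal.ofReal (Real.exp (-α * w ((m + 1 : ℕ) / (n + 1)))) else gridStop α n w m

/-- `∫ exp (-α w)` over the time before `negTime w`. -/
def pathLaplace (α : ℝ) (w : ℝ≥0 → ℝ) : ℝ≥0∞ :=
  ∫⁻ s in Set.Ioi (0 : ℝ), if ENNReal.ofReal s < negTime w then
    ENNReal.ofReal (Real.exp (-α * w s.toNNReal)) else 0

/-- The Riemann sum of `exp (-α w)` over the grid of mesh `1 / (n + 1)` in `[0, n + 1)`, up to
`negTime w`. -/
def gridSum (α : ℝ) (n : ℕ) (w : ℝ≥0 → ℝ) : ℝ≥0∞ :=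
  (∑ j ∈ Finset.range ((n + 1) ^ 2), gridWeight α n w j) * ((n : ℝ≥0∞) + 1)⁻¹

variable {α : ℝ} {w : ℝ≥0 → ℝ} {r : ℝ}

lemma gridStop_eq_gridWeight (n m : ℕ) (h : ((m / (n + 1) : ℝ≥0) : ℝ≥0∞) ≤ negTime w) :
    gridStop α n w m = gridWeight α n w m := by
  rw [gridWeight, if_pos h]
  cases m with
  | zero => simp [gridStop]
  | succ m =>
    rw [gridStop, if_pos]
    refine le_trans ?_ h
    gcongr
    simp

/-- Pathwise form of optional stopping: the stopped value changes by `gridNext - gridWeight` at each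
step before passage and is constant afterwards. Both sides are sums because subtraction in `ℝ≥0∞`
truncates. -/
lemma gridStop_telescope (n m : ℕ) :
    ENNReal.ofReal (Real.exp (-α * w 0)) + ∑ j ∈ Finset.range m, gridNext α n w j =
      gridStop α n w m + ∑ j ∈ Finset.range m, gridWeight α n w j := by
  induction m with
  | zero => simp [gridStop]
  | succ m ih =>
    rw [Finset.sum_range_succ, Finset.sum_range_succ, ← add_assoc, ih]
    by_cases h : ((m / (n + 1) : ℝ≥0) : ℝ≥0∞) ≤ negTime w
    · rw [gridStop_eq_gridWeight n m h, gridStop, if_pos h, gridNext, if_pos h]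
      ring
    · rw [gridStop, if_neg h, gridNext, if_neg h, gridWeight, if_neg h, add_zero, add_zero]

/-- The last step may overshoot below zero, but by at most `r / (n + 1)`, the decrease possible
within one mesh. -/
lemma IsWorkloadPath.gridStop_le (hw : IsWorkloadPath w r) (hα : 0 ≤ α) (n m : ℕ) :
    gridStop α n w m ≤ ENNReal.ofReal (Real.exp (α * r * ((n : ℝ) + 1)⁻¹)) := by
  have hr := hw.rate_pos
  induction m with
  | zero =>
    rw [gridStop]
    refine ENNReal.ofReal_le_ofReal (Real.exp_le_exp.2 ?_)
    have : 0 ≤ α * r * ((n : ℝ) + 1)⁻¹ := by positivity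
    have := mul_nonneg hα hw.zero_nonneg
    linarith
  | succ m ih =>
    rw [gridStop]
    split_ifs with h
    · refine ENNReal.ofReal_le_ofReal (Real.exp_le_exp.2 ?_)
      have h1 := hw.nonneg_of_le_negTime h
      have h2 := hw.sub_le (s := m / (n + 1)) (t := (m + 1 : ℕ) / (n + 1)) (by gcongr; simp)
      have h3 : (((m + 1 : ℕ) / (n + 1) : ℝ≥0) : ℝ) - ((m / (n + 1) : ℝ≥0) : ℝ)
          = ((n : ℝ) + 1)⁻¹ := by
        push_cast
        field_simp
        ring
      rw [h3] at h2
      nlinarith [mul_nonneg hα (show 0 ≤ w ((m + 1 : ℕ) / (n + 1)) + r * ((n : ℝ) + 1)⁻¹ by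
        linarith)]
    · exact ih

lemma gridStop_of_lt (n : ℕ) {t : ℝ≥0} (ht : negTime w = t) {m : ℕ}
    (hm : ⌊(n + 1 : ℝ≥0) * t⌋₊ + 1 ≤ m) :
    gridStop α n w m = ENNReal.ofReal (Real.exp (-α * w (upperGrid n t))) := by
  induction m, hm using Nat.le_induction with
  | base =>
    rw [gridStop, if_pos, upperGrid]
    rw [ht, ENNReal.coe_le_coe]
    exact lowerGrid_le n t
  | succ m hm ih =>
    rw [gridStop, if_neg, ih]
    rw [ht, ENNReal.coe_le_coe, not_le]
    refine (lt_upperGrid n t).trans_le ?_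
    unfold upperGrid
    gcongr

/-- With `t` the passage time, the stopping point is eventually `upperGrid n t`, which decreases to
`t`, where the path is zero. The `(n + 1) ^ 2` steps cover time `n + 1`, eventually past `t`. -/
lemma IsWorkloadPath.tendsto_gridStop (hw : IsWorkloadPath w r) (hS : negTime w ≠ ⊤) :
    Tendsto (fun n : ℕ => gridStop α n w ((n + 1) ^ 2)) atTop (𝓝 1) := by
  obtain ⟨t, ht⟩ : ∃ t : ℝ≥0, negTime w = t := ⟨_, (ENNReal.coe_toNNReal hS).symm⟩
  have h1 : Tendsto (fun n : ℕ => ENNReal.ofReal (Real.exp (-α * w (upperGrid n t)))) atTop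
      (𝓝 1) := by
    have h2 : Tendsto (fun n : ℕ => w (upperGrid n t)) atTop (𝓝 0) := by
      rw [← hw.eq_zero_of_negTime_eq ht]
      exact (hw.rightCont t).tendsto.comp (tendsto_upperGrid t)
    have h3 := ENNReal.tendsto_ofReal ((Real.continuous_exp.tendsto _).comp (h2.const_mul (-α)))
    simpa using h3
  refine h1.congr' ?_
  filter_upwards [eventually_ge_atTop (⌈t⌉₊)] with n hn
  rw [gridStop_of_lt n ht]
  have h4 : t ≤ n := Nat.ceil_le.1 hn
  have h5 : ⌊(n + 1 : ℝ≥0) * t⌋₊ ≤ (n + 1) * n := by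
    refine Nat.floor_le_of_le ?_
    push_cast
    gcongr
  nlinarith

lemma lintegral_floor (n : ℕ) (f : ℕ → ℝ≥0∞) :
    ∫⁻ s in Set.Ioi (0 : ℝ), f ⌊((n : ℝ≥0) + 1) * s.toNNReal⌋₊ =
      (∑' j, f j) * ((n : ℝ≥0∞) + 1)⁻¹ := by
  have hm : Measurable fun s : ℝ => ⌊((n : ℝ≥0) + 1) * s.toNNReal⌋₊ := by fun_prop
  rw [← lintegral_map (f := f) (measurable_of_countable f) hm, lintegral_countable',
    ← ENNReal.tsum_mul_right]
  congr 1
  ext j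
  congr 1
  -- Adding the null point `0` turns every level set of the floor, including that of `j = 0`, into a
  -- half-open interval `Set.Ico` of length `1 / (n + 1)`.
  rw [Measure.map_apply hm (measurableSet_singleton j), Measure.restrict_congr_set (Ioi_ae_eq_Ici (a := (0 : ℝ))),
    Measure.restrict_apply (hm (measurableSet_singleton j))]
  have hset : (fun s : ℝ => ⌊((n : ℝ≥0) + 1) * s.toNNReal⌋₊) ⁻¹' {j} ∩ Set.Ici 0 =
      Set.Ico ((j : ℝ) / (n + 1)) ((j + 1 : ℝ) / (n + 1)) := by
    ext s
    simp only [Set.mem_inter_iff, Set.mem_preimage, Set.mem_singleton_iff, Set.mem_Ici,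
      Set.mem_Ico, Nat.floor_eq_iff (zero_le)]
    rw [div_le_iff₀ (by positivity), lt_div_iff₀ (by positivity)]
    constructor
    · rintro ⟨⟨h1, h2⟩, h3⟩
      rw [← NNReal.coe_le_coe] at h1
      rw [← NNReal.coe_lt_coe] at h2
      push_cast [Real.coe_toNNReal s h3] at h1 h2
      exact ⟨by linarith, by linarith⟩
    · rintro ⟨h1, h2⟩
      have h3 : 0 ≤ s := by
        by_contra! h
        have : s * (n + 1) < 0 := mul_neg_of_neg_of_pos h (by positivity)
        have : (0 : ℝ) ≤ j := by positivity
        linarith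
      refine ⟨⟨?_, ?_⟩, h3⟩
      · rw [← NNReal.coe_le_coe]
        push_cast [Real.coe_toNNReal s h3]
        linarith
      · rw [← NNReal.coe_lt_coe]
        push_cast [Real.coe_toNNReal s h3]
        linarith
  rw [hset, Real.volume_Ico, ← sub_div, add_sub_cancel_left, one_div,
    ENNReal.ofReal_inv_of_pos (by positivity), ENNReal.ofReal_add (by positivity) (by simp)]
  simp

/-- The sum is the integral of a step function, so Fatou and dominated convergence in the time
variable apply. -/
lemma gridSum_eq_lintegral (n : ℕ) : gridSum α n w = ∫⁻ s in Set.Ioi (0 : ℝ),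
    if ⌊((n : ℝ≥0) + 1) * s.toNNReal⌋₊ < (n + 1) ^ 2 ∧ (lowerGrid n s.toNNReal : ℝ≥0∞) ≤ negTime w
      then ENNReal.ofReal (Real.exp (-α * w (lowerGrid n s.toNNReal))) else 0 := by
  have := lintegral_floor n (fun j => if j < (n + 1) ^ 2 then gridWeight α n w j else 0)
  rw [gridSum, ← Finset.sum_congr rfl (g := gridWeight α n w) (fun j hj => if_pos (Finset.mem_range.1 hj)),
    ← tsum_eq_sum (L := .unconditional ℕ), ← this]
  · refine lintegral_congr fun s => ?_
    rw [ite_and]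
    rfl
  · intro j hj
    rw [if_neg]
    simpa using hj

/-- Adding `r * s` makes the path monotone, hence with countably many discontinuities. This is what
lets left grid points be used for a path that is only right-continuous. -/
lemma IsWorkloadPath.ae_continuousAt (hw : IsWorkloadPath w r) :
    ∀ᵐ s ∂(volume.restrict (Set.Ioi (0 : ℝ))), ContinuousAt w s.toNNReal := by
  have h1 := hw.mono.countable_not_continuousAt
  have h2 : ((fun s : ℝ≥0 => (s : ℝ)) '' {s : ℝ≥0 | ¬ ContinuousAt
    (fun s : ℝ≥0 => w s + r * s) s}).Countable := h1.image _
  rw [ae_restrict_iff' measurableSet_Ioi]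
  filter_upwards [h2.ae_notMem volume] with s hs hs0
  have h3 : ContinuousAt (fun s : ℝ≥0 => w s + r * s) s.toNNReal := by
    by_contra h
    exact hs ⟨s.toNNReal, h, Real.coe_toNNReal s (le_of_lt hs0)⟩
  have h4 := h3.sub (f := fun s : ℝ≥0 => w s + r * s) (g := fun s : ℝ≥0 => r * (s : ℝ))
    (by fun_prop)
  refine h4.congr (Eventually.of_forall fun s => ?_)
  simp

lemma eventually_floor_lt (s : ℝ≥0) : ∀ᶠ n : ℕ in atTop, ⌊((n : ℝ≥0) + 1) * s⌋₊ < (n + 1) ^ 2 := by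
  filter_upwards [eventually_ge_atTop (⌈s⌉₊)] with n hn
  have h4 : s ≤ n := Nat.ceil_le.1 hn
  have h5 : ⌊(n + 1 : ℝ≥0) * s⌋₊ ≤ (n + 1) * n := by
    refine Nat.floor_le_of_le ?_
    push_cast
    gcongr
  nlinarith

lemma measurable_lowerGrid_comp (n : ℕ) : Measurable fun s : ℝ =>
    if ⌊((n : ℝ≥0) + 1) * s.toNNReal⌋₊ < (n + 1) ^ 2 ∧ (lowerGrid n s.toNNReal : ℝ≥0∞) ≤ negTime w
      then ENNReal.ofReal (Real.exp (-α * w (lowerGrid n s.toNNReal))) else 0 := by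
  have hm : Measurable fun s : ℝ => ⌊((n : ℝ≥0) + 1) * s.toNNReal⌋₊ := by fun_prop
  exact (measurable_of_countable fun j : ℕ =>
    if j < (n + 1) ^ 2 ∧ ((j / (n + 1) : ℝ≥0) : ℝ≥0∞) ≤ negTime w
      then ENNReal.ofReal (Real.exp (-α * w (j / (n + 1)))) else 0).comp hm

lemma tendsto_lowerGrid_comp {s : ℝ} (hs : ContinuousAt w s.toNNReal)
    (hs' : (s.toNNReal : ℝ≥0∞) < negTime w) :
    Tendsto (fun n : ℕ => if ⌊((n : ℝ≥0) + 1) * s.toNNReal⌋₊ < (n + 1) ^ 2 ∧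
        (lowerGrid n s.toNNReal : ℝ≥0∞) ≤ negTime w
      then ENNReal.ofReal (Real.exp (-α * w (lowerGrid n s.toNNReal))) else 0) atTop
      (𝓝 (ENNReal.ofReal (Real.exp (-α * w s.toNNReal)))) := by
  have h2 : Tendsto (fun n : ℕ => w (lowerGrid n s.toNNReal)) atTop (𝓝 (w s.toNNReal)) :=
    hs.tendsto.comp (tendsto_lowerGrid _)
  have h3 := ENNReal.tendsto_ofReal ((Real.continuous_exp.tendsto _).comp (h2.const_mul (-α)))
  refine h3.congr' ?_
  filter_upwards [eventually_floor_lt s.toNNReal] with n hn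
  rw [if_pos ⟨hn, le_trans (ENNReal.coe_le_coe.2 (lowerGrid_le _ _)) hs'.le⟩]
  rfl

lemma IsWorkloadPath.pathLaplace_le_liminf (hw : IsWorkloadPath w r) :
    pathLaplace α w ≤ liminf (fun n => gridSum α n w) atTop := by
  simp_rw [gridSum_eq_lintegral]
  refine le_trans (lintegral_mono_ae ?_) (lintegral_liminf_le fun n => measurable_lowerGrid_comp n)
  filter_upwards [hw.ae_continuousAt] with s hs
  split_ifs with h
  · exact (tendsto_lowerGrid_comp hs h).liminf_eq.ge
  · exact zero_le

/-- The summands are at most `1` and vanish beyond one mesh after the passage time `t`; `t + 1`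
bounds this for all `n` at once. -/
lemma IsWorkloadPath.lowerGrid_comp_le (hw : IsWorkloadPath w r) (hα : 0 ≤ α) (n : ℕ) {t : ℝ≥0}
    (ht : negTime w = t) {s : ℝ} (hs : 0 < s) :
    (if ⌊((n : ℝ≥0) + 1) * s.toNNReal⌋₊ < (n + 1) ^ 2 ∧
        (lowerGrid n s.toNNReal : ℝ≥0∞) ≤ negTime w
      then ENNReal.ofReal (Real.exp (-α * w (lowerGrid n s.toNNReal))) else 0) ≤
      (Set.Iic ((t : ℝ) + 1)).indicator 1 s := by
  split_ifs with h
  · rw [Set.indicator_of_mem]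
    · refine (ENNReal.ofReal_le_one).2 (Real.exp_le_one_iff.2 ?_)
      nlinarith [hw.nonneg_of_le_negTime h.2]
    · have h1 := h.2
      rw [ht, ENNReal.coe_le_coe] at h1
      have h2 := lt_upperGrid n s.toNNReal
      rw [← lowerGrid_add_inv] at h2
      have h3 : (s.toNNReal : ℝ) ≤ t + ((n : ℝ) + 1)⁻¹ := by
        have h5 : s.toNNReal ≤ t + ((n : ℝ≥0) + 1)⁻¹ := h2.le.trans (by gcongr)
        exact_mod_cast h5
      have h4 : ((n : ℝ) + 1)⁻¹ ≤ 1 := inv_le_one_of_one_le₀ (by simp)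
      rw [Real.coe_toNNReal s (le_of_lt hs)] at h3
      exact h3.trans (by linarith)
  · exact zero_le

lemma IsWorkloadPath.tendsto_gridSum (hw : IsWorkloadPath w r) (hα : 0 ≤ α) (hS : negTime w ≠ ⊤) :
    Tendsto (fun n => gridSum α n w) atTop (𝓝 (pathLaplace α w)) := by
  obtain ⟨t, ht⟩ : ∃ t : ℝ≥0, negTime w = t := ⟨_, (ENNReal.coe_toNNReal hS).symm⟩
  simp_rw [gridSum_eq_lintegral]
  refine tendsto_lintegral_of_dominated_convergence
    ((Set.Iic ((t : ℝ) + 1)).indicator 1) (fun n => measurable_lowerGrid_comp n) (fun n => ?_) ?_ ?_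
  · filter_upwards [ae_restrict_mem measurableSet_Ioi] with s hs
    exact hw.lowerGrid_comp_le hα n ht hs
  · rw [lintegral_indicator_one measurableSet_Iic, Measure.restrict_apply measurableSet_Iic,
      Set.inter_comm, Set.Ioi_inter_Iic, Real.volume_Ioc]
    exact ENNReal.ofReal_ne_top
  -- At `s = t` the grid condition `≤ negTime` and the strict condition in `pathLaplace` may
  -- disagree; this single point is discarded.
  · have h0 : ∀ᵐ s : ℝ ∂(volume.restrict (Set.Ioi (0 : ℝ))), s ≠ t :=
      ae_restrict_of_ae (by simp [ae_iff])
    filter_upwards [hw.ae_continuousAt, h0, ae_restrict_mem measurableSet_Ioi] with s hs hst hs0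
    split_ifs with h
    · exact tendsto_lowerGrid_comp hs h
    · refine tendsto_const_nhds.congr' ?_
      have h1 : t < s.toNNReal := by
        rw [ht, not_lt, ENNReal.ofReal, ENNReal.coe_le_coe] at h
        refine lt_of_le_of_ne h fun h' => hst ?_
        rw [h', Real.coe_toNNReal s (le_of_lt hs0)]
      filter_upwards [(tendsto_lowerGrid s.toNNReal).eventually (lt_mem_nhds h1)] with n hn
      rw [if_neg]
      rintro ⟨-, h2⟩
      rw [ht, ENNReal.coe_le_coe] at h2
      exact absurd hn (not_lt.2 h2)

lemma IsWorkloadPath.gridSum_le (hw : IsWorkloadPath w r) (hα : 0 ≤ α) (n : ℕ) :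
    gridSum α n w ≤ negTime w + 1 := by
  cases ht : negTime w with
  | top => simp
  | coe t =>
    rw [gridSum_eq_lintegral]
    calc _ ≤ ∫⁻ s in Set.Ioi (0 : ℝ), (Set.Iic ((t : ℝ) + 1)).indicator 1 s := by
          refine lintegral_mono_ae ?_
          filter_upwards [ae_restrict_mem measurableSet_Ioi] with s hs
          exact hw.lowerGrid_comp_le hα n ht hs
      _ = _ := by
          rw [lintegral_indicator_one measurableSet_Iic, Measure.restrict_apply measurableSet_Iic,
            Set.inter_comm, Set.Ioi_inter_Iic, Real.volume_Ioc]
          simp [ENNReal.ofReal_add]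

lemma pathLaplace_zero : pathLaplace 0 w = negTime w := by
  unfold pathLaplace
  cases ht : negTime w with
  | top => simp
  | coe t =>
    have h : ∀ s ∈ Set.Ioi (0 : ℝ), (if ENNReal.ofReal s < t then
        ENNReal.ofReal (Real.exp (-0 * w s.toNNReal)) else 0) = (Set.Iio (t : ℝ)).indicator 1 s := by
      intro s hs
      simp [Set.indicator_apply, ENNReal.ofReal, Real.toNNReal_lt_iff_lt_coe (le_of_lt hs)]
    rw [setLIntegral_congr_fun measurableSet_Ioi h, lintegral_indicator_one measurableSet_Iio,
      Measure.restrict_apply measurableSet_Iio, Set.inter_comm, Set.Ioi_inter_Iio, Real.volume_Ioo]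
    simp

lemma IsWorkloadPath.measurable (hw : IsWorkloadPath w r) : Measurable w := by
  have h : w = fun s : ℝ≥0 => (w s + r * s) - r * s := by
    ext s
    ring
  rw [h]
  exact hw.mono.measurable.sub (by fun_prop)

lemma measurableSet_ofReal_lt (t : ℝ≥0∞) : MeasurableSet {s : ℝ | ENNReal.ofReal s < t} :=
  measurableSet_lt (by fun_prop) measurable_const

/-- Fatou as the exponent tends to zero, where the integrand tends to the indicator of the on
period. No finiteness of the passage time is needed. -/
lemma IsWorkloadPath.negTime_le_liminf_pathLaplace (hw : IsWorkloadPath w r) :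
    negTime w ≤ liminf (fun k : ℕ => pathLaplace ((k : ℝ) + 1)⁻¹ w) atTop := by
  rw [← pathLaplace_zero]
  have hm := hw.measurable
  refine le_trans (lintegral_mono fun s => ?_) (lintegral_liminf_le fun k => ?_)
  · simp only
    split_ifs with hs
    · refine (Tendsto.liminf_eq ?_).ge
      refine ENNReal.tendsto_ofReal ((Real.continuous_exp.tendsto _).comp ?_)
      refine Tendsto.mul_const _ (Tendsto.neg ?_)
      simpa using! tendsto_one_div_add_atTop_nhds_zero_nat (𝕜 := ℝ)
    · exact zero_le
  · exact Measurable.ite (measurableSet_ofReal_lt _) (by fun_prop) measurable_const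

lemma pathLaplace_le_negTime {α : ℝ} (hα : 0 ≤ α) (w : ℝ≥0 → ℝ) :
    pathLaplace α w ≤ negTime w := by
  rw [← pathLaplace_zero]
  refine lintegral_mono fun s => ?_
  simp only
  split_ifs with hs
  · refine ENNReal.ofReal_le_ofReal (Real.exp_le_exp.2 ?_)
    have := nonneg_of_lt_negTime hs
    nlinarith
  · exact le_rfl

end PathGrid

/-! ### Laplace transform and exponent of a subordinator. -/

section Subordinator

variable {Ω : Type*} [mΩ : MeasurableSpace Ω] {P : Measure Ω}
  {G : Filtration ℝ≥0 mΩ} {X : ℝ≥0 → Ω → ℝ}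

lemma IsSubordinator.measurable (hX : IsSubordinator P G X) (t : ℝ≥0) : Measurable (X t) :=
  (hX.adapted t).mono (G.le t) le_rfl

lemma IsSubordinator.nonneg (hX : IsSubordinator P G X) (t : ℝ≥0) (ω : Ω) : 0 ≤ X t ω := by
  rw [← hX.zero ω]
  exact hX.mono ω zero_le

lemma IsSubordinator.lintegral_mul_exp_increment (hX : IsSubordinator P G X) (α : ℝ) (s h : ℝ≥0)
    {Z : Ω → ℝ≥0∞} (hZ : Measurable[G s] Z) :
    ∫⁻ ω, Z ω * ENNReal.ofReal (Real.exp (-α * (X (s + h) ω - X s ω))) ∂P =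
      (∫⁻ ω, Z ω ∂P) * ∫⁻ ω, ENNReal.ofReal (Real.exp (-α * X h ω)) ∂P := by
  have hinc : Measurable fun ω => X (s + h) ω - X s ω := (hX.measurable _).sub (hX.measurable _)
  have hm : Measurable fun x : ℝ => ENNReal.ofReal (Real.exp (-α * x)) := by fun_prop
  refine (lintegral_mul_eq_lintegral_mul_lintegral_of_independent_measurableSpace (G.le s)
    hinc.comap_le (hX.indep s h).symm hZ (hm.comp (comap_measurable _))).trans ?_
  congr 1
  exact ((hX.stationary s h).comp hm).lintegral_eq

lemma IsSubordinator.meanRate_nonneg (hX : IsSubordinator P G X) : 0 ≤ meanRate P X :=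
  integral_nonneg fun ω => hX.nonneg 1 ω

lemma IsSubordinator.lintegral_exp_add (hX : IsSubordinator P G X) (α : ℝ) (s h : ℝ≥0) :
    ∫⁻ ω, ENNReal.ofReal (Real.exp (-α * X (s + h) ω)) ∂P =
      (∫⁻ ω, ENNReal.ofReal (Real.exp (-α * X s ω)) ∂P) *
        ∫⁻ ω, ENNReal.ofReal (Real.exp (-α * X h ω)) ∂P := by
  have hm : Measurable fun x : ℝ => ENNReal.ofReal (Real.exp (-α * x)) := by fun_prop
  refine Eq.trans ?_ (hX.lintegral_mul_exp_increment α s h (hm.comp (hX.adapted s)))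
  refine lintegral_congr fun ω => ?_
  rw [← ENNReal.ofReal_mul (Real.exp_pos _).le, ← Real.exp_add]
  ring_nf

variable [IsProbabilityMeasure P]

lemma IsSubordinator.lintegral_exp_nsmul (hX : IsSubordinator P G X) (α : ℝ) (h : ℝ≥0) (k : ℕ) :
    ∫⁻ ω, ENNReal.ofReal (Real.exp (-α * X (k * h) ω)) ∂P =
      (∫⁻ ω, ENNReal.ofReal (Real.exp (-α * X h ω)) ∂P) ^ k := by
  induction k with
  | zero => simp [hX.zero]
  | succ k ih =>
    push_cast
    rw [add_mul, one_mul, hX.lintegral_exp_add, ih, pow_succ]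

lemma IsSubordinator.integrable_exp (hX : IsSubordinator P G X) {α : ℝ} (hα : 0 ≤ α) (t : ℝ≥0) :
    Integrable (fun ω => Real.exp (-α * X t ω)) P := by
  refine Integrable.of_bound (C := 1) ?_ (Eventually.of_forall fun ω => ?_)
  · exact ((hX.measurable t).const_mul _).exp.aestronglyMeasurable
  · rw [Real.norm_of_nonneg (Real.exp_pos _).le, Real.exp_le_one_iff]
    nlinarith [hX.nonneg t ω]

lemma IsSubordinator.integral_exp_one_pos (hX : IsSubordinator P G X) {α : ℝ} (hα : 0 ≤ α) :
    0 < ∫ ω, Real.exp (-α * X 1 ω) ∂P :=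
  integral_exp_pos (hX.integrable_exp hα 1)

lemma IsSubordinator.integral_exp_one (hX : IsSubordinator P G X) {α : ℝ} (hα : 0 ≤ α) :
    ∫ ω, Real.exp (-α * X 1 ω) ∂P = Real.exp (-exponent P X α) := by
  rw [exponent, neg_neg, Real.exp_log (hX.integral_exp_one_pos hα)]

/-- Unit time consists of `n + 1` meshes, so the transform over one mesh is the `(n + 1)`-st root of
the transform at time `1`. Only mesh times are needed afterwards. -/
lemma IsSubordinator.lintegral_exp_inv (hX : IsSubordinator P G X) {α : ℝ} (hα : 0 ≤ α) (n : ℕ) :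
    ∫⁻ ω, ENNReal.ofReal (Real.exp (-α * X (n + 1 : ℝ≥0)⁻¹ ω)) ∂P =
      ENNReal.ofReal (Real.exp (-exponent P X α * ((n : ℝ) + 1)⁻¹)) := by
  have h1 := hX.lintegral_exp_nsmul α (n + 1 : ℝ≥0)⁻¹ (n + 1)
  have h2 : ((n + 1 : ℕ) : ℝ≥0) * (n + 1 : ℝ≥0)⁻¹ = 1 := by
    push_cast
    exact mul_inv_cancel₀ (by positivity)
  rw [h2, ← ofReal_integral_eq_lintegral_ofReal (hX.integrable_exp hα 1)
    (Eventually.of_forall fun ω => (Real.exp_pos _).le), hX.integral_exp_one hα] at h1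
  have h3 : ENNReal.ofReal (Real.exp (-exponent P X α)) =
      ENNReal.ofReal (Real.exp (-exponent P X α * ((n : ℝ) + 1)⁻¹)) ^ (n + 1) := by
    rw [← ENNReal.ofReal_pow (Real.exp_pos _).le, ← Real.exp_nat_mul]
    congr 2
    push_cast
    field_simp
  rw [h3] at h1
  exact ((ENNReal.pow_right_strictMono (Nat.succ_ne_zero n)).injective h1).symm

/-- Jensen's inequality, obtained from the tangent line of `exp` at `-α * meanRate P X`. -/
lemma IsSubordinator.exponent_le (hX : IsSubordinator P G X) (hi : Integrable (X 1) P) {α : ℝ}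
    (hα : 0 ≤ α) : exponent P X α ≤ α * meanRate P X := by
  have h1 : Real.exp (-(α * meanRate P X)) ≤ ∫ ω, Real.exp (-α * X 1 ω) ∂P := by
    have h2 : Integrable (fun ω => Real.exp (-(α * meanRate P X)) *
        (1 + (-α * X 1 ω + α * meanRate P X))) P :=
      ((integrable_const _).add ((hi.const_mul _).add (integrable_const _))).const_mul _
    have h3 : ∫ ω, Real.exp (-(α * meanRate P X)) * (1 + (-α * X 1 ω + α * meanRate P X)) ∂P
        = Real.exp (-(α * meanRate P X)) := by
      have h4 : Integrable (fun ω => -α * X 1 ω + α * meanRate P X) P :=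
        (hi.const_mul _).add (integrable_const _)
      rw [integral_const_mul, integral_add (integrable_const _) h4, integral_add (hi.const_mul _)
        (integrable_const _), integral_const_mul]
      simp [meanRate]
    rw [← h3]
    refine integral_mono h2 (hX.integrable_exp hα 1) fun ω => ?_
    simp only
    calc _ ≤ Real.exp (-(α * meanRate P X)) * Real.exp (-α * X 1 ω + α * meanRate P X) := by
          gcongr
          linarith [Real.add_one_le_exp (-α * X 1 ω + α * meanRate P X)]
      _ = _ := by
          rw [← Real.exp_add]
          ring_nf
  rw [hX.integral_exp_one hα, Real.exp_le_exp] at h1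
  linarith

/-- The exponent has derivative `meanRate P X` at the origin, along the sequence `1 / (k + 1)`. -/
lemma IsSubordinator.tendsto_exponent_div (hX : IsSubordinator P G X) (hi : Integrable (X 1) P) :
    Tendsto (fun k : ℕ => exponent P X ((k : ℝ) + 1)⁻¹ * ((k : ℝ) + 1)) atTop
      (𝓝 (meanRate P X)) := by
  have hk : ∀ k : ℕ, (0 : ℝ) < ((k : ℝ) + 1)⁻¹ := fun k => by positivity
  have hlow : Tendsto (fun k : ℕ => ∫ ω, (1 - Real.exp (-((k : ℝ) + 1)⁻¹ * X 1 ω)) * ((k : ℝ) + 1)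
      ∂P) atTop (𝓝 (meanRate P X)) := by
    refine tendsto_integral_of_dominated_convergence (X 1) (fun k => ?_) hi (fun k => ?_) ?_
    · exact (((((hX.measurable 1).const_mul _).exp).const_sub _).mul_const _).aestronglyMeasurable
    · refine Eventually.of_forall fun ω => ?_
      have h1 := Real.add_one_le_exp (-((k : ℝ) + 1)⁻¹ * X 1 ω)
      have h2 : Real.exp (-((k : ℝ) + 1)⁻¹ * X 1 ω) ≤ 1 := by
        rw [Real.exp_le_one_iff]
        nlinarith [hX.nonneg 1 ω, hk k]
      rw [Real.norm_of_nonneg (mul_nonneg (by linarith) (by positivity))]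
      calc _ ≤ (((k : ℝ) + 1)⁻¹ * X 1 ω) * ((k : ℝ) + 1) := by gcongr; linarith
        _ = X 1 ω := by field_simp
    · refine Eventually.of_forall fun ω => ?_
      have hd : HasDerivAt (fun a : ℝ => 1 - Real.exp (-a * X 1 ω)) (X 1 ω) 0 := by
        have := (((hasDerivAt_id (0 : ℝ)).neg.mul_const (X 1 ω)).exp).const_sub 1
        simpa using! this
      have ht : Tendsto (fun k : ℕ => ((k : ℝ) + 1)⁻¹) atTop (𝓝[≠] 0) := by
        refine tendsto_nhdsWithin_iff.2 ⟨?_, Eventually.of_forall fun k => (hk k).ne'⟩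
        simpa using! tendsto_one_div_add_atTop_nhds_zero_nat (𝕜 := ℝ)
      have := (hasDerivAt_iff_tendsto_slope_zero.1 hd).comp ht
      refine this.congr fun k => ?_
      simp
      ring
  -- The lower bound is `log x ≤ x - 1`, the upper bound is `exponent_le`.
  refine tendsto_of_tendsto_of_tendsto_of_le_of_le hlow tendsto_const_nhds (fun k => ?_)
    fun k => ?_
  · simp only
    rw [integral_mul_const, integral_sub (integrable_const _) (hX.integrable_exp (hk k).le 1)]
    gcongr
    have := Real.log_le_sub_one_of_pos (hX.integral_exp_one_pos (hk k).le)
    simp only [integral_const, probReal_univ, smul_eq_mul, one_mul]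
    rw [exponent]
    linarith
  · have := hX.exponent_le hi (hk k).le
    calc _ ≤ ((k : ℝ) + 1)⁻¹ * meanRate P X * ((k : ℝ) + 1) := by gcongr
      _ = _ := by field_simp

end Subordinator

/-! ### The exponential martingale of an on period, on a grid. -/

section OnPeriod

/-- The data of an on period: the input `X`, the initial workload `V` and the output rate `R`. -/
structure IsOnPeriod {Ω : Type*} [mΩ : MeasurableSpace Ω] (P : Measure Ω)
    (G : Filtration ℝ≥0 mΩ) (X : ℝ≥0 → Ω → ℝ) (V R : Ω → ℝ) : Prop where
  subordinator : IsSubordinator P G X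
  integrable : Integrable (X 1) P
  measurable_V : Measurable[G 0] V
  measurable_R : Measurable[G 0] R
  V_nonneg : ∀ ω, 0 ≤ V ω
  R_gt : ∀ ω, meanRate P X < R ω

/-- The workload `s` time units after the beginning of the on period. -/
def workload {Ω : Type*} (X : ℝ≥0 → Ω → ℝ) (V R : Ω → ℝ) (ω : Ω) (s : ℝ≥0) : ℝ :=
  V ω + X s ω - R ω * s

/-- One step splits into a factor known at the grid point and the exponential of an increment
independent of it. -/
lemma gridNext_workload {Ω : Type*} (X : ℝ≥0 → Ω → ℝ) (V R : Ω → ℝ) (α : ℝ) (n j : ℕ) (ω : Ω) :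
    gridNext α n (workload X V R ω) j = gridWeight α n (workload X V R ω) j *
      ENNReal.ofReal (Real.exp (α * R ω * ((n : ℝ) + 1)⁻¹)) *
      ENNReal.ofReal (Real.exp (-α * (X (j / (n + 1) + (n + 1 : ℝ≥0)⁻¹) ω - X (j / (n + 1)) ω))) := by
  unfold gridNext gridWeight
  split_ifs
  · rw [← ENNReal.ofReal_mul (Real.exp_pos _).le, ← ENNReal.ofReal_mul (by positivity),
      ← Real.exp_add, ← Real.exp_add]
    have : ((j + 1 : ℕ) / (n + 1) : ℝ≥0) = j / (n + 1) + (n + 1 : ℝ≥0)⁻¹ := by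
      push_cast
      rw [add_div, one_div]
    rw [this]
    congr 2
    unfold workload
    push_cast
    ring
  · simp

variable {Ω : Type*} [mΩ : MeasurableSpace Ω] {P : Measure Ω}
  {G : Filtration ℝ≥0 mΩ} {X : ℝ≥0 → Ω → ℝ} {V R : Ω → ℝ}

namespace IsOnPeriod

lemma R_pos (h : IsOnPeriod P G X V R) (ω : Ω) : 0 < R ω :=
  h.subordinator.meanRate_nonneg.trans_lt (h.R_gt ω)

lemma isWorkloadPath (h : IsOnPeriod P G X V R) (ω : Ω) :
    IsWorkloadPath (workload X V R ω) (R ω) where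
  rightCont t := by
    refine ((h.subordinator.rightCont ω t).const_add (V ω)).sub ?_
    exact Continuous.continuousWithinAt (by fun_prop)
  mono s t hst := by
    simpa [workload] using h.subordinator.mono ω hst
  zero_nonneg := by
    simpa [workload, h.subordinator.zero] using h.V_nonneg ω
  rate_pos := h.R_pos ω

lemma adapted_workload (h : IsOnPeriod P G X V R) (s : ℝ≥0) :
    Measurable[G s] fun ω => workload X V R ω s :=
  ((h.measurable_V.mono (G.mono zero_le) le_rfl).add (h.subordinator.adapted s)).sub
    ((h.measurable_R.mono (G.mono zero_le) le_rfl).mul_const _)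

lemma measurable_workload (h : IsOnPeriod P G X V R) :
    Measurable fun p : ℝ≥0 × Ω => workload X V R p.2 p.1 :=
  measurable_uncurry_of_rightCont (X := fun s ω => workload X V R ω s)
    (fun s => (h.adapted_workload s).mono (G.le s) le_rfl)
    fun ω => (h.isWorkloadPath ω).rightCont

/-- By `le_negTime_iff`, only dense times strictly before `t` impose a condition. The weak
inequality is essential: the strict one would look immediately past `t`. -/
lemma measurableSet_le_negTime (h : IsOnPeriod P G X V R) (t : ℝ≥0) :
    MeasurableSet[G t] {ω | (t : ℝ≥0∞) ≤ negTime (workload X V R ω)} := by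
  have : {ω | (t : ℝ≥0∞) ≤ negTime (workload X V R ω)} =
      ⋂ i, {ω | workload X V R ω (TopologicalSpace.denseSeq ℝ≥0 i) < 0 →
        (t : ℝ≥0∞) ≤ TopologicalSpace.denseSeq ℝ≥0 i} := by
    ext ω
    simp only [Set.mem_iInter, Set.mem_ofPred_eq]
    exact le_negTime_iff (h.isWorkloadPath ω).rightCont t
  rw [this]
  refine MeasurableSet.iInter fun i => ?_
  by_cases hi : (t : ℝ≥0∞) ≤ TopologicalSpace.denseSeq ℝ≥0 i
  · simp [hi]
  · simp only [hi, imp_false, not_lt]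
    have hlt : TopologicalSpace.denseSeq ℝ≥0 i ≤ t := by
      rw [ENNReal.coe_le_coe] at hi
      exact (not_le.1 hi).le
    exact ((h.adapted_workload _).mono (G.mono hlt) le_rfl) measurableSet_Ici

lemma measurable_negTime (h : IsOnPeriod P G X V R) :
    Measurable fun ω => negTime (workload X V R ω) := by
  refine measurable_of_Ici fun x => ?_
  have : (fun ω => negTime (workload X V R ω)) ⁻¹' Set.Ici x =
      ⋂ i, {ω | workload X V R ω (TopologicalSpace.denseSeq ℝ≥0 i) < 0 →
        x ≤ TopologicalSpace.denseSeq ℝ≥0 i} := by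
    ext ω
    simp only [Set.mem_iInter, Set.mem_ofPred_eq, Set.mem_preimage, Set.mem_Ici]
    exact le_negTime_iff (h.isWorkloadPath ω).rightCont x
  rw [this]
  refine MeasurableSet.iInter fun i => ?_
  by_cases hi : x ≤ TopologicalSpace.denseSeq ℝ≥0 i
  · simp [hi]
  · simp only [hi, imp_false, not_lt]
    exact ((h.adapted_workload _).mono (G.le _) le_rfl) measurableSet_Ici

lemma adapted_gridWeight (h : IsOnPeriod P G X V R) (α : ℝ) (n j : ℕ) :
    Measurable[G (j / (n + 1))] fun ω => gridWeight α n (workload X V R ω) j := by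
  unfold gridWeight
  refine Measurable.ite (h.measurableSet_le_negTime _) ?_ measurable_const
  exact (((h.adapted_workload _).const_mul _).exp).ennreal_ofReal

lemma measurable_gridWeight (h : IsOnPeriod P G X V R) (α : ℝ) (n j : ℕ) :
    Measurable fun ω => gridWeight α n (workload X V R ω) j :=
  (h.adapted_gridWeight α n j).mono (G.le _) le_rfl

lemma measurable_gridStop (h : IsOnPeriod P G X V R) (α : ℝ) (n m : ℕ) :
    Measurable fun ω => gridStop α n (workload X V R ω) m := by
  induction m with
  | zero =>
    exact ((((h.adapted_workload _).mono (G.le _) le_rfl).const_mul _).exp).ennreal_ofReal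
  | succ m ih =>
    simp only [gridStop]
    refine Measurable.ite (G.le _ _ (h.measurableSet_le_negTime _)) ?_ ih
    exact ((((h.adapted_workload _).mono (G.le _) le_rfl).const_mul _).exp).ennreal_ofReal

lemma measurable_gridNext (h : IsOnPeriod P G X V R) (α : ℝ) (n j : ℕ) :
    Measurable fun ω => gridNext α n (workload X V R ω) j := by
  unfold gridNext
  refine Measurable.ite (G.le _ _ (h.measurableSet_le_negTime _)) ?_ measurable_const
  exact ((((h.adapted_workload _).mono (G.le _) le_rfl).const_mul _).exp).ennreal_ofReal

lemma measurable_gridSum (h : IsOnPeriod P G X V R) (α : ℝ) (n : ℕ) :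
    Measurable fun ω => gridSum α n (workload X V R ω) := by
  unfold gridSum
  exact (Finset.measurable_fun_sum _ fun j _ => h.measurable_gridWeight α n j).mul_const _

/-- The region `{(ω, s) : 0 < s < negTime}` under the on period. -/
lemma measurableSet_lt_negTime (h : IsOnPeriod P G X V R) :
    MeasurableSet {p : Ω × ℝ | ENNReal.ofReal p.2 < negTime (workload X V R p.1)} :=
  measurableSet_lt (by fun_prop) (h.measurable_negTime.comp measurable_fst)

lemma measurable_workload_toNNReal (h : IsOnPeriod P G X V R) :
    Measurable fun p : Ω × ℝ => workload X V R p.1 p.2.toNNReal :=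
  h.measurable_workload.comp ((by fun_prop : Measurable fun p : Ω × ℝ => (p.2.toNNReal, p.1)))

lemma measurable_pathLaplace (h : IsOnPeriod P G X V R) (α : ℝ) :
    Measurable fun ω => pathLaplace α (workload X V R ω) := by
  unfold pathLaplace
  refine Measurable.lintegral_prod_right' (f := fun p : Ω × ℝ =>
    if ENNReal.ofReal p.2 < negTime (workload X V R p.1) then
      ENNReal.ofReal (Real.exp (-α * workload X V R p.1 p.2.toNNReal)) else 0) ?_
  refine Measurable.ite h.measurableSet_lt_negTime ?_ measurable_const
  exact ((h.measurable_workload_toNNReal.const_mul _).exp).ennreal_ofReal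

lemma measurable_V' (h : IsOnPeriod P G X V R) : Measurable V :=
  h.measurable_V.mono (G.le _) le_rfl

lemma measurable_R' (h : IsOnPeriod P G X V R) : Measurable R :=
  h.measurable_R.mono (G.le _) le_rfl

lemma gridWeight_le_one (h : IsOnPeriod P G X V R) {α : ℝ} (hα : 0 ≤ α) (n j : ℕ) (ω : Ω) :
    gridWeight α n (workload X V R ω) j ≤ 1 := by
  unfold gridWeight
  split_ifs with h1
  · refine (ENNReal.ofReal_le_one).2 (Real.exp_le_one_iff.2 ?_)
    nlinarith [(h.isWorkloadPath ω).nonneg_of_le_negTime h1]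
  · exact zero_le

variable [IsProbabilityMeasure P]

lemma mul_sub_meanRate_le (h : IsOnPeriod P G X V R) {α : ℝ} (hα : 0 ≤ α) (ω : Ω) :
    α * (R ω - meanRate P X) ≤ α * R ω - exponent P X α := by
  linarith [h.subordinator.exponent_le h.integrable hα]

lemma denom_pos (h : IsOnPeriod P G X V R) {α : ℝ} (hα : 0 < α) (ω : Ω) :
    0 < α * R ω - exponent P X α :=
  (mul_pos hα (sub_pos.2 (h.R_gt ω))).trans_le (h.mul_sub_meanRate_le hα.le ω)

/-- Independence and stationarity replace the exponential of the increment by its mean `exp (-η α /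
(n + 1))`. -/
lemma lintegral_gridNext (h : IsOnPeriod P G X V R) {α : ℝ} (hα : 0 ≤ α) (n j : ℕ)
    {g : Ω → ℝ≥0∞} (hg : Measurable[G 0] g) :
    ∫⁻ ω, g ω * gridNext α n (workload X V R ω) j ∂P =
      ∫⁻ ω, g ω * gridWeight α n (workload X V R ω) j *
        ENNReal.ofReal (Real.exp ((α * R ω - exponent P X α) * ((n : ℝ) + 1)⁻¹)) ∂P := by
  have hZ : Measurable[G (j / (n + 1))] fun ω => g ω * (gridWeight α n (workload X V R ω) j *
      ENNReal.ofReal (Real.exp (α * R ω * ((n : ℝ) + 1)⁻¹))) := by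
    refine (hg.mono (G.mono zero_le) le_rfl).mul ((h.adapted_gridWeight α n j).mul ?_)
    exact ((((h.measurable_R.mono (G.mono zero_le) le_rfl).const_mul _).mul_const _).exp).ennreal_ofReal
  have h1 := h.subordinator.lintegral_mul_exp_increment α (j / (n + 1)) (n + 1 : ℝ≥0)⁻¹ hZ
  rw [h.subordinator.lintegral_exp_inv hα, ← lintegral_mul_const _ (hZ.mono (G.le _) le_rfl)] at h1
  simp_rw [gridNext_workload, ← mul_assoc]
  simp_rw [← mul_assoc] at h1
  rw [h1]
  refine lintegral_congr fun ω => ?_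
  rw [mul_assoc, ← ENNReal.ofReal_mul (Real.exp_pos _).le, ← Real.exp_add]
  ring_nf

/-- The martingale identity along the grid of mesh `1 / (n + 1)`. -/
lemma lintegral_gridStop (h : IsOnPeriod P G X V R) {α : ℝ} (hα : 0 < α) (n : ℕ)
    {g : Ω → ℝ≥0∞} (hg : Measurable[G 0] g) (hgi : ∫⁻ ω, g ω ∂P ≠ ∞) :
    ∫⁻ ω, g ω * ENNReal.ofReal (Real.exp (-α * V ω)) ∂P +
      ∫⁻ ω, g ω * (ENNReal.ofReal
        ((Real.exp ((α * R ω - exponent P X α) * ((n : ℝ) + 1)⁻¹) - 1) * ((n : ℝ) + 1)) *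
          gridSum α n (workload X V R ω)) ∂P =
      ∫⁻ ω, g ω * gridStop α n (workload X V R ω) ((n + 1) ^ 2) ∂P := by
  have hg' : Measurable g := hg.mono (G.le _) le_rfl
  set m := (n + 1) ^ 2
  set ε : Ω → ℝ≥0∞ := fun ω =>
    ENNReal.ofReal (Real.exp ((α * R ω - exponent P X α) * ((n : ℝ) + 1)⁻¹) - 1) with hε
  have hεm : Measurable ε := by
    have := h.measurable_R'
    fun_prop
  have h1 : ∀ ω, ENNReal.ofReal (Real.exp ((α * R ω - exponent P X α) * ((n : ℝ) + 1)⁻¹)) =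
      1 + ε ω := fun ω => by
    rw [hε, ← ENNReal.ofReal_one, ← ENNReal.ofReal_add zero_le_one]
    · ring_nf
    · rw [sub_nonneg, Real.one_le_exp_iff]
      have := h.denom_pos hα ω
      positivity
  have h2 : ∀ j, ∫⁻ ω, g ω * gridNext α n (workload X V R ω) j ∂P =
      ∫⁻ ω, g ω * gridWeight α n (workload X V R ω) j ∂P +
      ∫⁻ ω, g ω * (ε ω * gridWeight α n (workload X V R ω) j) ∂P := fun j => by
    rw [h.lintegral_gridNext hα.le n j hg, ← lintegral_add_left
      (hg'.fun_mul (h.measurable_gridWeight α n j))]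
    refine lintegral_congr fun ω => ?_
    rw [h1]
    ring
  have hfin : ∀ j, ∫⁻ ω, g ω * gridWeight α n (workload X V R ω) j ∂P ≠ ∞ := fun j => by
    refine ne_top_of_le_ne_top hgi (lintegral_mono fun ω => ?_)
    exact mul_le_of_le_one_right' (h.gridWeight_le_one hα.le n j ω)
  have h3 : ∫⁻ ω, g ω * ENNReal.ofReal (Real.exp (-α * V ω)) ∂P +
      ∑ j ∈ Finset.range m, ∫⁻ ω, g ω * gridNext α n (workload X V R ω) j ∂P =
      ∫⁻ ω, g ω * gridStop α n (workload X V R ω) m ∂P +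
      ∑ j ∈ Finset.range m, ∫⁻ ω, g ω * gridWeight α n (workload X V R ω) j ∂P := by
    rw [← lintegral_finsetSum _ fun j _ => hg'.fun_mul (h.measurable_gridNext α n j),
      ← lintegral_finsetSum _ fun j _ => hg'.fun_mul (h.measurable_gridWeight α n j),
      ← lintegral_add_left (by have := h.measurable_V'; fun_prop),
      ← lintegral_add_left (hg'.fun_mul (h.measurable_gridStop α n m))]
    refine lintegral_congr fun ω => ?_
    rw [← Finset.mul_sum, ← Finset.mul_sum, ← mul_add, ← mul_add, ← gridStop_telescope]
    simp [workload, h.subordinator.zero]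
  simp_rw [h2] at h3
  rw [Finset.sum_add_distrib, add_comm (∑ j ∈ Finset.range m, ∫⁻ ω, g ω * gridWeight α n (workload X V R ω) j ∂P),
    ← add_assoc] at h3
  -- The common sum of the `gridWeight` terms is cancelled, which is legitimate since each is
  -- bounded by the finite integral of `g`.
  have h4 := (ENNReal.add_left_inj (ENNReal.sum_ne_top.2 fun j _ => hfin j)).1 h3
  rw [← h4, ← lintegral_finsetSum _ fun j _ => hg'.fun_mul (hεm.fun_mul (h.measurable_gridWeight α n j))]
  congr 1
  refine lintegral_congr fun ω => ?_
  rw [← Finset.mul_sum, ← Finset.mul_sum, gridSum, ENNReal.ofReal_mul' (by positivity)]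
  congr 1
  have h5 : ENNReal.ofReal ((n : ℝ) + 1) = (n : ℝ≥0∞) + 1 := by
    rw [ENNReal.ofReal_add (by positivity) (by simp)]
    simp
  have h6 : ((n : ℝ≥0∞) + 1) * ((n : ℝ≥0∞) + 1)⁻¹ = 1 :=
    ENNReal.mul_inv_cancel (by simp) (by simp)
  rw [h5, mul_comm (∑ j ∈ _, _), mul_assoc, ← mul_assoc _ _ (∑ j ∈ _, _), h6, one_mul]

end IsOnPeriod

end OnPeriod

/-! ### The discrete rate `(exp (φ h) - 1) / h` with `h = 1 / (n + 1)`, compared with `φ`. -/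

section GridRate

lemma tendsto_inv_nat_real : Tendsto (fun n : ℕ => ((n : ℝ) + 1)⁻¹) atTop (𝓝 0) := by
  simpa using! tendsto_one_div_add_atTop_nhds_zero_nat (𝕜 := ℝ)

lemma le_gridRate (φ : ℝ) (n : ℕ) :
    φ ≤ (Real.exp (φ * ((n : ℝ) + 1)⁻¹) - 1) * ((n : ℝ) + 1) := by
  have h1 := Real.add_one_le_exp (φ * ((n : ℝ) + 1)⁻¹)
  calc φ = (φ * ((n : ℝ) + 1)⁻¹) * ((n : ℝ) + 1) := by field_simp
    _ ≤ _ := by gcongr; linarith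

lemma tendsto_gridRate (φ : ℝ) : Tendsto (fun n : ℕ => ENNReal.ofReal
    ((Real.exp (φ * ((n : ℝ) + 1)⁻¹) - 1) * ((n : ℝ) + 1))) atTop (𝓝 (ENNReal.ofReal φ)) := by
  refine ENNReal.tendsto_ofReal ?_
  have hd : HasDerivAt (fun a : ℝ => Real.exp (φ * a)) φ 0 := by
    have := ((hasDerivAt_id (0 : ℝ)).const_mul φ).exp
    simpa using! this
  have ht : Tendsto (fun k : ℕ => ((k : ℝ) + 1)⁻¹) atTop (𝓝[≠] 0) :=
    tendsto_nhdsWithin_iff.2 ⟨tendsto_inv_nat_real, Eventually.of_forall fun k => by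
      simp only [Set.mem_compl_iff, Set.mem_singleton_iff]
      positivity⟩
  have := (hasDerivAt_iff_tendsto_slope_zero.1 hd).comp ht
  refine this.congr fun k => ?_
  simp [mul_comm]

lemma gridRate_le {φ M : ℝ} (h0 : 0 ≤ φ) (hM : φ ≤ M) (n : ℕ) :
    (Real.exp (φ * ((n : ℝ) + 1)⁻¹) - 1) * ((n : ℝ) + 1) ≤ M * Real.exp M := by
  set y := φ * ((n : ℝ) + 1)⁻¹ with hy
  have hy0 : 0 ≤ y := by positivity
  have hyφ : y ≤ φ := mul_le_of_le_one_right h0 (inv_le_one_of_one_le₀ (by simp))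
  have h1 : Real.exp y - 1 ≤ y * Real.exp y := by
    have := Real.add_one_le_exp (-y)
    have h2 : Real.exp (-y) * Real.exp y = 1 := by rw [← Real.exp_add]; simp
    nlinarith [Real.exp_pos y]
  calc _ ≤ (y * Real.exp y) * ((n : ℝ) + 1) := by gcongr
    _ = φ * Real.exp y := by rw [hy]; field_simp
    _ ≤ M * Real.exp M := by
        have := hyφ.trans hM
        have := h0.trans hM
        gcongr

end GridRate

/-! ### Passage to the limit: transform and mean length of an on period. -/

section OnPeriodMean

variable {Ω : Type*} [mΩ : MeasurableSpace Ω] {P : Measure Ω}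
  {G : Filtration ℝ≥0 mΩ} {X : ℝ≥0 → Ω → ℝ} {V R : Ω → ℝ}

namespace IsOnPeriod

/-- The sets on which the rate and the inverse of the denominator are bounded by `K + 1`. -/
def truncSet (P : Measure Ω) (X : ℝ≥0 → Ω → ℝ) (R : Ω → ℝ) (α : ℝ) (K : ℕ) : Set Ω :=
  {ω | R ω ≤ K + 1 ∧ ((K : ℝ) + 1)⁻¹ ≤ α * R ω - exponent P X α}

lemma measurableSet_truncSet (h : IsOnPeriod P G X V R) (α : ℝ) (K : ℕ) :
    MeasurableSet[G 0] (truncSet P X R α K) := by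
  have h1 : MeasurableSet[G 0] {ω | R ω ≤ K + 1} := h.measurable_R measurableSet_Iic
  have h2 : MeasurableSet[G 0] {ω | ((K : ℝ) + 1)⁻¹ ≤ α * R ω - exponent P X α} :=
    ((h.measurable_R.const_mul α).sub_const (exponent P X α)) measurableSet_Ici
  exact h1.inter h2

/-- The weight `1 / (α R - η α)` on the truncation set. -/
def truncWeight (P : Measure Ω) (X : ℝ≥0 → Ω → ℝ) (R : Ω → ℝ) (α : ℝ) (K : ℕ) : Ω → ℝ≥0∞ :=
  (truncSet P X R α K).indicator fun ω => ENNReal.ofReal (α * R ω - exponent P X α)⁻¹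

lemma measurable_truncWeight (h : IsOnPeriod P G X V R) (α : ℝ) (K : ℕ) :
    Measurable[G 0] (truncWeight P X R α K) := by
  refine Measurable.indicator ?_ (h.measurableSet_truncSet α K)
  exact (((h.measurable_R.const_mul α).sub_const (exponent P X α)).inv).ennreal_ofReal

lemma truncWeight_le (α : ℝ) (K : ℕ) (ω : Ω) :
    truncWeight P X R α K ω ≤ ENNReal.ofReal ((K : ℝ) + 1) := by
  classical
  unfold truncWeight
  rw [Set.indicator_apply]
  split_ifs with h
  · refine ENNReal.ofReal_le_ofReal (inv_le_of_inv_le₀ (by positivity) h.2)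
  · exact zero_le

lemma le_of_truncWeight_ne_zero (α : ℝ) (K : ℕ) (ω : Ω) (h : truncWeight P X R α K ω ≠ 0) :
    R ω ≤ (K : ℝ) + 1 :=
  (Set.mem_of_indicator_ne_zero h).1

variable [IsProbabilityMeasure P]

/-- The upper bound in the stopped martingale identity. -/
lemma lintegral_pathLaplace_mul_le (h : IsOnPeriod P G X V R) {α : ℝ} (hα : 0 < α)
    {g : Ω → ℝ≥0∞} (hg : Measurable[G 0] g) {C : ℝ} (hgC : ∀ ω, g ω ≤ ENNReal.ofReal C)
    (hgR : ∀ ω, g ω ≠ 0 → R ω ≤ C) :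
    ∫⁻ ω, g ω * ENNReal.ofReal (Real.exp (-α * V ω)) ∂P +
      ∫⁻ ω, g ω * (ENNReal.ofReal (α * R ω - exponent P X α) *
        pathLaplace α (workload X V R ω)) ∂P ≤ ∫⁻ ω, g ω ∂P := by
  have hg' : Measurable g := hg.mono (G.le _) le_rfl
  have hR := h.measurable_R'
  have hgi : ∫⁻ ω, g ω ∂P ≠ ∞ := by
    refine ne_top_of_le_ne_top (b := ENNReal.ofReal C) ENNReal.ofReal_ne_top ?_
    simpa using lintegral_mono (μ := P) hgC
  set a := ∫⁻ ω, g ω * ENNReal.ofReal (Real.exp (-α * V ω)) ∂P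
  have ha : a ≤ ∫⁻ ω, g ω ∂P := by
    refine lintegral_mono fun ω => mul_le_of_le_one_right' ?_
    refine ENNReal.ofReal_le_one.2 (Real.exp_le_one_iff.2 ?_)
    nlinarith [h.V_nonneg ω]
  have hc : Tendsto (fun n : ℕ => ENNReal.ofReal (Real.exp (α * C * ((n : ℝ) + 1)⁻¹)) *
      ∫⁻ ω, g ω ∂P) atTop (𝓝 (∫⁻ ω, g ω ∂P)) := by
    have h1 := ENNReal.tendsto_ofReal ((Real.continuous_exp.tendsto _).comp
      (tendsto_inv_nat_real.const_mul (α * C)))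
    have h2 := ENNReal.Tendsto.mul_const h1 (Or.inr hgi)
    simpa using! h2
  have hn : ∀ n : ℕ, ∫⁻ ω, g ω * (ENNReal.ofReal (α * R ω - exponent P X α) *
      gridSum α n (workload X V R ω)) ∂P ≤
      ENNReal.ofReal (Real.exp (α * C * ((n : ℝ) + 1)⁻¹)) * (∫⁻ ω, g ω ∂P) - a := by
    intro n
    refine ENNReal.le_sub_of_add_le_left (ne_top_of_le_ne_top hgi ha) ?_
    calc _ ≤ a + ∫⁻ ω, g ω * (ENNReal.ofReal
            ((Real.exp ((α * R ω - exponent P X α) * ((n : ℝ) + 1)⁻¹) - 1) * ((n : ℝ) + 1)) *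
          gridSum α n (workload X V R ω)) ∂P := by
          gcongr with ω
          exact le_gridRate _ n
      _ = ∫⁻ ω, g ω * gridStop α n (workload X V R ω) ((n + 1) ^ 2) ∂P :=
          h.lintegral_gridStop hα n hg hgi
      _ ≤ ∫⁻ ω, ENNReal.ofReal (Real.exp (α * C * ((n : ℝ) + 1)⁻¹)) * g ω ∂P := by
          refine lintegral_mono fun ω => ?_
          rw [mul_comm]
          rcases eq_or_ne (g ω) 0 with h0 | h0
          · simp [h0]
          gcongr
          refine ((h.isWorkloadPath ω).gridStop_le hα.le n _).trans ?_
          refine ENNReal.ofReal_le_ofReal (Real.exp_le_exp.2 ?_)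
          have := hgR ω h0
          gcongr
      _ = _ := lintegral_const_mul _ hg'
  -- The passage time is not yet known to be finite, so only Fatou is available and the result is an
  -- inequality.
  have hlim : ∫⁻ ω, g ω * (ENNReal.ofReal (α * R ω - exponent P X α) *
        pathLaplace α (workload X V R ω)) ∂P ≤ (∫⁻ ω, g ω ∂P) - a := by
    calc _ ≤ ∫⁻ ω, liminf (fun n : ℕ => g ω * (ENNReal.ofReal (α * R ω - exponent P X α) *
          gridSum α n (workload X V R ω))) atTop ∂P := by
          refine lintegral_mono fun ω => ?_
          simp only
          rw [ENNReal.liminf_const_mul_of_ne_top (ne_top_of_le_ne_top ENNReal.ofReal_ne_top (hgC ω)),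
            ENNReal.liminf_const_mul_of_ne_top ENNReal.ofReal_ne_top]
          gcongr
          exact (h.isWorkloadPath ω).pathLaplace_le_liminf
      _ ≤ liminf (fun n : ℕ => ∫⁻ ω, g ω * (ENNReal.ofReal (α * R ω - exponent P X α) *
          gridSum α n (workload X V R ω)) ∂P) atTop := by
          refine lintegral_liminf_le fun n => ?_
          have := h.measurable_gridSum α n
          fun_prop
      _ ≤ liminf (fun n : ℕ => ENNReal.ofReal (Real.exp (α * C * ((n : ℝ) + 1)⁻¹)) *
            (∫⁻ ω, g ω ∂P) - a) atTop := liminf_le_liminf (Eventually.of_forall hn)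
      _ = _ := (ENNReal.Tendsto.sub hc tendsto_const_nhds (Or.inl hgi)).liminf_eq
  calc _ ≤ a + ((∫⁻ ω, g ω ∂P) - a) := by gcongr
    _ = _ := add_tsub_cancel_of_le ha

/-- The stopped martingale identity. -/
lemma lintegral_pathLaplace_mul (h : IsOnPeriod P G X V R) {α : ℝ} (hα : 0 < α)
    (hS : ∫⁻ ω, negTime (workload X V R ω) ∂P ≠ ∞)
    {g : Ω → ℝ≥0∞} (hg : Measurable[G 0] g) {C : ℝ} (hgC : ∀ ω, g ω ≤ ENNReal.ofReal C)
    (hgR : ∀ ω, g ω ≠ 0 → R ω ≤ C) :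
    ∫⁻ ω, g ω * ENNReal.ofReal (Real.exp (-α * V ω)) ∂P +
      ∫⁻ ω, g ω * (ENNReal.ofReal (α * R ω - exponent P X α) *
        pathLaplace α (workload X V R ω)) ∂P = ∫⁻ ω, g ω ∂P := by
  have hg' : Measurable g := hg.mono (G.le _) le_rfl
  have hR := h.measurable_R'
  have hgtop : ∀ ω, g ω ≠ ∞ := fun ω => ne_top_of_le_ne_top ENNReal.ofReal_ne_top (hgC ω)
  have hgi : ∫⁻ ω, g ω ∂P ≠ ∞ := by
    refine ne_top_of_le_ne_top (b := ENNReal.ofReal C) ENNReal.ofReal_ne_top ?_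
    simpa using lintegral_mono (μ := P) hgC
  have hSae : ∀ᵐ ω ∂P, negTime (workload X V R ω) ≠ ∞ :=
    (ae_lt_top h.measurable_negTime hS).mono fun ω hω => hω.ne
  -- Almost surely the passage time is finite, so the stopped exponential tends to `1`.
  have h1 : Tendsto (fun n : ℕ => ∫⁻ ω, g ω * gridStop α n (workload X V R ω) ((n + 1) ^ 2) ∂P)
      atTop (𝓝 (∫⁻ ω, g ω ∂P)) := by
    refine tendsto_lintegral_of_dominated_convergence
      (fun ω => g ω * ENNReal.ofReal (Real.exp (α * C)))
      (fun n => hg'.fun_mul (h.measurable_gridStop α n _)) (fun n => ?_) ?_ ?_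
    · refine Eventually.of_forall fun ω => ?_
      simp only
      rcases eq_or_ne (g ω) 0 with h0 | h0
      · simp [h0]
      gcongr
      refine ((h.isWorkloadPath ω).gridStop_le hα.le n _).trans ?_
      refine ENNReal.ofReal_le_ofReal (Real.exp_le_exp.2 ?_)
      have h2 := hgR ω h0
      have h3 : ((n : ℝ) + 1)⁻¹ ≤ 1 := inv_le_one_of_one_le₀ (by simp)
      have h4 := h.R_pos ω
      calc α * R ω * ((n : ℝ) + 1)⁻¹ ≤ α * R ω * 1 := by gcongr
        _ ≤ α * C := by rw [mul_one]; gcongr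
    · rw [lintegral_mul_const _ hg']
      exact ENNReal.mul_ne_top hgi ENNReal.ofReal_ne_top
    · filter_upwards [hSae] with ω hω
      simpa using ENNReal.Tendsto.const_mul ((h.isWorkloadPath ω).tendsto_gridStop (α := α) hω)
        (Or.inr (hgtop ω))
  -- `M` bounds `α R - η α` wherever `g` is nonzero; together with `gridSum_le` it gives the
  -- integrable bound `C * M * exp M * (negTime + 1)`.
  set M := α * C - exponent P X α with hM
  have h2 : Tendsto (fun n : ℕ => ∫⁻ ω, g ω * (ENNReal.ofReal
        ((Real.exp ((α * R ω - exponent P X α) * ((n : ℝ) + 1)⁻¹) - 1) * ((n : ℝ) + 1)) *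
          gridSum α n (workload X V R ω)) ∂P) atTop
      (𝓝 (∫⁻ ω, g ω * (ENNReal.ofReal (α * R ω - exponent P X α) *
        pathLaplace α (workload X V R ω)) ∂P)) := by
    refine tendsto_lintegral_of_dominated_convergence
      (fun ω => ENNReal.ofReal C * (ENNReal.ofReal (M * Real.exp M) *
        (negTime (workload X V R ω) + 1))) (fun n => ?_) (fun n => ?_) ?_ ?_
    · have := h.measurable_gridSum α n
      fun_prop
    · refine Eventually.of_forall fun ω => ?_
      simp only
      rcases eq_or_ne (g ω) 0 with h0 | h0
      · simp [h0]
      refine mul_le_mul' (hgC ω) (mul_le_mul' (ENNReal.ofReal_le_ofReal ?_)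
        ((h.isWorkloadPath ω).gridSum_le hα.le n))
      refine gridRate_le (h.denom_pos hα ω).le ?_ n
      have := hgR ω h0
      rw [hM]
      gcongr
    · have hmn := h.measurable_negTime
      rw [lintegral_const_mul _ (by fun_prop), lintegral_const_mul _ (by fun_prop),
        lintegral_add_right _ measurable_const]
      refine ENNReal.mul_ne_top ENNReal.ofReal_ne_top (ENNReal.mul_ne_top ENNReal.ofReal_ne_top ?_)
      simpa using hS
    · filter_upwards [hSae] with ω hω
      refine ENNReal.Tendsto.const_mul ?_ (Or.inr (hgtop ω))
      have hne : pathLaplace α (workload X V R ω) ≠ ∞ := by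
        refine ne_top_of_le_ne_top (b := negTime (workload X V R ω) + 1) (by simpa using hω) ?_
        exact le_of_tendsto' ((h.isWorkloadPath ω).tendsto_gridSum hα.le hω)
          fun n => (h.isWorkloadPath ω).gridSum_le hα.le n
      exact ENNReal.Tendsto.mul (tendsto_gridRate _) (Or.inr hne)
        ((h.isWorkloadPath ω).tendsto_gridSum hα.le hω) (Or.inr ENNReal.ofReal_ne_top)
  have h3 := h2.const_add (∫⁻ ω, g ω * ENNReal.ofReal (Real.exp (-α * V ω)) ∂P)
  simp_rw [h.lintegral_gridStop hα _ hg hgi] at h3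
  exact tendsto_nhds_unique h3 h1

/-- The truncation sets increase to the whole space, because the denominator is positive everywhere.
They permit the unbounded weight `1 / (α R - η α)` in the martingale identity. -/
lemma lintegral_eq_iSup_truncSet (h : IsOnPeriod P G X V R) {α : ℝ} (hα : 0 < α)
    (f : Ω → ℝ≥0∞) : ∫⁻ ω, f ω ∂P = ⨆ K, ∫⁻ ω in truncSet P X R α K, f ω ∂P := by
  have hmono : Monotone (truncSet P X R α) := by
    intro K L hKL ω hω
    have hKL' : (K : ℝ) ≤ L := by exact_mod_cast hKL
    refine ⟨hω.1.trans (by linarith), le_trans ?_ hω.2⟩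
    gcongr
  have hU : ⋃ K, truncSet P X R α K = Set.univ := by
    refine Set.eq_univ_of_forall fun ω => Set.mem_iUnion.2 ?_
    have h1 : ∀ᶠ K : ℕ in atTop, R ω ≤ K := tendsto_natCast_atTop_atTop.eventually_ge_atTop _
    have h2 := tendsto_inv_nat_real.eventually (gt_mem_nhds (h.denom_pos hα ω))
    obtain ⟨K, hK1, hK2⟩ := (h1.and h2).exists
    exact ⟨K, by linarith, hK2.le⟩
  rw [← setLIntegral_iUnion_of_directed f hmono.directed_le, hU, Measure.restrict_univ]

/-- Writing `1 = exp (-α V) + (1 - exp (-α V))` under the weight isolates the initial term of the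
martingale identity, which then cancels. -/
lemma truncWeight_split (h : IsOnPeriod P G X V R) {α : ℝ} (hα : 0 < α) (K : ℕ) :
    ∫⁻ ω, truncWeight P X R α K ω ∂P =
      ∫⁻ ω, truncWeight P X R α K ω * ENNReal.ofReal (Real.exp (-α * V ω)) ∂P +
      ∫⁻ ω in truncSet P X R α K,
        ENNReal.ofReal ((1 - Real.exp (-α * V ω)) / (α * R ω - exponent P X α)) ∂P := by
  have hV := h.measurable_V'
  have hm := (h.measurable_truncWeight α K).mono (G.le _) le_rfl
  rw [← lintegral_indicator (G.le _ _ (h.measurableSet_truncSet α K)),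
    ← lintegral_add_left (by fun_prop)]
  refine lintegral_congr fun ω => ?_
  classical
  unfold truncWeight
  simp only [Set.indicator_apply]
  split_ifs with hω
  · have h1 := h.denom_pos hα ω
    have h2 : Real.exp (-α * V ω) ≤ 1 := by
      rw [Real.exp_le_one_iff]
      nlinarith [h.V_nonneg ω]
    rw [← ENNReal.ofReal_mul (by positivity), ← ENNReal.ofReal_add (by positivity)
      (div_nonneg (by linarith) h1.le)]
    congr 1
    field_simp
    ring
  · simp

lemma lintegral_truncWeight_mul (h : IsOnPeriod P G X V R) {α : ℝ} (hα : 0 < α) (K : ℕ)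
    (f : Ω → ℝ≥0∞) :
    ∫⁻ ω, truncWeight P X R α K ω * (ENNReal.ofReal (α * R ω - exponent P X α) * f ω) ∂P =
      ∫⁻ ω in truncSet P X R α K, f ω ∂P := by
  rw [← lintegral_indicator (G.le _ _ (h.measurableSet_truncSet α K))]
  refine lintegral_congr fun ω => ?_
  classical
  unfold truncWeight
  simp only [Set.indicator_apply]
  split_ifs with hω
  · have h1 := h.denom_pos hα ω
    rw [← mul_assoc, ← ENNReal.ofReal_mul (by positivity), inv_mul_cancel₀ h1.ne']
    simp
  · simp

lemma lintegral_truncWeight_ne_top (h : IsOnPeriod P G X V R) {α : ℝ} (hα : 0 < α) (K : ℕ) :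
    ∫⁻ ω, truncWeight P X R α K ω * ENNReal.ofReal (Real.exp (-α * V ω)) ∂P ≠ ∞ := by
  refine ne_top_of_le_ne_top (b := ENNReal.ofReal ((K : ℝ) + 1)) ENNReal.ofReal_ne_top ?_
  have : ∀ ω, truncWeight P X R α K ω * ENNReal.ofReal (Real.exp (-α * V ω)) ≤
      ENNReal.ofReal ((K : ℝ) + 1) := fun ω => by
    refine (mul_le_of_le_one_right' ?_).trans (truncWeight_le α K ω)
    refine ENNReal.ofReal_le_one.2 (Real.exp_le_one_iff.2 ?_)
    nlinarith [h.V_nonneg ω]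
  simpa using lintegral_mono (μ := P) this

lemma lintegral_pathLaplace_le (h : IsOnPeriod P G X V R) {α : ℝ} (hα : 0 < α) :
    ∫⁻ ω, pathLaplace α (workload X V R ω) ∂P ≤
      ∫⁻ ω, ENNReal.ofReal ((1 - Real.exp (-α * V ω)) / (α * R ω - exponent P X α)) ∂P := by
  rw [h.lintegral_eq_iSup_truncSet hα, h.lintegral_eq_iSup_truncSet hα]
  refine iSup_mono fun K => ?_
  have h1 := h.lintegral_pathLaplace_mul_le hα (h.measurable_truncWeight α K)
    (truncWeight_le α K) (le_of_truncWeight_ne_zero α K)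
  rw [h.truncWeight_split hα K, h.lintegral_truncWeight_mul hα] at h1
  exact (ENNReal.add_le_add_iff_left (h.lintegral_truncWeight_ne_top hα K)).1 h1

/-- The transform of the occupation measure of an on period. -/
lemma lintegral_pathLaplace (h : IsOnPeriod P G X V R) {α : ℝ} (hα : 0 < α)
    (hS : ∫⁻ ω, negTime (workload X V R ω) ∂P ≠ ∞) :
    ∫⁻ ω, pathLaplace α (workload X V R ω) ∂P =
      ∫⁻ ω, ENNReal.ofReal ((1 - Real.exp (-α * V ω)) / (α * R ω - exponent P X α)) ∂P := by
  rw [h.lintegral_eq_iSup_truncSet hα, h.lintegral_eq_iSup_truncSet hα]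
  congr 1
  ext K
  have h1 := h.lintegral_pathLaplace_mul hα hS (h.measurable_truncWeight α K)
    (truncWeight_le α K) (le_of_truncWeight_ne_zero α K)
  rw [h.truncWeight_split hα K, h.lintegral_truncWeight_mul hα] at h1
  exact (ENNReal.add_right_inj (h.lintegral_truncWeight_ne_top hα K)).1 h1

lemma transform_le (h : IsOnPeriod P G X V R) {α : ℝ} (hα : 0 < α) (ω : Ω) :
    (1 - Real.exp (-α * V ω)) / (α * R ω - exponent P X α) ≤ V ω / (R ω - meanRate P X) := by
  have h1 := sub_pos.2 (h.R_gt ω)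
  have h2 := h.V_nonneg ω
  calc _ ≤ (α * V ω) / (α * (R ω - meanRate P X)) := by
        gcongr
        · linarith [Real.add_one_le_exp (-α * V ω)]
        · exact h.mul_sub_meanRate_le hα.le ω
    _ = _ := by field_simp

/-- Fatou as `α → 0` in the one-sided transform bound. This gives the finite mean that the equality
case requires. -/
lemma lintegral_negTime_le (h : IsOnPeriod P G X V R) :
    ∫⁻ ω, negTime (workload X V R ω) ∂P ≤
      ∫⁻ ω, ENNReal.ofReal (V ω / (R ω - meanRate P X)) ∂P := by
  calc _ ≤ ∫⁻ ω, liminf (fun k : ℕ => pathLaplace ((k : ℝ) + 1)⁻¹ (workload X V R ω)) atTop ∂P :=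
        lintegral_mono fun ω => (h.isWorkloadPath ω).negTime_le_liminf_pathLaplace
    _ ≤ liminf (fun k : ℕ => ∫⁻ ω, pathLaplace ((k : ℝ) + 1)⁻¹ (workload X V R ω) ∂P) atTop :=
        lintegral_liminf_le fun k => h.measurable_pathLaplace _
    _ ≤ liminf (fun k : ℕ => ∫⁻ ω, ENNReal.ofReal (V ω / (R ω - meanRate P X)) ∂P) atTop := by
        refine liminf_le_liminf (Eventually.of_forall fun k => ?_)
        have hk : (0 : ℝ) < ((k : ℝ) + 1)⁻¹ := by positivity
        refine (h.lintegral_pathLaplace_le hk).trans (lintegral_mono fun ω => ?_)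
        exact ENNReal.ofReal_le_ofReal (h.transform_le hk ω)
    _ = _ := by simp

/-- The mean length of an on period. -/
lemma lintegral_negTime (h : IsOnPeriod P G X V R)
    (hVR : ∫⁻ ω, ENNReal.ofReal (V ω / (R ω - meanRate P X)) ∂P ≠ ∞) :
    ∫⁻ ω, negTime (workload X V R ω) ∂P =
      ∫⁻ ω, ENNReal.ofReal (V ω / (R ω - meanRate P X)) ∂P := by
  have hS := ne_top_of_le_ne_top hVR h.lintegral_negTime_le
  refine le_antisymm h.lintegral_negTime_le ?_
  have hV := h.measurable_V'
  have hR := h.measurable_R'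
  -- The ratio is the limit of the transforms as `α = 1 / (k + 1)` tends to zero, since `η α / α`
  -- tends to the mean rate; each transform is the mean of some `pathLaplace`, at most that of
  -- `negTime`.
  calc _ ≤ ∫⁻ ω, liminf (fun k : ℕ => ENNReal.ofReal ((1 - Real.exp (-((k : ℝ) + 1)⁻¹ * V ω)) /
            (((k : ℝ) + 1)⁻¹ * R ω - exponent P X ((k : ℝ) + 1)⁻¹))) atTop ∂P := by
        refine lintegral_mono fun ω => (Tendsto.liminf_eq ?_).ge
        refine ENNReal.tendsto_ofReal ?_
        have h1 : Tendsto (fun k : ℕ => (1 - Real.exp (-((k : ℝ) + 1)⁻¹ * V ω)) * ((k : ℝ) + 1))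
            atTop (𝓝 (V ω)) := by
          have hd : HasDerivAt (fun a : ℝ => 1 - Real.exp (-a * V ω)) (V ω) 0 := by
            have := (((hasDerivAt_id (0 : ℝ)).neg.mul_const (V ω)).exp).const_sub 1
            simpa using! this
          have ht : Tendsto (fun k : ℕ => ((k : ℝ) + 1)⁻¹) atTop (𝓝[≠] 0) :=
            tendsto_nhdsWithin_iff.2 ⟨tendsto_inv_nat_real, Eventually.of_forall fun k => by
              simp only [Set.mem_compl_iff, Set.mem_singleton_iff]
              positivity⟩
          have := (hasDerivAt_iff_tendsto_slope_zero.1 hd).comp ht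
          refine this.congr fun k => ?_
          simp
          ring
        have h2 := (h.subordinator.tendsto_exponent_div h.integrable).const_sub (R ω)
        refine (h1.div h2 (sub_pos.2 (h.R_gt ω)).ne').congr fun k => ?_
        have h3 : (0 : ℝ) < (k : ℝ) + 1 := by positivity
        have h4 : R ω - exponent P X ((k : ℝ) + 1)⁻¹ * ((k : ℝ) + 1) =
            (((k : ℝ) + 1)⁻¹ * R ω - exponent P X ((k : ℝ) + 1)⁻¹) * ((k : ℝ) + 1) := by
          field_simp
        simp only [Pi.div_apply]
        rw [h4, mul_div_mul_right _ _ h3.ne']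
    _ ≤ liminf (fun k : ℕ => ∫⁻ ω, ENNReal.ofReal ((1 - Real.exp (-((k : ℝ) + 1)⁻¹ * V ω)) /
            (((k : ℝ) + 1)⁻¹ * R ω - exponent P X ((k : ℝ) + 1)⁻¹)) ∂P) atTop :=
        lintegral_liminf_le fun k => by fun_prop
    _ ≤ liminf (fun k : ℕ => ∫⁻ ω, negTime (workload X V R ω) ∂P) atTop := by
        refine liminf_le_liminf (Eventually.of_forall fun k => ?_)
        have hk : (0 : ℝ) < ((k : ℝ) + 1)⁻¹ := by positivity
        rw [← h.lintegral_pathLaplace hk hS]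
        exact lintegral_mono fun ω => pathLaplace_le_negTime hk.le _
    _ = _ := by simp

end IsOnPeriod

end OnPeriodMean

/-! ### The strong Markov property of a subordinator. -/

section StrongMarkov

lemma untopA_coe (t : ℝ≥0) : (t : WithTop ℝ≥0).untopA = t := rfl

lemma add_coe_ne_top {x : WithTop ℝ≥0} (h : x ≠ ⊤) (s : ℝ≥0) : x + s ≠ ⊤ := by
  lift x to ℝ≥0 using h
  exact WithTop.coe_ne_top

/-- The increments `J (τ + s) - J τ` after the stopping time `τ`. -/
def shift {Ω : Type*} (J : ℝ≥0 → Ω → ℝ) (τ : Ω → WithTop ℝ≥0) (s : ℝ≥0) (ω : Ω) : ℝ :=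
  stoppedValue J (fun ω => τ ω + s) ω - stoppedValue J τ ω

lemma shift_of_ne_top {Ω : Type*} {J : ℝ≥0 → Ω → ℝ} {τ : Ω → WithTop ℝ≥0} {ω : Ω}
    (h : τ ω ≠ ⊤) (s : ℝ≥0) :
    shift J τ s ω = J ((τ ω).untopA + s) ω - J (τ ω).untopA ω := by
  unfold shift stoppedValue
  lift τ ω to ℝ≥0 using h with t
  rw [← WithTop.coe_add, untopA_coe, untopA_coe]

lemma shift_of_eq_top {Ω : Type*} {J : ℝ≥0 → Ω → ℝ} {τ : Ω → WithTop ℝ≥0} {ω : Ω}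
    (h : τ ω = ⊤) (s : ℝ≥0) : shift J τ s ω = 0 := by
  simp only [shift, stoppedValue, h]
  rw [WithTop.top_add, sub_self]

/-- Increments of the shifted process are increments after the stopping time `τ + s`. Stationarity
and independence therefore reduce to one statement about a single stopping time. -/
lemma shift_shift {Ω : Type*} (J : ℝ≥0 → Ω → ℝ) (τ : Ω → WithTop ℝ≥0) (s h : ℝ≥0) (ω : Ω) :
    shift J τ (s + h) ω - shift J τ s ω = shift J (fun ω => τ ω + s) h ω := by
  simp only [shift, WithTop.coe_add, add_assoc, sub_sub_sub_cancel_right]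

variable {Ω : Type*} [mΩ : MeasurableSpace Ω] {P : Measure Ω}
  {F : Filtration ℝ≥0 mΩ} {J : ℝ≥0 → Ω → ℝ} {τ : Ω → WithTop ℝ≥0}

lemma isStoppingTime_add_nnreal (hτ : IsStoppingTime F τ) (s : ℝ≥0) :
    IsStoppingTime F fun ω => τ ω + s := by
  intro i
  by_cases hs : s ≤ i
  · have : {ω | τ ω + (s : WithTop ℝ≥0) ≤ i} = {ω | τ ω ≤ ((i - s : ℝ≥0) : WithTop ℝ≥0)} := by
      ext ω
      simp only [Set.mem_ofPred_eq]
      cases τ ω with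
      | top =>
        rw [WithTop.top_add, top_le_iff, top_le_iff]
        simp only [WithTop.coe_ne_top]
      | coe t =>
        rw [← WithTop.coe_add, WithTop.coe_le_coe, WithTop.coe_le_coe]
        exact (le_tsub_iff_right hs).symm
    rw [this]
    exact F.mono tsub_le_self _ (hτ (i - s))
  · have : {ω | τ ω + (s : WithTop ℝ≥0) ≤ i} = ∅ := by
      refine Set.eq_empty_of_forall_notMem fun ω hω => hs ?_
      rw [Set.mem_ofPred_eq] at hω
      exact WithTop.coe_le_coe.1 (le_trans le_add_self hω)
    rw [this]
    exact @MeasurableSet.empty _ (F i)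

/-- The filtration `s ↦ F_{τ + s}`. -/
def shiftFiltration (hτ : IsStoppingTime F τ) : Filtration ℝ≥0 mΩ where
  seq s := (isStoppingTime_add_nnreal hτ s).measurableSpace
  mono' _ _ hst := IsStoppingTime.measurableSpace_mono _ _ fun _ =>
    add_le_add le_rfl (WithTop.coe_le_coe.2 hst)
  le' s := (isStoppingTime_add_nnreal hτ s).measurableSpace_le

/-- Freezing the path at time `i` keeps it right-continuous and makes all its values `F
i`-measurable. -/
lemma IsSubordinator.isStronglyProgressive (hJ : IsSubordinator P F J) :
    IsStronglyProgressive F J := by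
  intro i
  have h1 : Measurable[(inferInstance : MeasurableSpace ℝ≥0).prod (F i)]
      (Function.uncurry fun s ω => J (min s i) ω) := by
    refine @measurable_uncurry_of_rightCont Ω (F i) _
      (fun t => (hJ.adapted (min t i)).mono (F.mono (min_le_right _ _)) le_rfl) fun ω t => ?_
    rcases lt_or_ge t i with ht | ht
    · have h2 : (fun s => J (min s i) ω) =ᶠ[𝓝[>] t] fun s => J s ω := by
        filter_upwards [nhdsWithin_le_nhds (gt_mem_nhds ht)] with s hs
        rw [min_eq_left (le_of_lt hs)]
      exact (hJ.rightCont ω t).congr_of_eventuallyEq h2 (by rw [min_eq_left ht.le])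
    · have h2 : (fun s => J (min s i) ω) =ᶠ[𝓝[>] t] fun _ => J i ω := by
        filter_upwards [self_mem_nhdsWithin] with s hs
        rw [min_eq_right (ht.trans (le_of_lt hs))]
      exact continuousWithinAt_const.congr_of_eventuallyEq h2 (by rw [min_eq_right ht])
  have h2 : (fun p : Set.Iic i × Ω => J p.1 p.2) =
      (Function.uncurry fun s ω => J (min s i) ω) ∘ fun p : Set.Iic i × Ω => ((p.1 : ℝ≥0), p.2) := by
    ext p
    simp only [Function.comp_apply, Function.uncurry]
    rw [min_eq_left p.1.2]
  refine Measurable.stronglyMeasurable ?_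
  rw [h2]
  refine h1.comp ?_
  exact @Measurable.prodMk _ (Subtype.instMeasurableSpace.prod (F i)) _ _ _ (F i) _ _
    (measurable_subtype_coe.comp (@measurable_fst _ _ _ (F i))) (@measurable_snd _ _ _ (F i))

/-- On this event `upperGrid n σ` equals `(k + 1) / (n + 1)`, and by that time the event has been
decided. -/
lemma measurableSet_floor_eq {σ : Ω → WithTop ℝ≥0} (hσ : IsStoppingTime F σ) {A : Set Ω}
    (hA : MeasurableSet[hσ.measurableSpace] A) (n k : ℕ) :
    MeasurableSet[F ((k + 1 : ℕ) / (n + 1))]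
      (A ∩ {ω | σ ω ≠ ⊤ ∧ ⌊(n + 1 : ℝ≥0) * (σ ω).untopA⌋₊ = k}) := by
  set t : ℝ≥0 := (k + 1 : ℕ) / (n + 1)
  set u : ℝ≥0 := k / (n + 1)
  have hut : u ≤ t := by
    simp only [u, t]
    gcongr
    simp
  -- The redundant factor `σ ≤ t` is present because membership of `A` in the σ-algebra at `σ`
  -- speaks of `A ∩ {σ ≤ t}`.
  have h : A ∩ {ω | σ ω ≠ ⊤ ∧ ⌊(n + 1 : ℝ≥0) * (σ ω).untopA⌋₊ = k} =
      (A ∩ {ω | σ ω ≤ t}) ∩ ({ω | σ ω < t} ∩ {ω | σ ω < u}ᶜ) := by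
    ext ω
    simp only [Set.mem_inter_iff, Set.mem_ofPred_eq, Set.mem_compl_iff, not_lt, and_assoc]
    refine and_congr_right fun _ => ?_
    cases hω : σ ω with
    | top =>
      simp only [ne_eq, not_true_eq_false, false_and, top_le_iff, WithTop.coe_ne_top]
    | coe x =>
      simp only [ne_eq, WithTop.coe_ne_top, not_false_eq_true, true_and, untopA_coe,
        WithTop.coe_le_coe, WithTop.coe_lt_coe, Nat.floor_eq_iff zero_le]
      simp only [t, u]
      rw [lt_div_iff₀ (by positivity), div_le_iff₀ (by positivity), le_div_iff₀ (by positivity),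
        mul_comm x]
      push_cast
      constructor
      · rintro ⟨h1, h2⟩
        exact ⟨h2.le, h2, h1⟩
      · rintro ⟨-, h2, h1⟩
        exact ⟨h1, h2⟩
  rw [h]
  exact (hA.2 t).inter ((hσ.measurableSet_lt t).inter (F.mono hut _ (hσ.measurableSet_lt u)).compl)

lemma IsSubordinator.measurable_stoppedValue (hJ : IsSubordinator P F J)
    (hτ : IsStoppingTime F τ) : Measurable[hτ.measurableSpace] (stoppedValue J τ) :=
  MeasureTheory.measurable_stoppedValue hJ.isStronglyProgressive hτ

/-- The discretized stopping time has countably many values; on each piece the independence at a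
fixed time applies, and the pieces are summed. -/
lemma IsSubordinator.map_restrict_increment_grid (hJ : IsSubordinator P F J)
    {σ : Ω → WithTop ℝ≥0} (hσ : IsStoppingTime F σ) (hσt : ∀ᵐ ω ∂P, σ ω ≠ ⊤) {A : Set Ω}
    (hA : MeasurableSet[hσ.measurableSpace] A) (h : ℝ≥0) (n : ℕ) {B : Set ℝ}
    (hB : MeasurableSet B) :
    P (A ∩ {ω | J (upperGrid n (σ ω).untopA + h) ω - J (upperGrid n (σ ω).untopA) ω ∈ B}) =
      P A * P.map (J h) B := by
  set E : ℕ → Set Ω := fun k => {ω | σ ω ≠ ⊤ ∧ ⌊(n + 1 : ℝ≥0) * (σ ω).untopA⌋₊ = k}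
  set t : ℕ → ℝ≥0 := fun k => (k + 1 : ℕ) / (n + 1)
  have hAE : ∀ k, MeasurableSet[F (t k)] (A ∩ E k) := fun k => measurableSet_floor_eq hσ hA n k
  have hD : ∀ k, MeasurableSet {ω | J (t k + h) ω - J (t k) ω ∈ B} := fun k =>
    ((hJ.measurable _).sub (hJ.measurable _)) hB
  have hdisj : ∀ C : ℕ → Set Ω, Pairwise (Function.onFun Disjoint fun k => (A ∩ E k) ∩ C k) := by
    intro C i j hij
    refine Set.disjoint_left.2 ?_
    rintro ω ⟨⟨-, -, h1⟩, -⟩ ⟨⟨-, -, h2⟩, -⟩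
    exact hij (h1.symm.trans h2)
  have hae : ∀ᵐ ω ∂P, ω ∈ ⋃ k, E k := hσt.mono fun ω hω => Set.mem_iUnion.2 ⟨_, hω, rfl⟩
  have h1 : P (A ∩ {ω | J (upperGrid n (σ ω).untopA + h) ω - J (upperGrid n (σ ω).untopA) ω ∈ B}) =
      P (⋃ k, (A ∩ E k) ∩ {ω | J (t k + h) ω - J (t k) ω ∈ B}) := by
    refine measure_congr ?_
    filter_upwards [hae] with ω hω
    refine propext ?_
    obtain ⟨k, hk⟩ := Set.mem_iUnion.1 hω
    have hup : upperGrid n (σ ω).untopA = t k := by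
      rw [upperGrid, hk.2]
    change ω ∈ A ∩ _ ↔ ω ∈ ⋃ k, _
    simp only [Set.mem_inter_iff, Set.mem_iUnion, Set.mem_ofPred_eq, hup]
    constructor
    · rintro ⟨ha, hb⟩
      exact ⟨k, ⟨ha, hk⟩, hb⟩
    · rintro ⟨j, ⟨ha, hj⟩, hb⟩
      have : j = k := hj.2.symm.trans hk.2
      exact ⟨ha, this ▸ hb⟩
  have h2 : P A = P (⋃ k, (A ∩ E k) ∩ Set.univ) := by
    refine measure_congr ?_
    filter_upwards [hae] with ω hω
    refine propext ?_
    obtain ⟨k, hk⟩ := Set.mem_iUnion.1 hω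
    change ω ∈ A ↔ ω ∈ ⋃ k, _
    simp only [Set.mem_inter_iff, Set.mem_iUnion, Set.mem_univ, and_true]
    exact ⟨fun ha => ⟨k, ha, hk⟩, fun ⟨_, ha, _⟩ => ha⟩
  rw [h1, h2, measure_iUnion (hdisj _) fun k => (F.le _ _ (hAE k)).inter (hD k),
    measure_iUnion (hdisj _) fun k => (F.le _ _ (hAE k)).inter .univ, ← ENNReal.tsum_mul_right]
  refine tsum_congr fun k => ?_
  have hind := (Indep_iff _ _ _).1 (hJ.indep (t k) h) {ω | J (t k + h) ω - J (t k) ω ∈ B} (A ∩ E k)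
    ⟨B, hB, rfl⟩ (hAE k)
  rw [Set.inter_comm, hind, mul_comm, Set.inter_univ, ← (hJ.stationary (t k) h).map_eq,
    Measure.map_apply ((hJ.measurable _).fun_sub (hJ.measurable _)) hB]
  rfl

variable [IsProbabilityMeasure P]

/-- The increment of a subordinator after a stopping time `σ` is independent of `F_σ` and has the
law of `J h`. -/
lemma IsSubordinator.map_restrict_increment (hJ : IsSubordinator P F J)
    {σ : Ω → WithTop ℝ≥0} (hσ : IsStoppingTime F σ) (hσt : ∀ᵐ ω ∂P, σ ω ≠ ⊤) {A : Set Ω}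
    (hA : MeasurableSet[hσ.measurableSpace] A) (h : ℝ≥0) :
    (P.restrict A).map (shift J σ h) = P A • P.map (J h) := by
  have hA' : MeasurableSet A := hσ.measurableSpace_le _ hA
  have hm : Measurable (shift J σ h) :=
    ((hJ.measurable_stoppedValue (isStoppingTime_add_nnreal hσ h)).mono
      (IsStoppingTime.measurableSpace_le _) le_rfl).sub
      ((hJ.measurable_stoppedValue hσ).mono (IsStoppingTime.measurableSpace_le _) le_rfl)
  have hσm : Measurable fun ω => (σ ω).untopA := by
    have h1 : Measurable σ := hσ.measurable'
    exact h1.untopA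
  have hmn : ∀ n, Measurable fun ω =>
      J (upperGrid n (σ ω).untopA + h) ω - J (upperGrid n (σ ω).untopA) ω := fun n => by
    have hu := measurable_uncurry_of_rightCont hJ.measurable hJ.rightCont
    have hup := (measurable_upperGrid n).comp hσm
    exact (hu.comp ((hup.add_const h).prodMk measurable_id)).sub (hu.comp (hup.prodMk measurable_id))
  have hlaw : ∀ n, (P.restrict A).map (fun ω =>
      J (upperGrid n (σ ω).untopA + h) ω - J (upperGrid n (σ ω).untopA) ω) = P A • P.map (J h) := by
    intro n
    ext B hB
    rw [Measure.map_apply (hmn n) hB, Measure.restrict_apply (hmn n hB), Set.inter_comm]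
    exact hJ.map_restrict_increment_grid hσ hσt hA h n hB
  have : IsProbabilityMeasure (P.map (J h)) := Measure.isProbabilityMeasure_map (hJ.measurable h).aemeasurable
  have : IsFiniteMeasure (P A • P.map (J h)) := Measure.smul_finite _ (measure_ne_top P A)
  have : IsFiniteMeasure ((P.restrict A).map (shift J σ h)) := inferInstance
  refine ext_of_forall_integral_eq_of_IsFiniteMeasure fun f => ?_
  rw [integral_map hm.aemeasurable f.continuous.aestronglyMeasurable]
  -- The discretized increments all have the required law, and right continuity at `σ` and at `σ +
  -- h` carries it to the limit against bounded continuous functions.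
  have hlim : Tendsto (fun n => ∫ ω in A, f (J (upperGrid n (σ ω).untopA + h) ω -
      J (upperGrid n (σ ω).untopA) ω) ∂P) atTop (𝓝 (∫ ω in A, f (shift J σ h ω) ∂P)) := by
    refine tendsto_integral_of_dominated_convergence (fun _ => ‖f‖)
      (fun n => (f.continuous.measurable.comp (hmn n)).aestronglyMeasurable) (integrable_const _)
      (fun n => Eventually.of_forall fun ω => f.norm_coe_le_norm _) ?_
    filter_upwards [ae_restrict_of_ae hσt] with ω hω
    refine (f.continuous.tendsto _).comp ?_
    rw [shift_of_ne_top hω]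
    have h1 := tendsto_upperGrid (σ ω).untopA
    refine Tendsto.sub ?_ ((hJ.rightCont ω _).tendsto.comp h1)
    refine (hJ.rightCont ω ((σ ω).untopA + h)).tendsto.comp ?_
    refine tendsto_nhdsWithin_iff.2 ⟨(h1.mono_right nhdsWithin_le_nhds).add_const h,
      Eventually.of_forall fun n => ?_⟩
    exact add_lt_add_left (lt_upperGrid n _) h
  refine tendsto_nhds_unique hlim (tendsto_const_nhds.congr fun n => ?_)
  rw [← hlaw n, integral_map (hmn n).aemeasurable f.continuous.aestronglyMeasurable]

lemma IsSubordinator.identDistrib_shift (hJ : IsSubordinator P F J) (hτ : IsStoppingTime F τ)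
    (hτt : ∀ᵐ ω ∂P, τ ω ≠ ⊤) (h : ℝ≥0) : IdentDistrib (shift J τ h) (J h) P P where
  aemeasurable_fst := (((hJ.measurable_stoppedValue (isStoppingTime_add_nnreal hτ h)).mono
      (IsStoppingTime.measurableSpace_le _) le_rfl).sub
      ((hJ.measurable_stoppedValue hτ).mono (IsStoppingTime.measurableSpace_le _) le_rfl)).aemeasurable
  aemeasurable_snd := (hJ.measurable h).aemeasurable
  map_eq := by
    have := hJ.map_restrict_increment hτ hτt (A := Set.univ) MeasurableSet.univ h
    simpa using this

/-- The strong Markov property of a subordinator. -/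
lemma IsSubordinator.shift (hJ : IsSubordinator P F J) (hτ : IsStoppingTime F τ)
    (hτt : ∀ᵐ ω ∂P, τ ω ≠ ⊤) : IsSubordinator P (shiftFiltration hτ) (shift J τ) where
  adapted s := by
    refine (hJ.measurable_stoppedValue (isStoppingTime_add_nnreal hτ s)).sub ?_
    refine (hJ.measurable_stoppedValue hτ).mono ?_ le_rfl
    exact IsStoppingTime.measurableSpace_mono _ _ fun ω => le_self_add
  zero ω := by simp [LevyStorage.shift]
  mono ω := by
    by_cases hω : τ ω = ⊤
    · simp only [shift_of_eq_top hω]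
      exact monotone_const
    · intro s t hst
      simp only [shift_of_ne_top hω]
      exact sub_le_sub_right (hJ.mono ω (by gcongr)) _
  rightCont ω t := by
    by_cases hω : τ ω = ⊤
    · simp only [shift_of_eq_top hω]
      exact continuousWithinAt_const
    · simp only [shift_of_ne_top hω]
      refine ContinuousWithinAt.sub ?_ continuousWithinAt_const
      refine (hJ.rightCont ω ((τ ω).untopA + t)).comp
        (Continuous.continuousWithinAt (by fun_prop)) fun s hs => ?_
      exact add_lt_add_right (Set.mem_Ioi.1 hs) _
  stationary s h := by
    simp_rw [shift_shift]
    refine (hJ.identDistrib_shift (isStoppingTime_add_nnreal hτ s) ?_ h).trans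
      (hJ.identDistrib_shift hτ hτt h).symm
    exact hτt.mono fun ω hω => add_coe_ne_top hω s
  indep s h := by
    simp_rw [shift_shift]
    have hσ := isStoppingTime_add_nnreal hτ s
    have hσt : ∀ᵐ ω ∂P, τ ω + s ≠ ⊤ :=
      hτt.mono fun ω hω => add_coe_ne_top hω s
    have hid := hJ.identDistrib_shift hσ hσt h
    have hm : Measurable (LevyStorage.shift J (fun ω => τ ω + s) h) :=
      ((hJ.measurable_stoppedValue (isStoppingTime_add_nnreal hσ h)).mono
      (IsStoppingTime.measurableSpace_le _) le_rfl).sub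
      ((hJ.measurable_stoppedValue hσ).mono (IsStoppingTime.measurableSpace_le _) le_rfl)
    rw [Indep_iff]
    rintro _ A ⟨B, hB, rfl⟩ hA
    have h1 := congrArg (fun μ => μ B) (hJ.map_restrict_increment hσ hσt hA h)
    simp only [Measure.smul_apply, smul_eq_mul] at h1
    rw [Measure.map_apply hm hB, Measure.restrict_apply (hm hB), ← hid.map_eq,
      Measure.map_apply hm hB, mul_comm] at h1
    exact h1

end StrongMarkov

/-! ### The occupation measure of an on period, and equality of the two passage times. -/

section Occupation

/-- The points `(ω, s)` such that `s` is before the end of the on period. -/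
def region {Ω : Type*} (X : ℝ≥0 → Ω → ℝ) (V R : Ω → ℝ) : Set (Ω × ℝ) :=
  {p : Ω × ℝ | ENNReal.ofReal p.2 < negTime (workload X V R p.1)}

/-- The integral of `f` along an on period. -/
def onIntegral {Ω : Type*} (X : ℝ≥0 → Ω → ℝ) (V R : Ω → ℝ) (f : ℝ → ℝ) (ω : Ω) : ℝ :=
  ∫ s in Set.Ioi (0 : ℝ), (region X V R).indicator (fun p => f (workload X V R p.1 p.2.toNNReal))
    (ω, s)

lemma onIntegral_eq {Ω : Type*} {X : ℝ≥0 → Ω → ℝ} {V R : Ω → ℝ} (f : ℝ → ℝ) {ω : Ω}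
    (hS : negTime (workload X V R ω) ≠ ∞) :
    onIntegral X V R f ω = ∫ s in (0 : ℝ)..(negTime (workload X V R ω)).toReal,
      f (workload X V R ω s.toNNReal) := by
  classical
  rw [onIntegral, intervalIntegral.integral_of_le ENNReal.toReal_nonneg,
    integral_Ioc_eq_integral_Ioo, ← Set.Ioi_inter_Iio, ← setIntegral_indicator measurableSet_Iio]
  refine setIntegral_congr_fun measurableSet_Ioi fun s hs => ?_
  have : ENNReal.ofReal s < negTime (workload X V R ω) ↔
      s < (negTime (workload X V R ω)).toReal := ENNReal.ofReal_lt_iff_lt_toReal (le_of_lt hs) hS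
  simp only [Set.indicator_apply, region, Set.mem_ofPred_eq, Set.mem_Iio, this]

variable {Ω : Type*} [mΩ : MeasurableSpace Ω] {P : Measure Ω}
  {G : Filtration ℝ≥0 mΩ} {X : ℝ≥0 → Ω → ℝ} {V R : Ω → ℝ}

namespace IsOnPeriod

lemma smul_V (h : IsOnPeriod P G X V R) {c : ℝ} (hc : 0 ≤ c) :
    IsOnPeriod P G X (fun ω => c * V ω) R where
  subordinator := h.subordinator
  integrable := h.integrable
  measurable_V := h.measurable_V.const_mul c
  measurable_R := h.measurable_R
  V_nonneg ω := mul_nonneg hc (h.V_nonneg ω)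
  R_gt := h.R_gt

/-- The occupation measure of the workload during an on period. -/
def occupation (P : Measure Ω) (X : ℝ≥0 → Ω → ℝ) (V R : Ω → ℝ) : Measure ℝ :=
  ((P.prod (volume.restrict (Set.Ioi (0 : ℝ)))).restrict (region X V R)).map
    fun p => workload X V R p.1 p.2.toNNReal

lemma measurableSet_region (h : IsOnPeriod P G X V R) : MeasurableSet (region X V R) :=
  h.measurableSet_lt_negTime

lemma occupation_Iio (h : IsOnPeriod P G X V R) : occupation P X V R (Set.Iio 0) = 0 := by
  have hm := h.measurable_workload_toNNReal
  rw [occupation, Measure.map_apply hm measurableSet_Iio, Measure.restrict_apply (hm measurableSet_Iio)]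
  have : (fun p : Ω × ℝ => workload X V R p.1 p.2.toNNReal) ⁻¹' Set.Iio 0 ∩ region X V R = ∅ := by
    refine Set.eq_empty_of_forall_notMem ?_
    rintro ⟨ω, s⟩ ⟨h1, h2⟩
    exact absurd (nonneg_of_lt_negTime h2) (not_le.2 h1)
  rw [this, measure_empty]

lemma measurable_onIntegral (h : IsOnPeriod P G X V R) (f : ℝ →ᵇ ℝ) :
    Measurable (onIntegral X V R f) := by
  have h1 : StronglyMeasurable ((region X V R).indicator fun p : Ω × ℝ =>
      f (workload X V R p.1 p.2.toNNReal)) :=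
    ((f.continuous.measurable.comp h.measurable_workload_toNNReal).indicator
      h.measurableSet_region).stronglyMeasurable
  exact h1.integral_prod_right'.measurable

lemma lintegral_occupation (h : IsOnPeriod P G X V R) {f : ℝ → ℝ≥0∞} (hf : Measurable f) :
    ∫⁻ x, f x ∂(occupation P X V R) = ∫⁻ ω, (∫⁻ s in Set.Ioi (0 : ℝ),
      if ENNReal.ofReal s < negTime (workload X V R ω) then f (workload X V R ω s.toNNReal) else 0)
      ∂P := by
  classical
  have hm := h.measurable_workload_toNNReal
  rw [occupation, lintegral_map hf hm, ← lintegral_indicator h.measurableSet_region,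
    lintegral_prod (fun p => (region X V R).indicator
      (fun p => f (workload X V R p.1 p.2.toNNReal)) p)
      ((hf.comp hm).indicator h.measurableSet_region).aemeasurable]
  simp only [Set.indicator_apply, region, Set.mem_ofPred_eq]

lemma occupation_univ (h : IsOnPeriod P G X V R) :
    occupation P X V R Set.univ = ∫⁻ ω, negTime (workload X V R ω) ∂P := by
  rw [← lintegral_one, h.lintegral_occupation measurable_const]
  refine lintegral_congr fun ω => ?_
  refine Eq.trans ?_ pathLaplace_zero
  simp [pathLaplace]

lemma lintegral_exp_occupation (h : IsOnPeriod P G X V R) (α : ℝ) :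
    ∫⁻ x, ENNReal.ofReal (Real.exp (-α * x)) ∂(occupation P X V R) =
      ∫⁻ ω, pathLaplace α (workload X V R ω) ∂P := by
  rw [h.lintegral_occupation (by fun_prop)]
  rfl

lemma integrable_region (h : IsOnPeriod P G X V R)
    (hS : ∫⁻ ω, negTime (workload X V R ω) ∂P ≠ ∞) (f : ℝ →ᵇ ℝ) :
    Integrable ((region X V R).indicator fun p : Ω × ℝ => f (workload X V R p.1 p.2.toNNReal))
      (P.prod (volume.restrict (Set.Ioi (0 : ℝ)))) := by
  rw [integrable_indicator_iff h.measurableSet_region]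
  have hm := h.measurable_workload_toNNReal
  have hfin : IsFiniteMeasure (occupation P X V R) :=
    ⟨by rw [h.occupation_univ]; exact hS.lt_top⟩
  have h1 : Integrable f (occupation P X V R) := f.integrable _
  exact h1.comp_measurable hm

lemma integrable_onIntegral (h : IsOnPeriod P G X V R)
    (hS : ∫⁻ ω, negTime (workload X V R ω) ∂P ≠ ∞) (f : ℝ →ᵇ ℝ) :
    Integrable (onIntegral X V R f) P :=
  (h.integrable_region hS f).integral_prod_left

variable [IsProbabilityMeasure P]

/-- Started from `c k * V` with `c k = 1 - 1 / (k + 1)`, the workload goes below zero no later than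
the original one vanishes, since it lies lower by `V / (k + 1) > 0`. These passage times have means
`c k * m`, where `m` is the mean of `negTime`. So their supremum, `hitTime` and `negTime` are
ordered, while the outer two have the same finite mean. -/
lemma ae_hitTime_eq_negTime (h : IsOnPeriod P G X V R) (hV : ∀ᵐ ω ∂P, 0 < V ω)
    (hVR : ∫⁻ ω, ENNReal.ofReal (V ω / (R ω - meanRate P X)) ∂P ≠ ∞) :
    ∀ᵐ ω ∂P, hitTime (workload X V R ω) = negTime (workload X V R ω) := by
  set c : ℕ → ℝ := fun k => 1 - ((k : ℝ) + 1)⁻¹ with hc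
  have hc0 : ∀ k, 0 ≤ c k := fun k => sub_nonneg.2 (inv_le_one_of_one_le₀ (by simp))
  have hk := fun k => h.smul_V (hc0 k)
  set m := ∫⁻ ω, ENNReal.ofReal (V ω / (R ω - meanRate P X)) ∂P
  have hint : ∀ k, ∫⁻ ω, ENNReal.ofReal (c k * V ω / (R ω - meanRate P X)) ∂P =
      ENNReal.ofReal (c k) * m := fun k => by
    have hVm := h.measurable_V'
    have hRm := h.measurable_R'
    rw [← lintegral_const_mul _ (by fun_prop)]
    refine lintegral_congr fun ω => ?_
    rw [← ENNReal.ofReal_mul (hc0 k), mul_div_assoc]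
  have hSk : ∀ k, ∫⁻ ω, negTime (workload X (fun ω => c k * V ω) R ω) ∂P =
      ENNReal.ofReal (c k) * m := fun k => by
    rw [(hk k).lintegral_negTime, hint]
    rw [hint]
    exact ENNReal.mul_ne_top ENNReal.ofReal_ne_top hVR
  have hle : ∀ᵐ ω ∂P, ⨆ k, negTime (workload X (fun ω => c k * V ω) R ω) ≤
      hitTime (workload X V R ω) := by
    filter_upwards [hV] with ω hω
    refine iSup_le fun k => negTime_le_hitTime_add (δ := ((k : ℝ) + 1)⁻¹ * V ω) (by positivity)
      fun s => ?_
    simp only [workload, hc]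
    ring
  have hle' : ∀ ω, hitTime (workload X V R ω) ≤ negTime (workload X V R ω) := fun ω =>
    (h.isWorkloadPath ω).hitTime_le_negTime
  have hm : Measurable fun ω => ⨆ k, negTime (workload X (fun ω => c k * V ω) R ω) :=
    Measurable.iSup fun k => (hk k).measurable_negTime
  have hlim : m ≤ ∫⁻ ω, ⨆ k, negTime (workload X (fun ω => c k * V ω) R ω) ∂P := by
    have h1 : Tendsto (fun k => ENNReal.ofReal (c k) * m) atTop (𝓝 (ENNReal.ofReal 1 * m)) := by
      refine ENNReal.Tendsto.mul_const (ENNReal.tendsto_ofReal ?_) (Or.inr hVR)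
      simpa using! tendsto_inv_nat_real.const_sub 1
    rw [ENNReal.ofReal_one, one_mul] at h1
    refine le_of_tendsto' h1 fun k => ?_
    rw [← hSk k]
    exact lintegral_mono fun ω => le_iSup (fun k => negTime (workload X (fun ω => c k * V ω) R ω)) k
  have hS := h.lintegral_negTime hVR
  have hae : ∀ᵐ ω ∂P, ⨆ k, negTime (workload X (fun ω => c k * V ω) R ω) ≤
      negTime (workload X V R ω) := hle.mono fun ω hω => hω.trans (hle' ω)
  have heq := ae_eq_of_ae_le_of_lintegral_le hae
    (ne_top_of_le_ne_top (hS ▸ hVR) (lintegral_mono_ae hae)) h.measurable_negTime.aemeasurable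
    (hS ▸ hlim)
  filter_upwards [heq, hle] with ω h1 h2
  exact le_antisymm (hle' ω) (h1 ▸ h2)

lemma integral_onIntegral (h : IsOnPeriod P G X V R)
    (hS : ∫⁻ ω, negTime (workload X V R ω) ∂P ≠ ∞) (f : ℝ →ᵇ ℝ) :
    ∫ ω, onIntegral X V R f ω ∂P = ∫ x, f x ∂(occupation P X V R) := by
  have hm := h.measurable_workload_toNNReal
  rw [occupation, integral_map hm.aemeasurable f.continuous.aestronglyMeasurable,
    ← integral_indicator h.measurableSet_region, integral_prod _ (h.integrable_region hS f)]
  rfl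

end IsOnPeriod

end Occupation

/-! ### The renewal reward theorem along one path. -/

section Renewal

lemma exists_renewal_index {E : ℕ → ℝ} (h0 : E 0 = 0) (hE : Tendsto E atTop atTop) {t : ℝ}
    (ht : 0 ≤ t) : ∃ n, E n ≤ t ∧ t < E (n + 1) := by
  classical
  have hex : ∃ n, t < E (n + 1) :=
    (((tendsto_add_atTop_iff_nat 1).2 hE).eventually_gt_atTop t).exists
  refine ⟨Nat.find hex, ?_, Nat.find_spec hex⟩
  cases hn : Nat.find hex with
  | zero => rwa [h0]
  | succ k => exact not_lt.1 (Nat.find_min hex (by omega : k < Nat.find hex))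

/-- The renewal reward theorem, along one path. -/
lemma tendsto_average_of_renewal {E I : ℕ → ℝ} {g : ℝ → ℝ} {C m c : ℝ} (h0 : E 0 = 0)
    (hmono : Monotone E) (hm : 0 < m) (hEm : Tendsto (fun n : ℕ => E n / n) atTop (𝓝 m))
    (hgC : ∀ s, |g s| ≤ C)
    (hgi : ∀ n, IntervalIntegrable g volume (E n) (E (n + 1)))
    (hI : ∀ n, ∫ s in E n..E (n + 1), g s = I n)
    (hIc : Tendsto (fun n : ℕ => (∑ k ∈ Finset.range n, I k) / n) atTop (𝓝 c)) :
    Tendsto (fun t : ℝ => t⁻¹ * ∫ s in (0 : ℝ)..t, g s) atTop (𝓝 (c / m)) := by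
  have hnat : Tendsto (fun n : ℕ => (n : ℝ)) atTop atTop := tendsto_natCast_atTop_atTop
  have hEtop : Tendsto E atTop atTop := by
    have := hEm.pos_mul_atTop hm hnat
    refine this.congr' ?_
    filter_upwards [eventually_gt_atTop 0] with n hn
    have : (n : ℝ) ≠ 0 := by positivity
    field_simp
  have hex : ∀ t : ℝ, ∃ n, 0 ≤ t → E n ≤ t ∧ t < E (n + 1) := fun t => by
    by_cases ht : 0 ≤ t
    · obtain ⟨n, hn⟩ := exists_renewal_index h0 hEtop ht
      exact ⟨n, fun _ => hn⟩
    · exact ⟨0, fun h => absurd h ht⟩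
  choose N hN using hex
  have hNtop : Tendsto N atTop atTop := by
    refine tendsto_atTop.2 fun M => ?_
    filter_upwards [eventually_ge_atTop (E M), eventually_ge_atTop 0] with t ht ht0
    by_contra! hlt
    exact absurd ((hmono (by omega : N t + 1 ≤ M)).trans ht) (not_le.2 (hN t ht0).2)
  have hsucc : Tendsto (fun n : ℕ => E (n + 1) / n) atTop (𝓝 m) := by
    have h1 : Tendsto (fun n : ℕ => E (n + 1) / ((n + 1 : ℕ) : ℝ)) atTop (𝓝 m) :=
      (tendsto_add_atTop_iff_nat 1).2 hEm
    have h2 : Tendsto (fun n : ℕ => ((n : ℝ) + 1) / n) atTop (𝓝 1) := by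
      have h3 : Tendsto (fun n : ℕ => 1 + (n : ℝ)⁻¹) atTop (𝓝 (1 + 0)) :=
        (tendsto_inv_atTop_nhds_zero_nat (𝕜 := ℝ)).const_add 1
      rw [add_zero] at h3
      refine h3.congr' ?_
      filter_upwards [eventually_gt_atTop 0] with n hn
      have : (n : ℝ) ≠ 0 := by positivity
      field_simp
    have h3 := h1.mul h2
    rw [mul_one] at h3
    refine h3.congr fun n => ?_
    push_cast
    have : (n : ℝ) + 1 ≠ 0 := by positivity
    field_simp
  have htN : Tendsto (fun t : ℝ => t / N t) atTop (𝓝 m) := by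
    refine tendsto_of_tendsto_of_tendsto_of_le_of_le' (hEm.comp hNtop) (hsucc.comp hNtop) ?_ ?_
    · filter_upwards [eventually_ge_atTop 0] with t ht
      exact div_le_div_of_nonneg_right (hN t ht).1 (Nat.cast_nonneg _)
    · filter_upwards [eventually_ge_atTop 0] with t ht
      exact div_le_div_of_nonneg_right (hN t ht).2.le (Nat.cast_nonneg _)
  have hsum : ∀ n, ∫ s in (0 : ℝ)..E n, g s = ∑ k ∈ Finset.range n, I k := fun n => by
    have := intervalIntegral.sum_integral_adjacent_intervals (n := n) fun k _ => hgi k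
    rw [h0] at this
    rw [← this]
    exact Finset.sum_congr rfl fun k _ => hI k
  have hint : ∀ n, IntervalIntegrable g volume 0 (E n) := fun n => by
    rw [← h0]
    exact IntervalIntegrable.trans_iterate fun k _ => hgi k
  have hC : 0 ≤ C := (abs_nonneg _).trans (hgC 0)
  -- The incomplete cycle contributes at most `C` times its length, and one cycle length divided by
  -- its index tends to zero.
  have herr : Tendsto (fun t : ℝ => (∫ s in E (N t)..t, g s) / N t) atTop (𝓝 0) := by
    have h1 : Tendsto (fun t : ℝ => C * (E (N t + 1) / N t - E (N t) / N t)) atTop (𝓝 0) := by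
      simpa using ((hsucc.comp hNtop).sub (hEm.comp hNtop)).const_mul C
    refine squeeze_zero_norm' ?_ h1
    filter_upwards [eventually_ge_atTop 0] with t ht
    obtain ⟨h2, h3⟩ := hN t ht
    rw [norm_div, Real.norm_natCast, ← sub_div, mul_div_assoc']
    gcongr
    refine (intervalIntegral.norm_integral_le_of_norm_le_const fun s _ => hgC s).trans ?_
    rw [abs_of_nonneg (by linarith)]
    gcongr
  -- Numerator and denominator of the time average are both divided by the number `N t` of completed
  -- cycles.
  have hmain := ((hIc.comp hNtop).add herr).div htN hm.ne'
  rw [add_zero] at hmain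
  refine hmain.congr' ?_
  filter_upwards [eventually_gt_atTop 0, hNtop.eventually_gt_atTop 0] with t ht hNt
  obtain ⟨h2, h3⟩ := hN t ht.le
  have hN0 : (0 : ℝ) < N t := by exact_mod_cast hNt
  have h4 : IntervalIntegrable g volume (E (N t)) t := by
    refine (hgi (N t)).mono_set ?_
    rw [Set.uIcc_of_le h2, Set.uIcc_of_le (hmono (Nat.le_succ _))]
    exact Set.Icc_subset_Icc_right h3.le
  rw [← intervalIntegral.integral_add_adjacent_intervals (hint (N t)) h4, hsum]
  simp only [Pi.div_apply, Function.comp_apply]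
  field_simp

end Renewal

/-! ### The strong law for independent copies on the product space. -/

section StrongLaw

lemma identDistrib_of_measurePreserving {Ω Ω' : Type*} [MeasurableSpace Ω] [MeasurableSpace Ω']
    {P : Measure Ω} {Q : Measure Ω'} {φ : Ω' → Ω} (hφ : MeasurePreserving φ Q P) {Y : Ω → ℝ}
    (hY : Measurable Y) : IdentDistrib (fun ω => Y (φ ω)) Y Q P where
  aemeasurable_fst := (hY.comp hφ.measurable).aemeasurable
  aemeasurable_snd := hY.aemeasurable
  map_eq := by
    rw [← hφ.map_eq, Measure.map_map hY hφ.measurable]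
    rfl

lemma strong_law_of_identDistrib {Ω Ω' : Type*} [MeasurableSpace Ω] [MeasurableSpace Ω']
    {P : Measure Ω} {Q : Measure Ω'} {Y : Ω → ℝ} {Z : ℕ → Ω' → ℝ}
    (hid : ∀ k, IdentDistrib (Z k) Y Q P) (hindep : Pairwise fun i j => IndepFun (Z i) (Z j) Q)
    (hi : Integrable Y P) :
    ∀ᵐ ω ∂Q, Tendsto (fun n : ℕ => (∑ k ∈ Finset.range n, Z k ω) / n) atTop
      (𝓝 (∫ x, Y x ∂P)) := by
  rw [← (hid 0).integral_eq]
  exact strong_law_ae_real Z ((hid 0).integrable_iff.2 hi) hindep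
    fun k => (hid k).trans (hid 0).symm

/-- The strong law of large numbers for independent copies on the product space. -/
lemma strong_law_infinitePi {Ω : Type*} [MeasurableSpace Ω] {P : Measure Ω}
    [IsProbabilityMeasure P] {Y : Ω → ℝ} (hY : Measurable Y) (hi : Integrable Y P) :
    ∀ᵐ ω ∂(Measure.infinitePi fun _ : ℕ => P),
      Tendsto (fun n : ℕ => (∑ k ∈ Finset.range n, Y (ω k)) / n) atTop (𝓝 (∫ x, Y x ∂P)) := by
  have hindep := iIndepFun_infinitePi (P := fun _ : ℕ => P) (X := fun _ => Y) fun _ => hY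
  exact strong_law_of_identDistrib (fun k => identDistrib_of_measurePreserving
    (measurePreserving_eval_infinitePi (fun _ : ℕ => P) k) hY)
    (fun _ _ hij => hindep.indepFun hij) hi

lemma ae_infinitePi {Ω : Type*} [MeasurableSpace Ω] {P : Measure Ω}
    [IsProbabilityMeasure P] {p : Ω → Prop} (h : ∀ᵐ x ∂P, p x) :
    ∀ᵐ ω ∂(Measure.infinitePi fun _ : ℕ => P), ∀ k, p (ω k) :=
  ae_all_iff.2 fun k =>
    (measurePreserving_eval_infinitePi (fun _ : ℕ => P) k).quasiMeasurePreserving.ae h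

end StrongLaw

/-! ### The steady-state law and its transform. -/

section SteadyState

lemma onIndex_eq {Ω : Type*} {J : ℝ≥0 → Ω → ℝ} {τ : Ω → WithTop ℝ≥0} {R : Ω → ℝ} {ω : ℕ → Ω}
    {t : ℝ≥0} {n : ℕ} (h1 : onEpoch J τ R ω n ≤ t) (h2 : (t : ℝ≥0∞) < onEpoch J τ R ω (n + 1)) :
    onIndex J τ R ω t = n := by
  refine le_antisymm (Nat.sInf_le h2) (le_csInf ⟨n, h2⟩ fun j hj => ?_)
  by_contra! hlt
  refine absurd (lt_of_lt_of_le hj (le_trans ?_ h1)) (lt_irrefl _)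
  exact Finset.sum_le_sum_of_subset (Finset.range_mono hlt)

/-- Along one sequence of cycles, the time averages of the on-period workload converge. -/
lemma tendsto_average_onProcess {Ω : Type*} {J : ℝ≥0 → Ω → ℝ} {τ : Ω → WithTop ℝ≥0}
    {R : Ω → ℝ} {ω : ℕ → Ω} {w : ℕ → ℝ≥0 → ℝ} (hw : ∀ k, Measurable (w k))
    (hW : ∀ k s, onWorkload J τ R (ω k) s = w k s) {ℓ : ℕ → ℝ} (hℓ0 : ∀ k, 0 ≤ ℓ k)
    (hℓ : ∀ k, onLength J τ R (ω k) = ENNReal.ofReal (ℓ k)) (f : ℝ →ᵇ ℝ) {m c : ℝ} (hm : 0 < m)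
    (hEm : Tendsto (fun n : ℕ => (∑ k ∈ Finset.range n, ℓ k) / n) atTop (𝓝 m))
    (hIc : Tendsto (fun n : ℕ => (∑ k ∈ Finset.range n,
      ∫ s in (0 : ℝ)..ℓ k, f (w k s.toNNReal)) / n) atTop (𝓝 c)) :
    Tendsto (fun t : ℝ => t⁻¹ * ∫ s in (0 : ℝ)..t, f (onProcess J τ R s.toNNReal ω)) atTop
      (𝓝 (c / m)) := by
  set E : ℕ → ℝ := fun n => ∑ k ∈ Finset.range n, ℓ k with hE
  have hE0 : ∀ n, 0 ≤ E n := fun n => Finset.sum_nonneg fun k _ => hℓ0 k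
  have hEs : ∀ n, E (n + 1) = E n + ℓ n := fun n => Finset.sum_range_succ _ _
  have hle : ∀ n, E n ≤ E (n + 1) := fun n => by linarith [hEs n, hℓ0 n]
  have hmono : Monotone E := monotone_nat_of_le_succ hle
  have hepoch : ∀ n, onEpoch J τ R ω n = ENNReal.ofReal (E n) := fun n => by
    rw [onEpoch, hE, ENNReal.ofReal_sum_of_nonneg fun k _ => hℓ0 k]
    exact Finset.sum_congr rfl fun k _ => hℓ k
  -- Restricting to the open interval suffices, as the endpoints are null, and it covers cycles of
  -- length zero vacuously.
  have hproc : ∀ n, ∀ s ∈ Set.Ioo (E n) (E (n + 1)),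
      f (w n (s - E n).toNNReal) = f (onProcess J τ R s.toNNReal ω) := fun n s hs => by
    have hs0 : 0 ≤ s := (hE0 n).trans hs.1.le
    have hidx : onIndex J τ R ω s.toNNReal = n := by
      refine onIndex_eq ?_ ?_
      · rw [hepoch]
        exact ENNReal.ofReal_le_ofReal hs.1.le
      · rw [hepoch]
        exact (ENNReal.ofReal_lt_ofReal_iff (hs0.trans_lt hs.2)).2 hs.2
    rw [onProcess, hidx, hepoch, hW, ENNReal.ofReal, ENNReal.toNNReal_coe]
    congr 2
    exact NNReal.eq (by
      rw [NNReal.coe_sub (Real.toNNReal_le_toNNReal hs.1.le), Real.coe_toNNReal _ hs0,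
        Real.coe_toNNReal _ (hE0 n), Real.coe_toNNReal _ (by linarith [hs.1])])
  have hint : ∀ n, IntervalIntegrable (fun s => f (w n (s - E n).toNNReal)) volume
      (E n) (E (n + 1)) := fun n => by
    refine IntervalIntegrable.mono_fun' (g := fun _ => ‖f‖) intervalIntegrable_const ?_
      (Eventually.of_forall fun s => f.norm_coe_le_norm _)
    have := hw n
    have hf := f.continuous.measurable
    exact (by fun_prop : Measurable fun s => f (w n (s - E n).toNNReal)).aestronglyMeasurable
  refine tendsto_average_of_renewal (E := E) (C := ‖f‖) (by simp [hE]) hmono hm hEm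
    (fun s => f.norm_coe_le_norm _) (fun n => ?_) (fun n => ?_) hIc
  · rw [intervalIntegrable_iff_integrableOn_Ioo_of_le (hle n)]
    have := hint n
    rw [intervalIntegrable_iff_integrableOn_Ioo_of_le (hle n)] at this
    exact this.congr_fun (hproc n) measurableSet_Ioo
  · rw [intervalIntegral.integral_of_le (hle n), integral_Ioc_eq_integral_Ioo,
      ← setIntegral_congr_fun measurableSet_Ioo (hproc n), ← integral_Ioc_eq_integral_Ioo,
      ← intervalIntegral.integral_of_le (hle n),
      intervalIntegral.integral_comp_sub_right (fun s => f (w n s.toNNReal)), sub_self, hEs,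
      add_sub_cancel_left]

variable {Ω : Type*} [mΩ : MeasurableSpace Ω] {P : Measure Ω}
  {G : Filtration ℝ≥0 mΩ} {X : ℝ≥0 → Ω → ℝ} {V R : Ω → ℝ}

namespace IsOnPeriod

/-- The occupation measure of an on period, normalized to a probability measure. -/
def stationaryLaw (P : Measure Ω) (X : ℝ≥0 → Ω → ℝ) (V R : Ω → ℝ) : Measure ℝ :=
  (occupation P X V R Set.univ)⁻¹ • occupation P X V R

lemma stationaryLaw_Iio (h : IsOnPeriod P G X V R) : stationaryLaw P X V R (Set.Iio 0) = 0 := by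
  simp [stationaryLaw, h.occupation_Iio]

variable [IsProbabilityMeasure P]

lemma lintegral_ratio_ne_zero (h : IsOnPeriod P G X V R) (hV : ∀ᵐ ω ∂P, 0 < V ω) :
    ∫⁻ ω, ENNReal.ofReal (V ω / (R ω - meanRate P X)) ∂P ≠ 0 := by
  intro h0
  have hVm := h.measurable_V'
  have hRm := h.measurable_R'
  rw [lintegral_eq_zero_iff (by fun_prop)] at h0
  obtain ⟨ω, h1, h2⟩ := (h0.and hV).exists
  simp only [Pi.zero_apply, ENNReal.ofReal_eq_zero] at h1
  exact absurd (div_pos h2 (sub_pos.2 (h.R_gt ω))) (not_lt.2 h1)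

lemma occupation_univ_eq (h : IsOnPeriod P G X V R)
    (hVR : ∫⁻ ω, ENNReal.ofReal (V ω / (R ω - meanRate P X)) ∂P ≠ ∞) :
    occupation P X V R Set.univ = ∫⁻ ω, ENNReal.ofReal (V ω / (R ω - meanRate P X)) ∂P := by
  rw [h.occupation_univ, h.lintegral_negTime hVR]

lemma isProbabilityMeasure_stationaryLaw (h : IsOnPeriod P G X V R) (hV : ∀ᵐ ω ∂P, 0 < V ω)
    (hVR : ∫⁻ ω, ENNReal.ofReal (V ω / (R ω - meanRate P X)) ∂P ≠ ∞) :
    IsProbabilityMeasure (stationaryLaw P X V R) := by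
  refine ⟨?_⟩
  rw [stationaryLaw, Measure.smul_apply, smul_eq_mul, h.occupation_univ_eq hVR]
  exact ENNReal.inv_mul_cancel (h.lintegral_ratio_ne_zero hV) hVR

/-- The normalized occupation measure is a steady-state law. -/
lemma isSteadyStateLaw_stationaryLaw (h : IsOnPeriod P G X V R) (hV : ∀ᵐ ω ∂P, 0 < V ω)
    (hVR : ∫⁻ ω, ENNReal.ofReal (V ω / (R ω - meanRate P X)) ∂P ≠ ∞)
    {J : ℝ≥0 → Ω → ℝ} {τ : Ω → WithTop ℝ≥0} {R' : Ω → ℝ}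
    (hW : ∀ᵐ ω ∂P, ∀ s, onWorkload J τ R' ω s = workload X V R ω s)
    (π : ProbabilityMeasure ℝ) (hπ : (π : Measure ℝ) = stationaryLaw P X V R) :
    IsOnSteadyState P J τ R' π := by
  intro f
  have hS := h.lintegral_negTime hVR
  have hS' : ∫⁻ ω, negTime (workload X V R ω) ∂P ≠ ∞ := hS ▸ hVR
  have hSfin := ae_lt_top h.measurable_negTime hS'
  have hmean : ∫ ω, (negTime (workload X V R ω)).toReal ∂P =
      (occupation P X V R Set.univ).toReal := by
    rw [integral_toReal h.measurable_negTime.aemeasurable hSfin, h.occupation_univ]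
  have hpos : 0 < (occupation P X V R Set.univ).toReal := by
    rw [h.occupation_univ_eq hVR]
    exact ENNReal.toReal_pos (h.lintegral_ratio_ne_zero hV) hVR
  -- Normalizing the occupation measure gives exactly the ratio of mean reward to mean cycle length.
  have hlaw : ∫ x, f x ∂(π : Measure ℝ) = (∫ ω, onIntegral X V R f ω ∂P) /
      ∫ ω, (negTime (workload X V R ω)).toReal ∂P := by
    rw [hπ, stationaryLaw, integral_smul_measure, h.integral_onIntegral hS' f, hmean,
      ENNReal.toReal_inv, smul_eq_mul, inv_mul_eq_div]
  rw [hlaw]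
  have hL1 := strong_law_infinitePi (P := P) h.measurable_negTime.ennreal_toReal
    (integrable_toReal_of_lintegral_ne_top h.measurable_negTime.aemeasurable hS')
  have hL2 := strong_law_infinitePi (P := P) (h.measurable_onIntegral f)
    (h.integrable_onIntegral hS' f)
  filter_upwards [hL1, hL2, ae_infinitePi hW, ae_infinitePi hSfin,
    ae_infinitePi (h.ae_hitTime_eq_negTime hV hVR)] with ω h1 h2 h3 h4 h5
  refine tendsto_average_onProcess (w := fun k => workload X V R (ω k))
    (fun k => (h.isWorkloadPath (ω k)).measurable) h3 (fun k => ENNReal.toReal_nonneg) (fun k => ?_)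
    f (by rw [hmean]; exact hpos) h1 ?_
  · have : onLength J τ R' (ω k) = hitTime (workload X V R (ω k)) := by
      rw [← funext (h3 k)]
      rfl
    rw [this, h5 k, ENNReal.ofReal_toReal (h4 k).ne]
  · refine h2.congr fun n => ?_
    congr 1
    exact Finset.sum_congr rfl fun k _ => onIntegral_eq f (h4 k).ne

/-- The transform of the occupation measure is the mean of `pathLaplace`, and its mass is the mean
length. Integrability follows from the domination `transform_le`; the case `α = 0` is the mean
length itself. -/
lemma lst_stationaryLaw (h : IsOnPeriod P G X V R)
    (hVR : ∫⁻ ω, ENNReal.ofReal (V ω / (R ω - meanRate P X)) ∂P ≠ ∞) {α : ℝ} (hα : 0 ≤ α) :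
    Integrable (fun ω => onTransform (exponent P X) (meanRate P X) α (V ω) (R ω)) P ∧
    lst (stationaryLaw P X V R) α =
      (∫ ω, onTransform (exponent P X) (meanRate P X) α (V ω) (R ω) ∂P) /
        ∫ ω, V ω / (R ω - meanRate P X) ∂P := by
  have hVm := h.measurable_V'
  have hRm := h.measurable_R'
  have hS' : ∫⁻ ω, negTime (workload X V R ω) ∂P ≠ ∞ := h.lintegral_negTime hVR ▸ hVR
  have hr0 : ∀ ω, 0 ≤ V ω / (R ω - meanRate P X) := fun ω =>
    div_nonneg (h.V_nonneg ω) (sub_pos.2 (h.R_gt ω)).le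
  have ht0 : ∀ ω, 0 ≤ onTransform (exponent P X) (meanRate P X) α (V ω) (R ω) ∧
      onTransform (exponent P X) (meanRate P X) α (V ω) (R ω) ≤ V ω / (R ω - meanRate P X) := by
    intro ω
    unfold onTransform
    split_ifs with h0
    · exact ⟨hr0 ω, le_rfl⟩
    · have hα' := lt_of_le_of_ne hα (Ne.symm h0)
      refine ⟨div_nonneg ?_ (h.denom_pos hα' ω).le, h.transform_le hα' ω⟩
      rw [sub_nonneg, Real.exp_le_one_iff]
      nlinarith [h.V_nonneg ω]
  have hm : Measurable fun ω => onTransform (exponent P X) (meanRate P X) α (V ω) (R ω) := by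
    unfold onTransform
    split_ifs <;> fun_prop
  have hri : Integrable (fun ω => V ω / (R ω - meanRate P X)) P := by
    refine ⟨(by fun_prop : Measurable _).aestronglyMeasurable, ?_⟩
    rw [hasFiniteIntegral_iff_ofReal (Eventually.of_forall hr0)]
    exact hVR.lt_top
  have hi : Integrable (fun ω => onTransform (exponent P X) (meanRate P X) α (V ω) (R ω)) P := by
    refine hri.mono' hm.aestronglyMeasurable (Eventually.of_forall fun ω => ?_)
    rw [Real.norm_of_nonneg (ht0 ω).1]
    exact (ht0 ω).2
  refine ⟨hi, ?_⟩
  have hocc : ∫⁻ x, ENNReal.ofReal (Real.exp (-α * x)) ∂(occupation P X V R) =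
      ∫⁻ ω, ENNReal.ofReal (onTransform (exponent P X) (meanRate P X) α (V ω) (R ω)) ∂P := by
    rw [h.lintegral_exp_occupation]
    rcases hα.eq_or_lt with rfl | hα'
    · simp only [pathLaplace_zero, onTransform, if_true, h.lintegral_negTime hVR]
    · simp only [onTransform, if_neg hα'.ne', h.lintegral_pathLaplace hα' hS']
  rw [lst, stationaryLaw, integral_smul_measure, integral_eq_lintegral_of_nonneg_ae
    (Eventually.of_forall fun x => (Real.exp_pos _).le) (by fun_prop), hocc,
    ← integral_eq_lintegral_of_nonneg_ae (Eventually.of_forall fun ω => (ht0 ω).1)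
      hm.aestronglyMeasurable, h.occupation_univ_eq hVR, ENNReal.toReal_inv,
    ← integral_eq_lintegral_of_nonneg_ae (Eventually.of_forall hr0)
      (by fun_prop : Measurable _).aestronglyMeasurable, smul_eq_mul, inv_mul_eq_div]

end IsOnPeriod

end SteadyState

/-! ### The decomposition under the size-biased measure. -/

section Decomposition

/-- The transform of a uniform random variable on `[0, 1]`. -/
lemma lintegral_exp_uniform {c : ℝ} (hc : 0 < c) :
    ∫⁻ u in Set.Icc (0 : ℝ) 1, ENNReal.ofReal (Real.exp (-c * u)) =
      ENNReal.ofReal ((1 - Real.exp (-c)) / c) := by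
  have hcont : Continuous fun u : ℝ => Real.exp (-c * u) := by fun_prop
  rw [← ofReal_integral_eq_lintegral_ofReal hcont.integrableOn_Icc
    (Eventually.of_forall fun u => (Real.exp_pos _).le), integral_Icc_eq_integral_Ioc,
    ← intervalIntegral.integral_of_le zero_le_one]
  congr 1
  have h1 : ∀ u ∈ Set.uIcc (0 : ℝ) 1,
      HasDerivAt (fun u => -(Real.exp (-c * u)) / c) (Real.exp (-c * u)) u := fun u _ => by
    have := ((((hasDerivAt_id u).const_mul (-c)).exp).neg).div_const c
    refine this.congr_deriv ?_
    field_simp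
    simp
  rw [intervalIntegral.integral_eq_sub_of_hasDerivAt h1 (hcont.intervalIntegrable _ _)]
  simp
  ring

variable {Ω : Type*} [MeasurableSpace Ω] {P : Measure Ω} [IsProbabilityMeasure P]
  {η : ℝ → ℝ} {ρ : ℝ} {V R U : Ω → ℝ} {N : Ω → ℕ} {e : ℕ → Ω → ℝ}

namespace IsDecomposition

lemma integrable_exp_e (h : IsDecomposition P η ρ V R U N e) {α : ℝ} (hα : 0 ≤ α) (i : ℕ) :
    Integrable (fun ω => Real.exp (-α * e i ω)) P := by
  have := h.measurable_e i
  refine Integrable.of_bound (C := 1) (by fun_prop) ?_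
  filter_upwards [h.e_nonneg i] with ω hω
  rw [Real.norm_of_nonneg (Real.exp_pos _).le, Real.exp_le_one_iff]
  nlinarith

lemma ratio_pos (h : IsDecomposition P η ρ V R U N e) {α : ℝ} (hα : 0 < α) :
    0 < η α / (ρ * α) := by
  rw [← h.e_lst 0 α hα]
  exact integral_exp_pos (h.integrable_exp_e hα.le 0)

lemma ratio_le_one (h : IsDecomposition P η ρ V R U N e) {α : ℝ} (hα : 0 < α) :
    η α / (ρ * α) ≤ 1 := by
  rw [← h.e_lst 0 α hα]
  have h1 : ∫ ω, Real.exp (-α * e 0 ω) ∂P ≤ ∫ _, (1 : ℝ) ∂P := by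
    refine integral_mono_ae (h.integrable_exp_e hα.le 0) (integrable_const _) ?_
    filter_upwards [h.e_nonneg 0] with ω hω
    rw [Real.exp_le_one_iff]
    nlinarith
  simpa using h1

/-- Division by zero would make the transform of `e 0` equal to `0`, but it is the mean of a
positive variable. -/
lemma rho_ne_zero (h : IsDecomposition P η ρ V R U N e) : ρ ≠ 0 := by
  rintro rfl
  simpa using h.ratio_pos one_pos

lemma lintegral_prod_exp_e (h : IsDecomposition P η ρ V R U N e) {α : ℝ} (hα : 0 < α) (n : ℕ) :
    ∫⁻ ω, ENNReal.ofReal (Real.exp (-α * ∑ i ∈ Finset.range n, e i ω)) ∂P =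
      ENNReal.ofReal (η α / (ρ * α)) ^ n := by
  have he := h.measurable_e
  have hm : Measurable fun x : ℝ => ENNReal.ofReal (Real.exp (-α * x)) := by fun_prop
  have hone : ∀ i, ∫⁻ ω, ENNReal.ofReal (Real.exp (-α * e i ω)) ∂P =
      ENNReal.ofReal (η α / (ρ * α)) := fun i => by
    rw [← h.e_lst i α hα, ofReal_integral_eq_lintegral_ofReal (h.integrable_exp_e hα.le i)
      (Eventually.of_forall fun ω => (Real.exp_pos _).le)]
  induction n with
  | zero => simp
  | succ n ih =>
    have hind : IndepFun (fun ω => ∑ i ∈ Finset.range n, e i ω) (e n) P := by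
      have := h.indep_e.indepFun_finsetSum_of_notMem he (s := Finset.range n) (i := n) (by simp)
      convert this using 1
      ext ω
      simp
    have h1 := lintegral_mul_eq_lintegral_mul_lintegral_of_indepFun''
      (f := fun ω => ENNReal.ofReal (Real.exp (-α * ∑ i ∈ Finset.range n, e i ω)))
      (g := fun ω => ENNReal.ofReal (Real.exp (-α * e n ω)))
      (by fun_prop) (by fun_prop) (hind.comp hm hm)
    rw [pow_succ, ← ih, ← hone n, ← h1]
    refine lintegral_congr fun ω => ?_
    rw [← ENNReal.ofReal_mul (Real.exp_pos _).le, ← Real.exp_add, Finset.sum_range_succ]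
    ring_nf

/-- The mixed law of `N` given `(V, R)`. -/
lemma lintegral_N_eq (h : IsDecomposition P η ρ V R U N e) (hρ : 0 ≤ ρ)
    (hR : ∀ᵐ ω ∂P, ρ < R ω) (n : ℕ) {g : ℝ × ℝ → ℝ≥0∞} (hg : Measurable g) :
    ∫⁻ ω in N ⁻¹' {n}, g (V ω, R ω) ∂P =
      ∫⁻ ω, ENNReal.ofReal ((1 - ρ / R ω) * (ρ / R ω) ^ n) * g (V ω, R ω) ∂P := by
  have hV' := h.measurable_V
  have hR' := h.measurable_R
  have hVR : Measurable fun ω => (V ω, R ω) := hV'.prodMk hR'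
  have hNm : MeasurableSet (N ⁻¹' {n}) := h.measurable_N (measurableSet_singleton n)
  have hd : Measurable fun ω => ENNReal.ofReal ((1 - ρ / R ω) * (ρ / R ω) ^ n) := by fun_prop
  have hnn : ∀ᵐ ω ∂P, 0 ≤ (1 - ρ / R ω) * (ρ / R ω) ^ n := by
    filter_upwards [hR] with ω hω
    have h0 : 0 < R ω := hρ.trans_lt hω
    have h1 : ρ / R ω ≤ 1 := (div_le_one h0).2 hω.le
    exact mul_nonneg (by linarith) (by positivity)
  have hint : Integrable (fun ω => (1 - ρ / R ω) * (ρ / R ω) ^ n) P :=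
    integrable_condExp.congr (h.geometric n)
  -- Both measures agree on sets determined by `(V, R)`: this is the defining property of the
  -- conditional probability in `geometric`.
  have hmap : (P.restrict (N ⁻¹' {n})).map (fun ω => (V ω, R ω)) =
      (P.withDensity fun ω => ENNReal.ofReal ((1 - ρ / R ω) * (ρ / R ω) ^ n)).map
        (fun ω => (V ω, R ω)) := by
    ext B hB
    rw [Measure.map_apply hVR hB, Measure.map_apply hVR hB, Measure.restrict_apply (hVR hB),
      withDensity_apply _ (hVR hB)]
    have h1 : ∫ ω in (fun ω => (V ω, R ω)) ⁻¹' B, (1 - ρ / R ω) * (ρ / R ω) ^ n ∂P =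
        ∫ ω in (fun ω => (V ω, R ω)) ⁻¹' B, (N ⁻¹' {n}).indicator (fun _ => (1 : ℝ)) ω ∂P := by
      rw [← setIntegral_condExp hVR.comap_le ((integrable_const (1 : ℝ)).indicator hNm)
        (⟨B, hB, rfl⟩ : MeasurableSet[MeasurableSpace.comap (fun ω => (V ω, R ω)) inferInstance] _)]
      refine setIntegral_congr_ae (hVR hB) ?_
      filter_upwards [h.geometric n] with ω hω _
      exact hω.symm
    rw [setIntegral_indicator hNm, setIntegral_const, smul_eq_mul, mul_one] at h1
    rw [← ofReal_integral_eq_lintegral_ofReal hint.restrict (ae_restrict_of_ae hnn), h1,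
      ofReal_measureReal, Set.inter_comm]
  rw [← lintegral_map hg hVR, hmap, lintegral_map hg hVR,
    lintegral_withDensity_eq_lintegral_mul _ hd
      (by fun_prop : Measurable fun ω => g (V ω, R ω))]
  rfl

/-- On `{N = n}` the number of summands is fixed, so `(U, e)` can be integrated out with `(V, R, N)`
held fixed. Given `V = v`, the variable `U v` has transform `(1 - exp (-α v)) / (α v)`. -/
lemma lintegral_term (h : IsDecomposition P η ρ V R U N e) (hV : ∀ᵐ ω ∂P, 0 < V ω) {α : ℝ}
    (hα : 0 < α) (n : ℕ) {g : ℝ × ℝ → ℝ≥0∞} (hg : Measurable g) :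
    ∫⁻ ω in N ⁻¹' {n}, g (V ω, R ω) * ENNReal.ofReal
        (Real.exp (-α * (U ω * V ω + ∑ i ∈ Finset.range (N ω), e i ω))) ∂P =
      ∫⁻ ω in N ⁻¹' {n}, g (V ω, R ω) * (ENNReal.ofReal ((1 - Real.exp (-α * V ω)) / (α * V ω)) *
        ENNReal.ofReal (η α / (ρ * α)) ^ n) ∂P := by
  have hV' := h.measurable_V
  have hR' := h.measurable_R
  have hU' := h.measurable_U
  have hN' := h.measurable_N
  have he' := h.measurable_e
  have hNm : MeasurableSet (N ⁻¹' {n}) := h.measurable_N (measurableSet_singleton n)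
  set μA := P.map fun ω => (U ω, fun i => e i ω) with hμA
  set μB := P.map fun ω => (V ω, R ω, N ω) with hμB
  have hA : Measurable fun ω => (U ω, fun i => e i ω) := by fun_prop
  have hB : Measurable fun ω => (V ω, R ω, N ω) := by fun_prop
  have hlaw := (indepFun_iff_map_prod_eq_prod_map_map hA.aemeasurable hB.aemeasurable).1
    h.indep_VRN
  have hUe := (indepFun_iff_map_prod_eq_prod_map_map hU'.aemeasurable
    (by fun_prop : Measurable fun ω i => e i ω).aemeasurable).1 h.indep_U_e
  have : IsProbabilityMeasure (P.map U) := Measure.isProbabilityMeasure_map hU'.aemeasurable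
  have : IsProbabilityMeasure (P.map fun ω i => e i ω) :=
    Measure.isProbabilityMeasure_map (by fun_prop : Measurable fun ω i => e i ω).aemeasurable
  have : IsProbabilityMeasure μA := Measure.isProbabilityMeasure_map hA.aemeasurable
  have : IsProbabilityMeasure μB := Measure.isProbabilityMeasure_map hB.aemeasurable
  -- The restriction to `N = n` is carried by `k`, a function of `(V, R, N)` alone, so that the
  -- product law applies.
  set k : ℝ × ℝ × ℕ → ℝ≥0∞ := fun b => if b.2.2 = n then g (b.1, b.2.1) else 0
  have hk : Measurable k :=
    Measurable.ite ((measurable_snd.comp measurable_snd) (measurableSet_singleton n))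
      (hg.comp (by fun_prop)) measurable_const
  have hinner : ∀ v : ℝ, 0 < v → ∫⁻ a : ℝ × (ℕ → ℝ), ENNReal.ofReal (Real.exp (-α * (a.1 * v))) *
      ENNReal.ofReal (Real.exp (-α * ∑ i ∈ Finset.range n, a.2 i)) ∂μA =
      ENNReal.ofReal ((1 - Real.exp (-α * v)) / (α * v)) *
        ENNReal.ofReal (η α / (ρ * α)) ^ n := by
    intro v hv
    rw [hμA, hUe, lintegral_prod_mul (f := fun u => ENNReal.ofReal (Real.exp (-α * (u * v))))
      (g := fun x : ℕ → ℝ => ENNReal.ofReal (Real.exp (-α * ∑ i ∈ Finset.range n, x i)))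
      (by fun_prop) (by fun_prop), h.uniform]
    congr 1
    · have h1 := lintegral_exp_uniform (mul_pos hα hv)
      rw [neg_mul, ← h1]
      refine lintegral_congr fun u => ?_
      ring_nf
    · rw [lintegral_map (by fun_prop) (by fun_prop), h.lintegral_prod_exp_e hα n]
  have hlhs : ∫⁻ ω in N ⁻¹' {n}, g (V ω, R ω) * ENNReal.ofReal
        (Real.exp (-α * (U ω * V ω + ∑ i ∈ Finset.range (N ω), e i ω))) ∂P =
      ∫⁻ p : (ℝ × (ℕ → ℝ)) × (ℝ × ℝ × ℕ), k p.2 *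
        (ENNReal.ofReal (Real.exp (-α * (p.1.1 * p.2.1))) *
          ENNReal.ofReal (Real.exp (-α * ∑ i ∈ Finset.range n, p.1.2 i))) ∂(μA.prod μB) := by
    rw [← hlaw, lintegral_map (by fun_prop) (hA.prodMk hB), ← lintegral_indicator hNm]
    refine lintegral_congr fun ω => ?_
    by_cases hω : N ω = n
    · rw [Set.indicator_of_mem (by exact hω)]
      simp only [k, hω, if_true]
      rw [← ENNReal.ofReal_mul (Real.exp_pos _).le, ← Real.exp_add]
      ring_nf
    · rw [Set.indicator_of_notMem (by exact hω)]
      simp [k, hω]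
  rw [hlhs, lintegral_prod_symm _ (by fun_prop)]
  have hVB : ∀ᵐ b ∂μB, 0 < b.1 := by
    rw [hμB, ae_map_iff hB.aemeasurable (measurableSet_lt measurable_const measurable_fst)]
    exact hV
  have hrhs : ∫⁻ b, ∫⁻ a : ℝ × (ℕ → ℝ), k b * (ENNReal.ofReal (Real.exp (-α * (a.1 * b.1))) *
      ENNReal.ofReal (Real.exp (-α * ∑ i ∈ Finset.range n, a.2 i))) ∂μA ∂μB =
      ∫⁻ b, k b * (ENNReal.ofReal ((1 - Real.exp (-α * b.1)) / (α * b.1)) *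
        ENNReal.ofReal (η α / (ρ * α)) ^ n) ∂μB := by
    refine lintegral_congr_ae ?_
    filter_upwards [hVB] with b hb
    rw [lintegral_const_mul _ (by fun_prop), hinner b.1 hb]
  rw [hrhs, hμB, lintegral_map (by fun_prop) hB, ← lintegral_indicator hNm]
  refine lintegral_congr fun ω => ?_
  by_cases hω : N ω = n
  · rw [Set.indicator_of_mem (by exact hω)]
    simp [k, hω]
  · rw [Set.indicator_of_notMem (by exact hω)]
    simp [k, hω]

lemma tsum_geometric_mixture {x q : ℝ} (hx0 : 0 ≤ x) (hx1 : x < 1) (hq0 : 0 ≤ q) (hq1 : q ≤ 1) :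
    ∑' n : ℕ, ENNReal.ofReal ((1 - x) * x ^ n) * ENNReal.ofReal q ^ n =
      ENNReal.ofReal ((1 - x) / (1 - x * q)) := by
  have hxq : x * q < 1 := (mul_le_of_le_one_right hx0 hq1).trans_lt hx1
  have h1 : ∀ n : ℕ, ENNReal.ofReal ((1 - x) * x ^ n) * ENNReal.ofReal q ^ n =
      ENNReal.ofReal (1 - x) * ENNReal.ofReal (x * q) ^ n := fun n => by
    rw [ENNReal.ofReal_mul (by linarith), ENNReal.ofReal_mul hx0, mul_pow, ENNReal.ofReal_pow hx0,
      mul_assoc]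
  simp_rw [h1]
  rw [ENNReal.tsum_mul_left, ENNReal.tsum_geometric, div_eq_mul_inv,
    ENNReal.ofReal_mul (p := 1 - x) (q := (1 - x * q)⁻¹) (by linarith),
    ENNReal.ofReal_inv_of_pos (by linarith),
    ENNReal.ofReal_sub _ (mul_nonneg hx0 hq0), ENNReal.ofReal_one]

/-- Summing over `n` gives a geometric series with ratio `ρ q / R`, where `q = η α / (ρ α)`. The
factors `V` and `R - ρ` of the size bias cancel, leaving the denominator `α R - η α`. -/
lemma lintegral_sizeBiased_weight (h : IsDecomposition P η ρ V R U N e) (hρ : 0 ≤ ρ)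
    (hV : ∀ᵐ ω ∂P, 0 < V ω) (hR : ∀ᵐ ω ∂P, ρ < R ω) {α : ℝ} (hα : 0 < α) :
    ∫⁻ ω, ENNReal.ofReal (V ω / (R ω - ρ)) * ENNReal.ofReal
        (Real.exp (-α * (U ω * V ω + ∑ i ∈ Finset.range (N ω), e i ω))) ∂P =
      ∫⁻ ω, ENNReal.ofReal (onTransform η ρ α (V ω) (R ω)) ∂P := by
  have hV' := h.measurable_V
  have hR' := h.measurable_R
  have hρ' : 0 < ρ := lt_of_le_of_ne hρ (Ne.symm h.rho_ne_zero)
  set q := η α / (ρ * α) with hq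
  have hNm : ∀ n, MeasurableSet (N ⁻¹' {n}) := fun n =>
    h.measurable_N (measurableSet_singleton n)
  have hsplit : ∀ f : Ω → ℝ≥0∞, ∫⁻ ω, f ω ∂P = ∑' n, ∫⁻ ω in N ⁻¹' {n}, f ω ∂P := fun f => by
    have hU : ⋃ n, N ⁻¹' {n} = Set.univ := by
      ext ω
      simp
    rw [← lintegral_iUnion hNm, hU, Measure.restrict_univ]
    intro i j hij
    exact Disjoint.preimage N (by simpa using hij)
  rw [hsplit]
  have hterm : ∀ n, ∫⁻ ω in N ⁻¹' {n}, ENNReal.ofReal (V ω / (R ω - ρ)) * ENNReal.ofReal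
        (Real.exp (-α * (U ω * V ω + ∑ i ∈ Finset.range (N ω), e i ω))) ∂P =
      ∫⁻ ω, ENNReal.ofReal ((1 - ρ / R ω) * (ρ / R ω) ^ n) * (ENNReal.ofReal (V ω / (R ω - ρ)) *
        (ENNReal.ofReal ((1 - Real.exp (-α * V ω)) / (α * V ω)) * ENNReal.ofReal q ^ n)) ∂P := by
    intro n
    rw [h.lintegral_term hV hα n (g := fun p => ENNReal.ofReal (p.1 / (p.2 - ρ))) (by fun_prop)]
    exact h.lintegral_N_eq hρ hR n (g := fun p => ENNReal.ofReal (p.1 / (p.2 - ρ)) *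
      (ENNReal.ofReal ((1 - Real.exp (-α * p.1)) / (α * p.1)) * ENNReal.ofReal q ^ n))
      (by fun_prop)
  simp_rw [hterm]
  rw [← lintegral_tsum fun n => (by fun_prop : Measurable _).aemeasurable]
  refine lintegral_congr_ae ?_
  filter_upwards [hV, hR] with ω hv hr
  have hr0 : 0 < R ω := hρ.trans_lt hr
  have hx0 : 0 ≤ ρ / R ω := by positivity
  have hx1 : ρ / R ω < 1 := (div_lt_one hr0).2 hr
  have hq0 := (h.ratio_pos hα).le
  have hq1 := h.ratio_le_one hα
  have h1 : ∀ n : ℕ, ENNReal.ofReal ((1 - ρ / R ω) * (ρ / R ω) ^ n) *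
      (ENNReal.ofReal (V ω / (R ω - ρ)) *
        (ENNReal.ofReal ((1 - Real.exp (-α * V ω)) / (α * V ω)) * ENNReal.ofReal q ^ n)) =
      (ENNReal.ofReal (V ω / (R ω - ρ)) *
        ENNReal.ofReal ((1 - Real.exp (-α * V ω)) / (α * V ω))) *
      (ENNReal.ofReal ((1 - ρ / R ω) * (ρ / R ω) ^ n) * ENNReal.ofReal q ^ n) := fun n => by ring
  simp_rw [h1]
  have hexp : Real.exp (-α * V ω) ≤ 1 := by
    rw [Real.exp_le_one_iff]
    nlinarith
  have hxq : ρ / R ω * q < 1 := (mul_le_of_le_one_right hx0 hq1).trans_lt hx1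
  have hd : 0 < R ω - ρ := sub_pos.2 hr
  rw [ENNReal.tsum_mul_left, tsum_geometric_mixture hx0 hx1 hq0 hq1,
    ← ENNReal.ofReal_mul (by positivity), ← ENNReal.ofReal_mul
    (mul_nonneg (by positivity) (div_nonneg (by linarith) (by positivity))), onTransform,
    if_neg hα.ne']
  congr 1
  have hη : η α = q * (ρ * α) := by
    rw [hq]
    field_simp
  rw [hη]
  have hden : 0 < α * R ω - q * (ρ * α) := by
    have : α * R ω - q * (ρ * α) = α * R ω * (1 - ρ / R ω * q) := by
      field_simp
    rw [this]
    exact mul_pos (by positivity) (by linarith)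
  have h2 : 1 - ρ / R ω * q ≠ 0 := by linarith
  have h3 : R ω - ρ * q ≠ 0 := by
    intro h0
    apply hden.ne'
    linear_combination α * h0
  field_simp

/-- The transform of `U V + e 0 + ⋯ + e (N - 1)` under the size-biased measure. -/
lemma integral_sizeBiased (h : IsDecomposition P η ρ V R U N e) (hρ : 0 ≤ ρ)
    (hV : ∀ᵐ ω ∂P, 0 < V ω) (hR : ∀ᵐ ω ∂P, ρ < R ω)
    (hVR : Integrable (fun ω => V ω / (R ω - ρ)) P) {α : ℝ} (hα : 0 ≤ α) :
    ∫ ω, Real.exp (-α * (U ω * V ω + ∑ i ∈ Finset.range (N ω), e i ω)) ∂(sizeBiased P ρ V R) =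
      (∫ ω, onTransform η ρ α (V ω) (R ω) ∂P) / ∫ ω, V ω / (R ω - ρ) ∂P := by
  have hV' := h.measurable_V
  have hR' := h.measurable_R
  have hU' := h.measurable_U
  have hN' := h.measurable_N
  have he' := h.measurable_e
  have hsum : Measurable fun ω => ∑ i ∈ Finset.range (N ω), e i ω := by
    have h1 : Measurable fun p : ℕ × Ω => ∑ i ∈ Finset.range p.1, e i p.2 :=
      measurable_from_prod_countable_right fun n => by
        simp only
        fun_prop
    exact h1.comp (hN'.prodMk measurable_id)
  have hr0 : 0 ≤ᵐ[P] fun ω => V ω / (R ω - ρ) := by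
    filter_upwards [hV, hR] with ω h1 h2
    exact (div_pos h1 (sub_pos.2 h2)).le
  have hm : Measurable fun ω => onTransform η ρ α (V ω) (R ω) := by
    unfold onTransform
    split_ifs <;> fun_prop
  have hw : ∫⁻ ω, ENNReal.ofReal (V ω / (R ω - ρ)) * ENNReal.ofReal
        (Real.exp (-α * (U ω * V ω + ∑ i ∈ Finset.range (N ω), e i ω))) ∂P =
      ∫⁻ ω, ENNReal.ofReal (onTransform η ρ α (V ω) (R ω)) ∂P := by
    rcases hα.eq_or_lt with rfl | hα'
    · simp [onTransform]
    · exact h.lintegral_sizeBiased_weight hρ hV hR hα'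
  have ht0 : 0 ≤ᵐ[P] fun ω => onTransform η ρ α (V ω) (R ω) := by
    filter_upwards [hV, hR] with ω h1 h2
    unfold onTransform
    split_ifs with h0
    · exact (div_pos h1 (sub_pos.2 h2)).le
    · have hα' := lt_of_le_of_ne hα (Ne.symm h0)
      have hρ' : 0 < ρ := lt_of_le_of_ne hρ (Ne.symm h.rho_ne_zero)
      have h3 := (div_le_one (by positivity)).1 (h.ratio_le_one hα')
      refine div_nonneg ?_ (by nlinarith)
      rw [sub_nonneg, Real.exp_le_one_iff]
      nlinarith
  rw [integral_eq_lintegral_of_nonneg_ae (Eventually.of_forall fun ω => (Real.exp_pos _).le)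
    (by fun_prop : Measurable _).aestronglyMeasurable, sizeBiased, lintegral_smul_measure,
    lintegral_withDensity_eq_lintegral_mul _ (by fun_prop) (by fun_prop)]
  simp only [Pi.mul_apply]
  rw [hw, smul_eq_mul, ENNReal.toReal_mul, ENNReal.toReal_inv,
    ← integral_eq_lintegral_of_nonneg_ae ht0 hm.aestronglyMeasurable,
    ← integral_eq_lintegral_of_nonneg_ae hr0 hVR.aestronglyMeasurable, inv_mul_eq_div]

end IsDecomposition

end Decomposition

/-! ### Uniqueness, and application to the input after the stopping time. -/

section Cycle

/-- For each test function some path has both limits, since `Q` is nonzero; integrals of bounded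
continuous functions determine the law. -/
lemma IsSteadyStateLaw.unique {S : Type*} [MeasurableSpace S] {Q : Measure S} [NeZero Q]
    {Y : ℝ≥0 → S → ℝ} {π₁ π₂ : ProbabilityMeasure ℝ} (h₁ : IsSteadyStateLaw Q Y π₁)
    (h₂ : IsSteadyStateLaw Q Y π₂) : π₁ = π₂ := by
  refine Subtype.ext ?_
  have : IsProbabilityMeasure (π₁ : Measure ℝ) := π₁.2
  have : IsProbabilityMeasure (π₂ : Measure ℝ) := π₂.2
  refine ext_of_forall_integral_eq_of_IsFiniteMeasure (μ := (π₁ : Measure ℝ))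
    (ν := (π₂ : Measure ℝ)) fun f => ?_
  obtain ⟨ω, hω₁, hω₂⟩ := ((h₁ f).and (h₂ f)).exists
  exact tendsto_nhds_unique hω₁ hω₂

lemma onWorkload_eq_workload_shift {Ω : Type*} {J : ℝ≥0 → Ω → ℝ} {τ : Ω → WithTop ℝ≥0}
    {R R' : Ω → ℝ} {ω : Ω} (hω : τ ω ≠ ⊤) (hR : R' ω = R ω) (s : ℝ≥0) :
    onWorkload J τ R ω s = workload (shift J τ) (stoppedValue J τ) R' ω s := by
  rw [onWorkload, workload, shift_of_ne_top hω, stoppedValue, hR]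
  ring

variable {Ω : Type*} [mΩ : MeasurableSpace Ω] {P : Measure Ω}
  {F : Filtration ℝ≥0 mΩ} {J : ℝ≥0 → Ω → ℝ} {τ : Ω → WithTop ℝ≥0} {R : Ω → ℝ}

lemma ae_ne_top_of_lintegral_lt_top (hτ : IsStoppingTime F τ)
    (hτ_mean : ∫⁻ ω, (τ ω : ℝ≥0∞) ∂P < ∞) : ∀ᵐ ω ∂P, τ ω ≠ ⊤ := by
  have hm : MeasurableSet {ω | τ ω = ⊤} := hτ.measurableSet_eq_top
  have h1 : ∞ * P {ω | τ ω = ⊤} ≤ ∫⁻ ω, (τ ω : ℝ≥0∞) ∂P := by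
    rw [← setLIntegral_const]
    refine le_trans (setLIntegral_mono' hm fun ω hω => ?_) (setLIntegral_le_lintegral _ _)
    exact (le_of_eq (Eq.symm hω) : (⊤ : WithTop ℝ≥0) ≤ τ ω)
  rw [ae_iff]
  by_contra h0
  simp only [ne_eq, not_not] at h0
  rw [ENNReal.top_mul h0] at h1
  exact absurd (h1.trans_lt hτ_mean) (lt_irrefl _)

variable [IsProbabilityMeasure P]

lemma meanRate_shift (hJ : IsSubordinator P F J) (hτ : IsStoppingTime F τ)
    (hτt : ∀ᵐ ω ∂P, τ ω ≠ ⊤) : meanRate P (shift J τ) = meanRate P J :=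
  (hJ.identDistrib_shift hτ hτt 1).integral_eq

lemma exponent_shift (hJ : IsSubordinator P F J) (hτ : IsStoppingTime F τ)
    (hτt : ∀ᵐ ω ∂P, τ ω ≠ ⊤) : exponent P (shift J τ) = exponent P J := by
  funext α
  have hm : Measurable fun x : ℝ => Real.exp (-α * x) := by fun_prop
  have h1 := ((hJ.identDistrib_shift hτ hτt 1).comp hm).integral_eq
  simp only [Function.comp_apply] at h1
  rw [exponent, exponent, h1]

/-- The output rate `R`, modified where it does not exceed the mean input rate `ρ`. -/
def properRate (ρ : ℝ) (R : Ω → ℝ) (ω : Ω) : ℝ := if ρ < R ω then R ω else ρ + 1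

/-- `V` and `R` are known at time `0` of the shifted filtration, as `F_τ` is contained in `F_{τ +
0}`. The structure demands a rate above the mean everywhere, whence `properRate`. -/
lemma isOnPeriod_shift (hJ : IsSubordinator P F J) (hi : Integrable (J 1) P)
    (hτ : IsStoppingTime F τ) (hτt : ∀ᵐ ω ∂P, τ ω ≠ ⊤) (hR : Measurable[hτ.measurableSpace] R) :
    IsOnPeriod P (shiftFiltration hτ) (shift J τ) (stoppedValue J τ)
      (properRate (meanRate P J) R) where
  subordinator := hJ.shift hτ hτt
  integrable := (hJ.identDistrib_shift hτ hτt 1).integrable_iff.2 hi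
  measurable_V := (hJ.measurable_stoppedValue hτ).mono
    (hτ.measurableSpace_mono (isStoppingTime_add_nnreal hτ 0) fun ω => le_self_add) le_rfl
  measurable_R := by
    refine Measurable.mono (ma := hτ.measurableSpace) ?_
      (hτ.measurableSpace_mono (isStoppingTime_add_nnreal hτ 0) fun ω => le_self_add) le_rfl
    unfold properRate
    exact Measurable.ite (measurableSet_lt measurable_const hR) hR measurable_const
  V_nonneg ω := hJ.nonneg _ ω
  R_gt ω := by
    rw [meanRate_shift hJ hτ hτt, properRate]
    split_ifs with h <;> linarith

end Cycle

end

end LevyStorage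

open LevyStorage

theorem theorem1 {Ω : Type*} [mΩ : MeasurableSpace Ω] (P : Measure Ω) [IsProbabilityMeasure P]
    (F : Filtration ℝ≥0 mΩ) (J : ℝ≥0 → Ω → ℝ)
    (hJ : LevyStorage.IsSubordinator P F J) (hJ_mean : Integrable (J 1) P)
    (η : ℝ → ℝ) (hη : η = LevyStorage.exponent P J)
    (ρ : ℝ) (hρ : ρ = LevyStorage.meanRate P J)
    (τ : Ω → WithTop ℝ≥0) (hτ : IsStoppingTime F τ)
    (hτ_mean : ∫⁻ ω, (τ ω : ℝ≥0∞) ∂P < ∞)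
    (V : Ω → ℝ) (hV : V = stoppedValue J τ) (hV_pos : ∀ᵐ ω ∂P, 0 < V ω)
    (R : Ω → ℝ) (hR : Measurable[hτ.measurableSpace] R) (hR_gt : ∀ᵐ ω ∂P, ρ < R ω)
    (hVR : Integrable (fun ω => V ω / (R ω - ρ)) P) :
    (∃! π : ProbabilityMeasure ℝ, LevyStorage.IsOnSteadyState P J τ R π) ∧
    ∀ π : ProbabilityMeasure ℝ, LevyStorage.IsOnSteadyState P J τ R π →
      (π : Measure ℝ) (Set.Iio 0) = 0 ∧
      (∀ α : ℝ, 0 ≤ α →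
        Integrable (fun ω => LevyStorage.onTransform η ρ α (V ω) (R ω)) P ∧
        LevyStorage.lst π α =
          (∫ ω, LevyStorage.onTransform η ρ α (V ω) (R ω) ∂P) / ∫ ω, V ω / (R ω - ρ) ∂P) ∧
      ∀ {Ω' : Type*} [MeasurableSpace Ω'] (P' : Measure Ω') [IsProbabilityMeasure P']
        (V' R' U : Ω' → ℝ) (N : Ω' → ℕ) (e : ℕ → Ω' → ℝ),
        IdentDistrib (fun ω => (V' ω, R' ω)) (fun ω => (V ω, R ω)) P' P →
        LevyStorage.IsDecomposition P' η ρ V' R' U N e →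
        ∀ α : ℝ, 0 ≤ α →
          LevyStorage.lst π α =
            ∫ ω, Real.exp (-α * (U ω * V' ω + ∑ i ∈ Finset.range (N ω), e i ω))
              ∂(LevyStorage.sizeBiased P' ρ V' R') := by
  subst hη hρ hV
  have hτt := ae_ne_top_of_lintegral_lt_top hτ hτ_mean
  have h := isOnPeriod_shift hJ hJ_mean hτ hτt hR
  -- `R₁` agrees with `R` almost surely, so it changes neither the integrals nor almost every
  -- sequence of cycles.
  set R₁ := properRate (meanRate P J) R with hR₁
  have hR₁R : ∀ᵐ ω ∂P, R₁ ω = R ω := by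
    filter_upwards [hR_gt] with ω hω
    rw [hR₁, properRate, if_pos hω]
  have hVR₁ : ∫⁻ ω, ENNReal.ofReal (stoppedValue J τ ω /
      (R₁ ω - meanRate P (shift J τ))) ∂P ≠ ∞ := by
    rw [meanRate_shift hJ hτ hτt]
    refine ne_of_eq_of_ne (lintegral_congr_ae ?_) hVR.lintegral_lt_top.ne
    filter_upwards [hR₁R] with ω hω
    rw [hω]
  have := h.isProbabilityMeasure_stationaryLaw hV_pos hVR₁
  set π₀ : ProbabilityMeasure ℝ :=
    ⟨IsOnPeriod.stationaryLaw P (shift J τ) (stoppedValue J τ) R₁, this⟩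
  have hπ₀ : IsOnSteadyState P J τ R π₀ := by
    refine h.isSteadyStateLaw_stationaryLaw hV_pos hVR₁ ?_ π₀ rfl
    filter_upwards [hτt, hR₁R] with ω h1 h2 s
    exact onWorkload_eq_workload_shift h1 h2 s
  refine ⟨⟨π₀, hπ₀, fun π hπ => hπ.unique hπ₀⟩, fun π hπ => ?_⟩
  obtain rfl : π = π₀ := hπ.unique hπ₀
  have hlst : ∀ α : ℝ, 0 ≤ α →
      Integrable (fun ω => onTransform (exponent P J) (meanRate P J) α (stoppedValue J τ ω) (R ω)) P ∧
        lst π₀ α = (∫ ω, onTransform (exponent P J) (meanRate P J) α (stoppedValue J τ ω) (R ω) ∂P) /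
          ∫ ω, stoppedValue J τ ω / (R ω - meanRate P J) ∂P := by
    intro α hα
    have h1 := h.lst_stationaryLaw hVR₁ hα
    rw [meanRate_shift hJ hτ hτt, exponent_shift hJ hτ hτt] at h1
    have h2 : (fun ω => onTransform (exponent P J) (meanRate P J) α (stoppedValue J τ ω) (R₁ ω))
        =ᵐ[P] fun ω => onTransform (exponent P J) (meanRate P J) α (stoppedValue J τ ω) (R ω) := by
      filter_upwards [hR₁R] with ω hω
      rw [hω]
    have h3 : (fun ω => stoppedValue J τ ω / (R₁ ω - meanRate P J))
        =ᵐ[P] fun ω => stoppedValue J τ ω / (R ω - meanRate P J) := by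
      filter_upwards [hR₁R] with ω hω
      rw [hω]
    rw [integral_congr_ae h2, integral_congr_ae h3] at h1
    exact ⟨h1.1.congr h2, h1.2⟩
  refine ⟨h.stationaryLaw_Iio, hlst, ?_⟩
  intro Ω' _ P' _ V' R' U N e hid hdec α hα
  -- All that enters about `(V', R')` is its joint law, so positivity, integrability and the two
  -- integrals transfer from `(V, R)`.
  have hV' : ∀ᵐ ω ∂P', 0 < V' ω :=
    hid.symm.ae_mem_snd (t := {p : ℝ × ℝ | 0 < p.1}) (measurableSet_lt measurable_const measurable_fst)
      hV_pos
  have hR' : ∀ᵐ ω ∂P', meanRate P J < R' ω :=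
    hid.symm.ae_mem_snd (t := {p : ℝ × ℝ | meanRate P J < p.2})
      (measurableSet_lt measurable_const measurable_snd) hR_gt
  have hm : Measurable fun p : ℝ × ℝ => p.1 / (p.2 - meanRate P J) := by fun_prop
  have hm' : Measurable fun p : ℝ × ℝ =>
      onTransform (exponent P J) (meanRate P J) α p.1 p.2 := by
    unfold onTransform
    split_ifs <;> fun_prop
  have hVR' : Integrable (fun ω => V' ω / (R' ω - meanRate P J)) P' :=
    (hid.comp hm).integrable_iff.2 hVR
  rw [hdec.integral_sizeBiased hJ.meanRate_nonneg hV' hR' hVR' hα, (hlst α hα).2]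
  exact congrArg₂ _ (hid.comp hm').integral_eq.symm (hid.comp hm).integral_eq.symm
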